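/- Let $\Theta=(\theta_i)_{i\ge 0}$ be a sequence in $\mathbb{R}^+=[0,\infty)$ with $\sum_{i\ge 0}\theta_i^2=1$, $\theta_1\ge\theta_2\ge\cdots$, and either $\theta_0\neq 0$ or $\sum_{i\ge 1}\theta_i=\infty$. Let $(X_i)_{i\ge 1}$ be independent random variables, $X_i$ being exponential of parameter $\theta_i$ (when $\theta_i=0$ the variable $X_i$ plays no role), and let $\mu$ be the random measure on $\mathbb{R}^+$ \[ \mu=\theta_0^2\,dx+\sum_{i\ge 1}\theta_i\,\delta_{X_i}. \] For $l\ge 0$ let $\mu_l$ be the restriction of $\mu$ to $[0,l]$. Conditionally on $\mu$, let $Y_1<Y_2<\cdots$ be the points of a Poisson point process on $\mathbb{R}^+$ of rate $\mu[0,l]\,dl$; conditionally on $\mu$ and $(Y_i)_{i\ge 1}$, let $(Z_i)_{i\ge 1}$ be independent with respective laws $\mu_{Y_i}/\mu[0,Y_i]$. Put $Y_0=Z_0=0$, let $d_0$ be the trivial distance on $\{0\}$, and for $n\ge 1$ let $d_n$ be the distance on $[0,Y_n]$ such that, for $x\le y$, $d_n(x,y)=d_{n-1}(x,y)$ if $x,y\in[0,Y_{n-1}]$,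 $d_n(x,y)=d_{n-1}(x,Z_{n-1})+y-Y_{n-1}$ if $x\le Y_{n-1}<y$, and $d_n(x,y)=|x-y|$ if $x,y\in(Y_{n-1},Y_n]$. Let $d$ be the metric on $\mathbb{R}^+$ which agrees with $d_n$ on $[0,Y_n]$ for every $n$. The inhomogeneous continuum random tree (ICRT) $\mathcal{T}$ of parameter $\Theta$ is the completion of $(\mathbb{R}^+,d)$. Then almost surely this construction is well defined (the $Y_i$ are strictly increasing to $\infty$, $Z_i\le Y_i$ for every $i$, and $0<\mu[0,l]<\infty$ for every $l>0$), and there is a Borel probability measure $p$ on $\mathcal{T}$ such that \[ p_l:=\frac{\mu_l}{\mu[0,l]}\longrightarrow p\quad\text{weakly on }\mathcal{T}\text{ as } l\to\infty, \] where $\mu_l$ is viewed as a measure on $\mathcal{T}$ through the inclusion $\mathbb{R}^+\subset\mathcal{T}$. Furthermore $p$ has support $\mathcal{T}$, has no atoms, and gives measure $1$ to the set of leaves, that is, the set of $x\in\mathcal{T}$ such that $\mathcal{T}\setminus\{x\}$ is connected. -/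

import Mathlib

open MeasureTheory ProbabilityTheory Filter Topology Set
open scoped NNReal ENNReal

/-- The input of the stick-breaking construction: an increasing sequence of cuts
`y₁ < y₂ < ⋯` tending to infinity and glue points `zᵢ ≤ yᵢ`, all in `ℝ⁺`.
The value `cut k` is the `(k+1)`-st cut `y_{k+1}`, and `glue k` is `z_{k+1}`. -/
structure StickBreaking where
  cut : ℕ → ℝ≥0
  glue : ℕ → ℝ≥0
  cut_strictMono : StrictMono cut
  cut_tendsto : Tendsto cut atTop atTop
  glue_le : ∀ i, glue i ≤ cut i

namespace StickBreaking

variable (S : StickBreaking)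

/-- The cuts `y₀, y₁, y₂, …` with the convention `y₀ = 0`. -/
def y : ℕ → ℝ≥0
  | 0 => 0
  | n + 1 => S.cut n

/-- The glue points `z₀, z₁, z₂, …` with the convention `z₀ = 0`. -/
def z : ℕ → ℝ≥0
  | 0 => 0
  | n + 1 => S.glue n

/-- The distance `dₙ`; only its values on `[0, yₙ]` matter. -/
noncomputable def d : ℕ → ℝ≥0 → ℝ≥0 → ℝ
  | 0, _, _ => 0
  | n + 1, s, t =>
    if s ≤ S.y n then
      if t ≤ S.y n then d n s t else d n s (S.z n) + ((t : ℝ) - S.y n)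
    else
      if t ≤ S.y n then d n t (S.z n) + ((s : ℝ) - S.y n) else |(s : ℝ) - t|

theorem y_mono : Monotone S.y := by
  refine monotone_nat_of_le_succ fun n => ?_
  cases n with
  | zero => exact bot_le
  | succ n => exact S.cut_strictMono.monotone (Nat.le_succ n)

theorem z_le_y (n : ℕ) : S.z n ≤ S.y n := by
  cases n with
  | zero => exact le_rfl
  | succ n => exact S.glue_le n

theorem exists_le_y (s t : ℝ≥0) : ∃ n, s ≤ S.y n ∧ t ≤ S.y n := by
  obtain ⟨n, hn⟩ := (S.cut_tendsto.eventually_ge_atTop (max s t)).exists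
  exact ⟨n + 1, (le_max_left s t).trans hn, (le_max_right s t).trans hn⟩

theorem d_succ {n : ℕ} {s t : ℝ≥0} (hs : s ≤ S.y n) (ht : t ≤ S.y n) :
    S.d (n + 1) s t = S.d n s t := by
  simp [d, hs, ht]

theorem d_eq_of_le {m n : ℕ} (h : m ≤ n) {s t : ℝ≥0} (hs : s ≤ S.y m) (ht : t ≤ S.y m) :
    S.d n s t = S.d m s t := by
  induction n, h using Nat.le_induction with
  | base => rfl
  | succ n h ih =>
    rw [S.d_succ (hs.trans (S.y_mono h)) (ht.trans (S.y_mono h)), ih]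

theorem d_self (n : ℕ) (s : ℝ≥0) : S.d n s s = 0 := by
  induction n with
  | zero => rfl
  | succ n ih => by_cases h : s ≤ S.y n <;> simp [d, h, ih]

theorem d_comm (n : ℕ) (s t : ℝ≥0) : S.d n s t = S.d n t s := by
  induction n with
  | zero => rfl
  | succ n ih =>
    by_cases hs : s ≤ S.y n <;> by_cases ht : t ≤ S.y n <;> simp [d, hs, ht, ih, abs_sub_comm]

theorem d_nonneg (n : ℕ) (s t : ℝ≥0) : 0 ≤ S.d n s t := by
  induction n generalizing s t with
  | zero => exact le_rfl
  | succ n ih =>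
    simp only [d]
    split_ifs with hs ht ht
    · exact ih s t
    · have : (S.y n : ℝ) ≤ t := by exact_mod_cast (not_le.1 ht).le
      linarith [ih s (S.z n)]
    · have : (S.y n : ℝ) ≤ s := by exact_mod_cast (not_le.1 hs).le
      linarith [ih t (S.z n)]
    · exact abs_nonneg _

theorem d_triangle (n : ℕ) (s t u : ℝ≥0) (hs : s ≤ S.y n) (ht : t ≤ S.y n) (hu : u ≤ S.y n) :
    S.d n s u ≤ S.d n s t + S.d n t u := by
  induction n generalizing s t u with
  | zero => simp [d]
  | succ n ih =>
    have hz := S.z_le_y n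
    have cast_lt : ∀ {a : ℝ≥0}, ¬ a ≤ S.y n → (S.y n : ℝ) < a := fun h => by
      exact_mod_cast not_le.1 h
    by_cases h1 : s ≤ S.y n <;> by_cases h2 : t ≤ S.y n <;> by_cases h3 : u ≤ S.y n <;>
      simp only [d, h1, h2, h3, if_true, if_false]
    · exact ih s t u h1 h2 h3
    · linarith [ih s t (S.z n) h1 h2 hz]
    · have := ih s (S.z n) u h1 hz h3
      rw [S.d_comm n (S.z n) u] at this
      linarith [cast_lt h2]
    · linarith [neg_abs_le ((t : ℝ) - u)]
    · have := ih u t (S.z n) h3 h2 hz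
      rw [S.d_comm n u t] at this
      linarith
    · have := S.d_nonneg n t (S.z n)
      rw [abs_le]
      constructor <;> linarith [cast_lt h1, cast_lt h3]
    · linarith [le_abs_self ((s : ℝ) - t)]
    · exact abs_sub_le _ _ _

theorem eq_of_d_eq_zero (n : ℕ) (s t : ℝ≥0) (hs : s ≤ S.y n) (ht : t ≤ S.y n)
    (h : S.d n s t = 0) : s = t := by
  induction n generalizing s t with
  | zero =>
    have h0 : S.y 0 = 0 := rfl
    rw [h0] at hs ht
    rw [le_antisymm hs bot_le, le_antisymm ht bot_le]
  | succ n ih =>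
    have cast_lt : ∀ {a : ℝ≥0}, ¬ a ≤ S.y n → (S.y n : ℝ) < a := fun h => by
      exact_mod_cast not_le.1 h
    by_cases h1 : s ≤ S.y n <;> by_cases h2 : t ≤ S.y n <;>
      simp only [d, h1, h2, if_true, if_false] at h
    · exact ih s t h1 h2 h
    · linarith [S.d_nonneg n s (S.z n), cast_lt h2]
    · linarith [S.d_nonneg n t (S.z n), cast_lt h1]
    · exact_mod_cast sub_eq_zero.1 (abs_eq_zero.1 h)

/-- The half-line `ℝ⁺`, to be equipped with the glued distance of `S`. -/
def Line (_S : StickBreaking) : Type := ℝ≥0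

open Classical in
/-- The distance on `ℝ⁺` which agrees with `dₙ` on `[0, yₙ]` for every `n`. -/
noncomputable def lineDist (s t : ℝ≥0) : ℝ := S.d (Nat.find (S.exists_le_y s t)) s t

theorem lineDist_eq {n : ℕ} {s t : ℝ≥0} (hs : s ≤ S.y n) (ht : t ≤ S.y n) :
    S.lineDist s t = S.d n s t := by
  classical
  have hf := Nat.find_spec (S.exists_le_y s t)
  have hle : Nat.find (S.exists_le_y s t) ≤ n := Nat.find_min' _ ⟨hs, ht⟩
  unfold lineDist
  rw [S.d_eq_of_le (n := n) (m := Nat.find (S.exists_le_y s t)) hle hf.1 hf.2]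

theorem lineDist_comm (s t : ℝ≥0) : S.lineDist s t = S.lineDist t s := by
  obtain ⟨n, h1, h2⟩ := S.exists_le_y s t
  rw [S.lineDist_eq h1 h2, S.lineDist_eq h2 h1, S.d_comm]

theorem lineDist_triangle (s t u : ℝ≥0) :
    S.lineDist s u ≤ S.lineDist s t + S.lineDist t u := by
  obtain ⟨n, h1, h2⟩ := S.exists_le_y (max s t) u
  have hs := (le_max_left s t).trans h1
  have ht := (le_max_right s t).trans h1
  rw [S.lineDist_eq hs h2, S.lineDist_eq hs ht, S.lineDist_eq ht h2]
  exact S.d_triangle _ s t u hs ht h2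

theorem eq_of_lineDist_eq_zero (s t : ℝ≥0) (h : S.lineDist s t = 0) : s = t := by
  obtain ⟨n, h1, h2⟩ := S.exists_le_y s t
  rw [S.lineDist_eq h1 h2] at h
  exact S.eq_of_d_eq_zero n s t h1 h2 h

noncomputable instance : MetricSpace S.Line where
  dist s t := S.lineDist s t
  dist_self s := S.d_self _ s
  dist_comm s t := S.lineDist_comm s t
  dist_triangle s t u := S.lineDist_triangle s t u
  eq_of_dist_eq_zero {s t} h := S.eq_of_lineDist_eq_zero s t h

/-- The tree `SB(y, z)`: the completion of `(ℝ⁺, d)`. -/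
abbrev Tree : Type := UniformSpace.Completion S.Line

noncomputable instance : MeasurableSpace S.Tree := borel _

instance : BorelSpace S.Tree := ⟨rfl⟩

/-- The canonical map from `ℝ⁺` to the tree. -/
noncomputable def toTree (x : ℝ≥0) : S.Tree := UniformSpace.Completion.coe' (show S.Line from x)

/-- The leaves of the tree: the points whose removal leaves the tree connected. -/
def leaves : Set S.Tree := {x | IsConnected ({x}ᶜ : Set S.Tree)}

end StickBreaking

/-- The parameter space: sequences `Θ = (θ₀, θ₁, …)` in `ℝ⁺`. -/
structure IsICRTParameter (θ : ℕ → ℝ≥0) : Prop where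
  sum_sq : HasSum (fun i => θ i ^ 2) 1
  antitone : Antitone fun i => θ (i + 1)
  ne_zero_or : θ 0 ≠ 0 ∨ ¬ Summable fun i => θ (i + 1)

/-- Lebesgue measure on `ℝ⁺`. -/
noncomputable def lebesgue : Measure ℝ≥0 := Measure.comap ((↑) : ℝ≥0 → ℝ) volume

/-- The measure `μ = θ₀² dx + ∑_{i ≥ 1} θᵢ δ_{Xᵢ}` on `ℝ⁺`, where `x i` is `X_{i+1}`. -/
noncomputable def massMeasure (θ : ℕ → ℝ≥0) (x : ℕ → ℝ≥0) : Measure ℝ≥0 :=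
  θ 0 ^ 2 • lebesgue + Measure.sum fun i => θ (i + 1) • Measure.dirac (x i)

/-- Conditionally on the `σ`-algebra `𝓖`, the points `Y i` form a Poisson point process on `ℝ⁺`
with (random) intensity measure `Λ`: the numbers of points in disjoint bounded Borel sets are
conditionally independent Poisson variables whose means are the intensities of these sets. -/
def IsCondPoissonProcess {Ω : Type*} {mΩ : MeasurableSpace Ω} (P : Measure Ω)
    (𝓖 : MeasurableSpace Ω) (Λ : Ω → Measure ℝ≥0) (Y : ℕ → Ω → ℝ≥0) : Prop :=
  ∀ (k : ℕ) (B : Fin k → Set ℝ≥0) (n : Fin k → ℕ),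
    (∀ j, MeasurableSet (B j)) → (∀ j, Bornology.IsBounded (B j)) →
    Pairwise (fun i j => Disjoint (B i) (B j)) →
    P⟦{ω | ∀ j, {i | Y i ω ∈ B j}.encard = n j} | 𝓖⟧
      =ᵐ[P] fun ω => ∏ j, (poissonMeasure (Λ ω (B j)).toNNReal).real {n j}

/-- Conditionally on the `σ`-algebra `𝓖`, the variables `Z i` are independent with respective
(random) laws `ν i`. -/
def IsCondIndepWithLaws {Ω : Type*} {mΩ : MeasurableSpace Ω} (P : Measure Ω)
    (𝓖 : MeasurableSpace Ω) (ν : ℕ → Ω → Measure ℝ≥0) (Z : ℕ → Ω → ℝ≥0) : Prop :=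
  ∀ (k : ℕ) (C : Fin k → Set ℝ≥0), (∀ j, MeasurableSet (C j)) →
    P⟦{ω | ∀ j : Fin k, Z j ω ∈ C j} | 𝓖⟧ =ᵐ[P] fun ω => ∏ j : Fin k, (ν j ω).real (C j)

/-- The random ingredients of the inhomogeneous continuum random tree of parameter `θ`.
Here `X i`, `Y i`, `Z i` stand for `X_{i+1}`, `Y_{i+1}`, `Z_{i+1}`. A variable `X i` whose rate
`θ (i + 1)` is zero has weight zero in `μ`, and its law is left free. -/
structure IsICRTConstruction {Ω : Type*} {mΩ : MeasurableSpace Ω} (P : Measure Ω)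
    (θ : ℕ → ℝ≥0) (X Y Z : ℕ → Ω → ℝ≥0) : Prop where
  measurable_X : ∀ i, Measurable (X i)
  measurable_Y : ∀ i, Measurable (Y i)
  measurable_Z : ∀ i, Measurable (Z i)
  /-- The `Xᵢ` are independent, -/
  indep_X : iIndepFun X P
  /-- and `Xᵢ` is exponential of parameter `θᵢ`. -/
  law_X : ∀ i, 0 < θ (i + 1) → HasLaw (fun ω => (X i ω : ℝ)) (expMeasure (θ (i + 1))) P
  /-- The points `Yᵢ` are enumerated in increasing order. -/
  strictMono_Y : ∀ᵐ ω ∂P, StrictMono fun i => Y i ω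
  /-- Conditionally on `μ`, they are a Poisson point process of rate `μ[0, l] dl`. -/
  poisson_Y : IsCondPoissonProcess P
    (MeasurableSpace.comap (fun ω => massMeasure θ fun i => X i ω) inferInstance)
    (fun ω => lebesgue.withDensity fun l => massMeasure θ (fun i => X i ω) (Icc 0 l)) Y
  /-- Conditionally on `μ` and `Y`, the `Zᵢ` are independent with laws `μ_{Yᵢ} / μ[0, Yᵢ]`. -/
  law_Z : IsCondIndepWithLaws P
    (MeasurableSpace.comap (fun ω => (massMeasure θ fun i => X i ω, fun i => Y i ω)) inferInstance)
    (fun i ω => (massMeasure θ fun j => X j ω)[|Icc 0 (Y i ω)]) Z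

/-!
# The mass measure of the inhomogeneous continuum random tree

Fix first the mass measure `μ` and the cuts `Y`, so that the only randomness left is in the glue
points `z k`, which are independent with laws `p k = μ[|Icc 0 (Y k)]`. For `m ≤ k` the tree with
`k + 1` sticks projects onto the tree with `m + 1` sticks: `proj` collapses each later stick to its
glue point, and `height` is the distance to the projection. Since `p (k + 1)` is a mixture of `p k`
and of a law on the new stick (`IsUrn`), and since `z k` has law `p k` itself, the `p k`-averages
of functionals which are transported along the gluing (`IsSprouting`) are submartingales. They
converge almost surely when their expected increments are summable
(`IsSprouting.ae_tendsto_avg`). With `a k` the proportion of the mass of `[0, Y (k + 1)]` which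
lies on the last stick, this gives the following.

* The `p k`-mass of the points which project into a given set is a bounded martingale, and
  `∑ a k (Y (k + 1) - Y k) < ∞` makes the mean height over the level `m` small, uniformly in the
  later levels, as `m → ∞` (`IsUrn.ae_height_small`). Hence the laws are tight and converge weakly
  along the cuts (`exists_tendsto_map`). As `a k → 0`, the convergence extends to all truncation
  levels (`exists_tendsto_of_tendsto_cut`).
* As `μ` has infinite mass, the laws leave each fixed subtree, and small neighbourhoods of a
  subtree have small mass (`IsUrn.ae_mass_near_subtree`). The limit does not charge `ℝ⁺`, and every
  point added by the completion is a leaf (`mem_leaves_of_notMem_range`).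
* The expected number of close pairs among two independent points grows by at most `a k ^ 2` at
  each step, so `∑ a k ^ 2 < ∞` excludes atoms (`IsUrn.ae_pair_far`).
* A second moment estimate for the martingale of masses, which needs
  `∑ μ[0, Y k] a k ^ 2 < ∞`, shows that every interval keeps some mass in a neighbourhood
  (`IsUrn.ae_mass_pos`), so the support is the whole tree.

It remains to see that the two series converge almost surely. The Poisson process of cuts enters
only through the probability `exp (-Λ [s, t))` that it avoids an interval `[s, t)`, where `Λ` is its
intensity. A sum over sticks is an integral over pairs of points which no cut separates, so
its expectation is an integral against avoidance probabilities (`lintegral_tsum_gap_le`). The first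
series is then finite for every `μ` (`ae_sum_length`), and the second one reduces to the finiteness
of a number of close pairs of points of `μ` (`ae_sum_sq`). That number has finite expectation
because each exponential variable `X i` has a density at most `θ i` and is independent of the rest
of `μ`, while `∑ θ i ^ 2 < ∞` (`ae_lintegral_close_ne_top`).

Finally, statements proved for fixed `μ` and `Y` are transferred to the random ones through regular
conditional distributions (`ae_iff_ae_condDistrib`). This requires each property used to be a
measurable condition, which is why they are stated through countably many functionals
(`IsGoodGluing`).
-/

namespace ICRT

/-! ### Projections, heights and distances along the construction -/

/-- The projection of the tree built from `[0, Y k]` onto the subtree built from `[0, Y m]`, read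
on the half-line: every stick beyond `Y m` is collapsed to its glue point. The level `k` counts
the sticks that have been glued; only the values on `[0, Y k]` matter, and for `k ≤ m` the map is
the identity. -/
noncomputable def proj (Y Z : ℕ → ℝ≥0) (m : ℕ) : ℕ → ℝ≥0 → ℝ≥0
  | 0, x => x
  | k + 1, x => if k < m then x else if x ≤ Y k then proj Y Z m k x else proj Y Z m k (Z k)

/-- The height of the point `x ∈ [0, Y k]` above the subtree built from `[0, Y m]`, that is, its
distance to `proj Y Z m k x` in the tree. -/
noncomputable def height (Y Z : ℕ → ℝ≥0) (m : ℕ) : ℕ → ℝ≥0 → ℝ≥0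
  | 0, _ => 0
  | k + 1, x =>
    if k < m then 0 else if x ≤ Y k then height Y Z m k x else height Y Z m k (Z k) + (x - Y k)

/-- The glued distance on `[0, Y k]`, for arbitrary sequences of cuts and glue points: unlike
`StickBreaking.lineDist`, it is a function of the sequences alone, hence jointly measurable in
them. -/
noncomputable def rawDist (Y Z : ℕ → ℝ≥0) : ℕ → ℝ≥0 → ℝ≥0 → ℝ
  | 0, s, t => |(s : ℝ) - t|
  | k + 1, s, t =>
    if s ≤ Y k then
      if t ≤ Y k then rawDist Y Z k s t else rawDist Y Z k s (Z k) + ((t : ℝ) - Y k)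
    else
      if t ≤ Y k then rawDist Y Z k t (Z k) + ((s : ℝ) - Y k) else |(s : ℝ) - t|

section Raw

variable {Y Z : ℕ → ℝ≥0} {m k : ℕ} {x : ℝ≥0}

theorem proj_of_le (h : k ≤ m) : proj Y Z m k x = x := by
  cases k with
  | zero => rfl
  | succ k => simp [proj, Nat.lt_of_succ_le h]

theorem height_of_le (h : k ≤ m) : height Y Z m k x = 0 := by
  cases k with
  | zero => rfl
  | succ k => simp [height, Nat.lt_of_succ_le h]

theorem proj_succ_of_le (h : x ≤ Y k) : proj Y Z m (k + 1) x = proj Y Z m k x := by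
  by_cases hk : k < m
  · rw [proj_of_le hk, proj_of_le hk.le]
  · simp [proj, hk, h]

theorem proj_succ_of_lt (hk : m ≤ k) (h : Y k < x) :
    proj Y Z m (k + 1) x = proj Y Z m k (Z k) := by
  simp [proj, hk.not_gt, h.not_ge]

theorem height_succ_of_le (h : x ≤ Y k) : height Y Z m (k + 1) x = height Y Z m k x := by
  by_cases hk : k < m
  · rw [height_of_le hk, height_of_le hk.le]
  · simp [height, hk, h]

theorem height_succ_of_lt (hk : m ≤ k) (h : Y k < x) :
    height Y Z m (k + 1) x = height Y Z m k (Z k) + (x - Y k) := by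
  simp [height, hk.not_gt, h.not_ge]

end Raw

section Tree

variable (S : StickBreaking) {m k : ℕ} {s t x : ℝ≥0}

theorem cut_mono : Monotone S.cut := S.cut_strictMono.monotone

theorem lineDist_self (s : ℝ≥0) : S.lineDist s s = 0 := S.d_self _ s

theorem lineDist_nonneg (s t : ℝ≥0) : 0 ≤ S.lineDist s t := S.d_nonneg _ s t

theorem lineDist_of_le_zero (hs : s ≤ S.cut 0) (ht : t ≤ S.cut 0) :
    S.lineDist s t = |(s : ℝ) - t| := by
  rw [S.lineDist_eq (n := 1) hs ht]
  have h0 : S.y 0 = 0 := rfl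
  by_cases h1 : s ≤ 0 <;> by_cases h2 : t ≤ 0 <;> simp [StickBreaking.d, h0] <;> aesop

theorem lineDist_of_le_of_lt (hs : s ≤ S.cut k) (ht : S.cut k < t) (ht' : t ≤ S.cut (k + 1)) :
    S.lineDist s t = S.lineDist s (S.glue k) + ((t : ℝ) - S.cut k) := by
  rw [S.lineDist_eq (n := k + 2) (hs.trans (cut_mono S k.le_succ)) ht',
    S.lineDist_eq (n := k + 1) hs (S.glue_le k)]
  have h : S.y (k + 1) = S.cut k := rfl
  have h' : S.z (k + 1) = S.glue k := rfl
  rw [StickBreaking.d, h, h', if_pos hs, if_neg ht.not_ge]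

theorem lineDist_of_lt_of_lt (hs : S.cut k < s) (hs' : s ≤ S.cut (k + 1)) (ht : S.cut k < t)
    (ht' : t ≤ S.cut (k + 1)) : S.lineDist s t = |(s : ℝ) - t| := by
  rw [S.lineDist_eq (n := k + 2) hs' ht']
  have h : S.y (k + 1) = S.cut k := rfl
  rw [StickBreaking.d, h, if_neg hs.not_ge, if_neg ht.not_ge]

theorem rawDist_eq_lineDist (hs : s ≤ S.cut k) (ht : t ≤ S.cut k) :
    rawDist S.cut S.glue k s t = S.lineDist s t := by
  induction k generalizing s t with
  | zero => rw [lineDist_of_le_zero S hs ht]; rfl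
  | succ k ih =>
    by_cases h1 : s ≤ S.cut k <;> by_cases h2 : t ≤ S.cut k <;> simp only [rawDist, h1, h2,
      if_true, if_false]
    · exact ih h1 h2
    · rw [ih h1 (S.glue_le k), lineDist_of_le_of_lt S h1 (not_le.1 h2) ht]
    · rw [ih h2 (S.glue_le k), S.lineDist_comm s t, lineDist_of_le_of_lt S h2 (not_le.1 h1) hs]
    · rw [lineDist_of_lt_of_lt S (not_le.1 h1) hs (not_le.1 h2) ht]

theorem proj_le (hk : m ≤ k) (hx : x ≤ S.cut k) : proj S.cut S.glue m k x ≤ S.cut m := by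
  induction k, hk using Nat.le_induction generalizing x with
  | base => rwa [proj_of_le le_rfl]
  | succ k hk ih =>
    rcases le_or_gt x (S.cut k) with h | h
    · rw [proj_succ_of_le h]; exact ih h
    · rw [proj_succ_of_lt hk h]; exact ih (S.glue_le k)

theorem lineDist_proj_le (hk : m ≤ k) (hx : x ≤ S.cut k) :
    S.lineDist x (proj S.cut S.glue m k x) ≤ height S.cut S.glue m k x := by
  induction k, hk using Nat.le_induction generalizing x with
  | base => rw [proj_of_le le_rfl, lineDist_self]; exact NNReal.coe_nonneg _
  | succ k hk ih =>
    rcases le_or_gt x (S.cut k) with h | h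
    · rw [proj_succ_of_le h, height_succ_of_le h]; exact ih h
    · have := ih (S.glue_le k)
      rw [proj_succ_of_lt hk h, height_succ_of_lt hk h, S.lineDist_comm,
        lineDist_of_le_of_lt S ((proj_le S hk (S.glue_le k)).trans (cut_mono S hk)) h hx,
        S.lineDist_comm, NNReal.coe_add, NNReal.coe_sub h.le]
      linarith

theorem height_le_lineDist (hk : m ≤ k) (hx : x ≤ S.cut k) (ht : t ≤ S.cut m) :
    height S.cut S.glue m k x ≤ S.lineDist x t := by
  induction k, hk using Nat.le_induction generalizing x with
  | base => rw [height_of_le le_rfl]; exact lineDist_nonneg S _ _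
  | succ k hk ih =>
    rcases le_or_gt x (S.cut k) with h | h
    · rw [height_succ_of_le h]; exact ih h
    · have := ih (S.glue_le k)
      rw [height_succ_of_lt hk h, S.lineDist_comm,
        lineDist_of_le_of_lt S (ht.trans (cut_mono S hk)) h hx, S.lineDist_comm,
        NNReal.coe_add, NNReal.coe_sub h.le]
      linarith

theorem lineDist_proj_proj_le (hk : m ≤ k) (hs : s ≤ S.cut k) (ht : t ≤ S.cut k) :
    S.lineDist (proj S.cut S.glue m k s) (proj S.cut S.glue m k t) ≤ S.lineDist s t := by
  induction k, hk using Nat.le_induction generalizing s t with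
  | base => rw [proj_of_le le_rfl, proj_of_le le_rfl]
  | succ k hk ih =>
    have hz := S.glue_le k
    rcases le_or_gt s (S.cut k) with h | h <;> rcases le_or_gt t (S.cut k) with h' | h'
    · rw [proj_succ_of_le h, proj_succ_of_le h']; exact ih h h'
    · rw [proj_succ_of_le h, proj_succ_of_lt hk h', lineDist_of_le_of_lt S h h' ht]
      have : (S.cut k : ℝ) < t := by exact_mod_cast h'
      linarith [ih h hz]
    · rw [proj_succ_of_lt hk h, proj_succ_of_le h', S.lineDist_comm s,
        lineDist_of_le_of_lt S h' h hs, S.lineDist_comm]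
      have : (S.cut k : ℝ) < s := by exact_mod_cast h
      linarith [ih h' hz]
    · rw [proj_succ_of_lt hk h, proj_succ_of_lt hk h', lineDist_self]
      exact lineDist_nonneg S _ _

theorem height_anti {m' : ℕ} (hm : m ≤ m') (hk : m' ≤ k) (hx : x ≤ S.cut k) :
    height S.cut S.glue m' k x ≤ height S.cut S.glue m k x := by
  have h := (height_le_lineDist S hk hx
    ((proj_le S (hm.trans hk) hx).trans (cut_mono S hm))).trans
    (lineDist_proj_le S (hm.trans hk) hx)
  exact_mod_cast h

/-! ### Topology of the tree -/

theorem dist_toTree (s t : ℝ≥0) : dist (S.toTree s) (S.toTree t) = S.lineDist s t :=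
  UniformSpace.Completion.dist_eq (α := S.Line) s t

theorem denseRange_toTree : DenseRange S.toTree :=
  UniformSpace.Completion.denseRange_coe (α := S.Line)

/-- On the closed interval `[cut k, cut (k + 1)]`, moving the left end to the glue point gives an
isometric copy of the glued stick. -/
theorem dist_stick (hs : s ∈ Icc (S.cut k) (S.cut (k + 1)))
    (ht : t ∈ Icc (S.cut k) (S.cut (k + 1))) :
    dist (S.toTree (if s = S.cut k then S.glue k else s))
      (S.toTree (if t = S.cut k then S.glue k else t)) = dist s t := by
  rw [dist_toTree, NNReal.dist_eq]
  by_cases h1 : s = S.cut k <;> by_cases h2 : t = S.cut k <;> simp only [h1, h2, if_true, if_false]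
  · simp [lineDist_self]
  · have h2' : S.cut k < t := lt_of_le_of_ne ht.1 (Ne.symm h2)
    rw [lineDist_of_le_of_lt S (S.glue_le k) h2' ht.2, lineDist_self, abs_sub_comm,
      abs_of_pos (sub_pos.2 (by exact_mod_cast h2')), zero_add]
  · have h1' : S.cut k < s := lt_of_le_of_ne hs.1 (Ne.symm h1)
    rw [S.lineDist_comm, lineDist_of_le_of_lt S (S.glue_le k) h1' hs.2, lineDist_self,
      abs_of_pos (sub_pos.2 (by exact_mod_cast h1')), zero_add]
  · exact lineDist_of_lt_of_lt S (lt_of_le_of_ne hs.1 (Ne.symm h1)) hs.2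
      (lt_of_le_of_ne ht.1 (Ne.symm h2)) ht.2

theorem continuousOn_stick (k : ℕ) :
    ContinuousOn (fun s => S.toTree (if s = S.cut k then S.glue k else s))
      (Icc (S.cut k) (S.cut (k + 1))) := by
  rw [Metric.continuousOn_iff]
  exact fun b hb ε hε => ⟨ε, hε, fun a ha h => by rwa [dist_stick S ha hb]⟩

theorem continuousOn_base : ContinuousOn S.toTree (Iic (S.cut 0)) := by
  rw [Metric.continuousOn_iff]
  refine fun b hb ε hε => ⟨ε, hε, fun a ha h => ?_⟩
  rwa [dist_toTree, lineDist_of_le_zero S ha hb, ← NNReal.dist_eq]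

theorem image_Iic_succ (k : ℕ) :
    S.toTree '' Iic (S.cut (k + 1)) = S.toTree '' Iic (S.cut k) ∪
      (fun s => S.toTree (if s = S.cut k then S.glue k else s)) ''
        Icc (S.cut k) (S.cut (k + 1)) := by
  ext w
  constructor
  · rintro ⟨s, hs, rfl⟩
    rcases le_or_gt s (S.cut k) with h | h
    · exact Or.inl ⟨s, h, rfl⟩
    · exact Or.inr ⟨s, ⟨h.le, hs⟩, by simp [h.ne']⟩
  · rintro (⟨s, hs, rfl⟩ | ⟨s, hs, rfl⟩)
    · exact ⟨s, le_trans hs (cut_mono S k.le_succ), rfl⟩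
    · by_cases h : s = S.cut k
      · exact ⟨S.glue k, (S.glue_le k).trans (cut_mono S k.le_succ), by simp [h]⟩
      · exact ⟨s, hs.2, by simp [h]⟩

/-- The subtree built from `[0, cut k]` is compact: it is a finite union of segments. -/
theorem isCompact_image_Iic (k : ℕ) : IsCompact (S.toTree '' Iic (S.cut k)) := by
  induction k with
  | zero =>
    have : Iic (S.cut 0) = Icc 0 (S.cut 0) := by ext; simp
    exact (this ▸ isCompact_Icc).image_of_continuousOn (continuousOn_base S)
  | succ k ih =>
    rw [image_Iic_succ]
    exact ih.union (isCompact_Icc.image_of_continuousOn (continuousOn_stick S k))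

theorem isPreconnected_image_Iic (k : ℕ) : IsPreconnected (S.toTree '' Iic (S.cut k)) := by
  induction k with
  | zero => exact (isPreconnected_Iic).image _ (continuousOn_base S)
  | succ k ih =>
    rw [image_Iic_succ]
    refine IsPreconnected.union (S.toTree (S.glue k)) ⟨_, S.glue_le k, rfl⟩
      ⟨S.cut k, ⟨le_rfl, cut_mono S k.le_succ⟩, by simp⟩ ih
      (isPreconnected_Icc.image _ (continuousOn_stick S k))

theorem range_toTree_eq : range S.toTree = ⋃ k, S.toTree '' Iic (S.cut k) := by
  rw [← image_iUnion, ← image_univ]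
  congr 1
  symm
  rw [eq_univ_iff_forall]
  intro x
  obtain ⟨k, hk⟩ := (S.cut_tendsto.eventually_ge_atTop x).exists
  exact mem_iUnion.2 ⟨k, hk⟩

/-- Every point added by the completion is a leaf: the rest of the tree contains the connected
dense set `ℝ⁺`. -/
theorem mem_leaves_of_notMem_range {x : S.Tree} (hx : x ∉ range S.toTree) : x ∈ S.leaves := by
  have hpre : IsPreconnected (range S.toTree) := by
    rw [range_toTree_eq]
    refine isPreconnected_iUnion ⟨S.toTree 0, mem_iInter.2 fun k => ⟨0, by simp, rfl⟩⟩
      (isPreconnected_image_Iic S)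
  have hsub : range S.toTree ⊆ {x}ᶜ := fun w hw h => hx (by rwa [← mem_singleton_iff.1 h])
  refine ⟨⟨S.toTree 0, hsub ⟨0, rfl⟩⟩, hpre.subset_closure hsub fun w _ => denseRange_toTree S w⟩

theorem measurable_toTree : Measurable S.toTree := by
  have hc : ContinuousOn S.toTree (Iic (S.cut 0)) := continuousOn_base S
  have hk : ∀ k, ContinuousOn S.toTree (Ioc (S.cut k) (S.cut (k + 1))) := fun k =>
    ((continuousOn_stick S k).mono Ioc_subset_Icc_self).congr fun s hs => by
      simp [hs.1.ne']
  intro B hB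
  have : S.toTree ⁻¹' B = (Iic (S.cut 0) ∩ S.toTree ⁻¹' B) ∪
      ⋃ k, (Ioc (S.cut k) (S.cut (k + 1)) ∩ S.toTree ⁻¹' B) := by
    rw [← iUnion_inter, ← union_inter_distrib_right]
    symm
    rw [inter_eq_right]
    intro x _
    obtain ⟨n, hn⟩ := (S.cut_tendsto.eventually_ge_atTop x).exists
    induction n with
    | zero => exact Or.inl hn
    | succ n ih =>
      rcases le_or_gt x (S.cut n) with h | h
      · exact ih h
      · exact Or.inr (mem_iUnion.2 ⟨n, h, hn⟩)
  rw [this]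
  have key : ∀ A : Set ℝ≥0, MeasurableSet A → ContinuousOn S.toTree A →
      MeasurableSet (A ∩ S.toTree ⁻¹' B) := by
    intro A hA h
    have := (continuousOn_iff_continuous_domRestrict.1 h).measurable hB
    have h2 := (MeasurableEmbedding.subtype_coe hA).measurableSet_image' this
    convert h2 using 1
    ext x; simp [and_comm]
  exact (key _ measurableSet_Iic hc).union
    (MeasurableSet.iUnion fun k => key _ measurableSet_Ioc (hk k))

end Tree

/-! ### Weak convergence of the normalized mass measures -/

/-- The part of the `i`-th stick on which `⌊n x⌋ = l`. For `n > 0` its diameter in the tree is at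
most `1 / n`, and for each `n` the cells form a countable partition of `ℝ⁺`. -/
def cell (Y : ℕ → ℝ≥0) (n i l : ℕ) : Set ℝ≥0 :=
  {x | (∀ j < i, Y j < x) ∧ x ≤ Y i ∧ ⌊n * x⌋₊ = l}

theorem measurableSet_cell (Y : ℕ → ℝ≥0) (n i l : ℕ) : MeasurableSet (cell Y n i l) := by
  unfold cell
  measurability

theorem measurable_proj (m k : ℕ) :
    Measurable fun w : ((ℕ → ℝ≥0) × (ℕ → ℝ≥0)) × ℝ≥0 => proj w.1.1 w.1.2 m k w.2 := by
  induction k with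
  | zero => exact measurable_snd
  | succ k ih =>
    simp only [proj]
    split_ifs with h
    · exact measurable_snd
    · refine Measurable.ite (measurableSet_le (by fun_prop) (by fun_prop)) ih ?_
      exact ih.comp (f := fun w : ((ℕ → ℝ≥0) × (ℕ → ℝ≥0)) × ℝ≥0 => (w.1, w.1.2 k)) (by fun_prop)

theorem measurable_height (m k : ℕ) :
    Measurable fun w : ((ℕ → ℝ≥0) × (ℕ → ℝ≥0)) × ℝ≥0 => height w.1.1 w.1.2 m k w.2 := by
  induction k with
  | zero => exact measurable_const
  | succ k ih =>
    simp only [height]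
    split_ifs with h
    · exact measurable_const
    · refine Measurable.ite (measurableSet_le (by fun_prop) (by fun_prop)) ih ?_
      refine Measurable.add ?_ (by fun_prop)
      exact ih.comp (f := fun w : ((ℕ → ℝ≥0) × (ℕ → ℝ≥0)) × ℝ≥0 => (w.1, w.1.2 k)) (by fun_prop)

theorem measurable_proj' (Y Z : ℕ → ℝ≥0) (m k : ℕ) : Measurable (proj Y Z m k) :=
  (measurable_proj m k).comp (measurable_prodMk_left (x := (Y, Z)))

theorem measurable_height' (Y Z : ℕ → ℝ≥0) (m k : ℕ) : Measurable (height Y Z m k) :=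
  (measurable_height m k).comp (measurable_prodMk_left (x := (Y, Z)))

theorem abs_integral_sub_sum_le {X ι : Type*} [MeasurableSpace X] (ρ : Measure X)
    [IsProbabilityMeasure ρ] {f : X → ℝ} (hf : Integrable f ρ) (s : Finset ι) (C : ι → Set X)
    (hC : ∀ c ∈ s, MeasurableSet (C c)) (v : ι → ℝ) {ε : ℝ}
    (h : ∀ᵐ x ∂ρ, |f x - ∑ c ∈ s, (C c).indicator (fun _ => v c) x| ≤ ε) :
    |∫ x, f x ∂ρ - ∑ c ∈ s, ρ.real (C c) * v c| ≤ ε := by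
  have hint : ∀ c ∈ s, Integrable ((C c).indicator fun _ => v c) ρ := fun c hc =>
    (integrable_const _).indicator (hC c hc)
  have h1 : ∑ c ∈ s, ρ.real (C c) * v c =
      ∫ x, ∑ c ∈ s, (C c).indicator (fun _ => v c) x ∂ρ := by
    rw [integral_finsetSum _ hint]
    refine Finset.sum_congr rfl fun c hc => ?_
    rw [integral_indicator_const _ (hC c hc), smul_eq_mul]
  rw [h1, ← integral_sub hf (integrable_finsetSum _ hint), ← Real.norm_eq_abs]
  simpa using norm_integral_le_of_norm_le_const (μ := ρ)
    (f := fun x => f x - ∑ c ∈ s, (C c).indicator (fun _ => v c) x)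
    (by simpa only [Real.norm_eq_abs] using h)

theorem exists_tendsto_of_approx {u : ℕ → ℝ}
    (h : ∀ ε > 0, ∃ w : ℕ → ℝ, (∃ L, Tendsto w atTop (𝓝 L)) ∧ ∀ᶠ k in atTop, |u k - w k| ≤ ε) :
    ∃ L, Tendsto u atTop (𝓝 L) := by
  refine cauchySeq_tendsto_of_complete (Metric.cauchySeq_iff'.2 fun ε hε => ?_)
  obtain ⟨w, ⟨L, hL⟩, hw⟩ := h (ε / 5) (by positivity)
  obtain ⟨N, hN⟩ := eventually_atTop.1 (hw.and (Metric.tendsto_nhds.1 hL (ε / 5) (by positivity)))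
  refine ⟨N, fun n hn => ?_⟩
  have h1 := hN n hn
  have h2 := hN N le_rfl
  simp only [Real.dist_eq, abs_le, abs_lt] at h1 h2 ⊢
  constructor <;> linarith [h1.1.1, h1.1.2, h1.2.1, h1.2.2, h2.1.1, h2.1.2, h2.2.1, h2.2.2]

section Limit

variable (S : StickBreaking) (p : ℕ → Measure ℝ≥0)

/-- The image in the tree of a probability measure on `ℝ⁺`. -/
noncomputable def treeLaw (ρ : Measure ℝ≥0) [IsProbabilityMeasure ρ] : ProbabilityMeasure S.Tree :=
  ⟨ρ.map S.toTree, Measure.isProbabilityMeasure_map (measurable_toTree S).aemeasurable⟩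

theorem coe_treeLaw (ρ : Measure ℝ≥0) [IsProbabilityMeasure ρ] :
    (treeLaw S ρ : Measure S.Tree) = ρ.map S.toTree := rfl

theorem exists_cell {n m : ℕ} {x : ℝ≥0} (hx : x ≤ S.cut m) :
    ∃ i ≤ m, x ∈ cell S.cut n i ⌊n * x⌋₊ ∧ ∀ i', (∃ l, x ∈ cell S.cut n i' l) → i' = i := by
  classical
  have hex : ∃ i, x ≤ S.cut i := ⟨m, hx⟩
  refine ⟨Nat.find hex, Nat.find_min' hex hx, ⟨fun j hj => not_le.1 (Nat.find_min hex hj),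
    Nat.find_spec hex, rfl⟩, ?_⟩
  rintro i' ⟨l, h1, h2, -⟩
  refine le_antisymm ?_ (Nat.find_min' hex h2)
  by_contra! h
  exact (h1 _ h).not_ge (Nat.find_spec hex)

theorem lineDist_le_of_mem_cell {n i l : ℕ} (hn : 0 < n) {s t : ℝ≥0}
    (hs : s ∈ cell S.cut n i l) (ht : t ∈ cell S.cut n i l) :
    S.lineDist s t ≤ 1 / n := by
  have hd : S.lineDist s t = |(s : ℝ) - t| := by
    cases i with
    | zero => exact lineDist_of_le_zero S hs.2.1 ht.2.1
    | succ i =>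
      exact lineDist_of_lt_of_lt S (hs.1 i i.lt_succ_self) hs.2.1 (ht.1 i i.lt_succ_self) ht.2.1
  have hn' : (0 : ℝ) < n := by exact_mod_cast hn
  have key : ∀ w : ℝ≥0, ⌊n * w⌋₊ = l → (l : ℝ) ≤ n * w ∧ n * (w : ℝ) < l + 1 := fun w hw => by
    have h1 := Nat.floor_le (zero_le (a := n * w))
    have h2 := Nat.lt_floor_add_one (n * w)
    rw [hw] at h1 h2
    exact ⟨by exact_mod_cast h1, by exact_mod_cast h2⟩
  have h1 := key s hs.2.2
  have h2 := key t ht.2.2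
  rw [hd, abs_le, ← neg_div, div_le_iff₀ hn', le_div_iff₀ hn']
  constructor <;> nlinarith

/-- Integrals of Lipschitz functions along the normalized mass measures converge: projecting onto
a high level changes them little, and the projected measures converge on small cells. -/
theorem exists_tendsto_integral [∀ k, IsProbabilityMeasure (p k)]
    (hp : ∀ k, ∀ᵐ x ∂p k, x ≤ S.cut k)
    (hcell : ∀ m n i l, ∃ L, Tendsto
      (fun k => (p k).real {x | proj S.cut S.glue m k x ∈ cell S.cut n i l}) atTop (𝓝 L))
    (hheight : ∀ ε : ℝ≥0∞, 0 < ε → ∃ m, ∀ᶠ k in atTop,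
      ∫⁻ x, height S.cut S.glue m k x ∂p k ≤ ε)
    (f : S.Tree → ℝ) {K : ℝ≥0} (hf : LipschitzWith K f) {C : ℝ} (hC : ∀ x, |f x| ≤ C) :
    ∃ L, Tendsto (fun k => ∫ x, f (S.toTree x) ∂p k) atTop (𝓝 L) := by
  have hfm : Measurable f := hf.continuous.measurable
  have hbd : ∀ (k : ℕ) (g : ℝ≥0 → S.Tree), Measurable g → Integrable (fun x => f (g x)) (p k) :=
    fun k g hg => Integrable.of_bound (hfm.comp hg).aestronglyMeasurable C
      (ae_of_all _ fun x => hC _)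
  refine exists_tendsto_of_approx fun ε hε => ?_
  -- both errors are at most `ε / 2`
  obtain ⟨m, hm⟩ := hheight (ENNReal.ofReal (ε / (2 * (K + 1)))) (by simp; positivity)
  obtain ⟨n, hn⟩ := exists_nat_gt (2 * (K + 1) / ε)
  have hn0 : 0 < n := by
    have : (0 : ℝ) < n := lt_of_le_of_lt (by positivity) hn
    exact_mod_cast this
  have hn0' : (0 : ℝ) < n := by exact_mod_cast hn0
  have hKn : K * (1 / n : ℝ) ≤ ε / 2 := by
    rw [div_lt_iff₀ hε] at hn
    rw [mul_one_div, div_le_iff₀ hn0']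
    nlinarith [K.2]
  let s : Finset (ℕ × ℕ) := Finset.range (m + 1) ×ˢ Finset.range (⌊n * S.cut m⌋₊ + 1)
  classical
  let v : ℕ × ℕ → ℝ := fun c =>
    if h : (cell S.cut n c.1 c.2).Nonempty then f (S.toTree h.some) else 0
  refine ⟨fun k => ∑ c ∈ s, (p k).real {x | proj S.cut S.glue m k x ∈ cell S.cut n c.1 c.2} * v c,
    ?_, ?_⟩
  · choose L hL using hcell
    exact ⟨∑ c ∈ s, L m n c.1 c.2 * v c,
      tendsto_finsetSum _ fun c _ => (hL m n c.1 c.2).mul_const _⟩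
  filter_upwards [hm, eventually_ge_atTop m] with k hk hmk
  have h1 : |∫ x, f (S.toTree (proj S.cut S.glue m k x)) ∂p k - ∑ c ∈ s,
      (p k).real {x | proj S.cut S.glue m k x ∈ cell S.cut n c.1 c.2} * v c| ≤ ε / 2 := by
    refine abs_integral_sub_sum_le (p k) (hbd k _
      ((measurable_toTree S).comp (measurable_proj' S.cut S.glue m k))) s
      (fun c => {x | proj S.cut S.glue m k x ∈ cell S.cut n c.1 c.2})
      (fun c _ => measurable_proj' S.cut S.glue m k (measurableSet_cell _ _ _ _)) v ?_
    filter_upwards [hp k] with x hx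
    set w := proj S.cut S.glue m k x with hw
    have hwm : w ≤ S.cut m := proj_le S hmk hx
    obtain ⟨i, him, hi, hi'⟩ := exists_cell S (n := n) hwm
    have hsum : ∑ c ∈ s, {x | proj S.cut S.glue m k x ∈ cell S.cut n c.1 c.2}.indicator
        (fun _ => v c) x = v (i, ⌊n * w⌋₊) := by
      rw [Finset.sum_eq_single (i, ⌊n * w⌋₊)]
      · rw [indicator_of_mem]
        exact hi
      · rintro ⟨i', l⟩ - hne
        refine indicator_of_notMem (fun hmem => hne ?_) _
        have hmem' : w ∈ cell S.cut n i' l := hmem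
        rw [hi' i' ⟨l, hmem'⟩, ← hmem'.2.2]
      · intro hns
        refine absurd ?_ hns
        simp only [s, Finset.mem_product, Finset.mem_range, Nat.lt_succ_iff]
        exact ⟨him, Nat.floor_mono (by gcongr)⟩
    rw [hsum]
    have hne : (cell S.cut n i ⌊n * w⌋₊).Nonempty := ⟨w, hi⟩
    simp only [v, hne, dif_pos]
    rw [← Real.dist_eq]
    refine (hf.dist_le_mul _ _).trans (le_trans ?_ hKn)
    refine mul_le_mul_of_nonneg_left ((dist_toTree S _ _).le.trans ?_) K.2
    exact (lineDist_le_of_mem_cell S hn0 hi hne.some_mem)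
  have h2 : |∫ x, f (S.toTree x) ∂p k - ∫ x, f (S.toTree (proj S.cut S.glue m k x)) ∂p k|
      ≤ ε / 2 := by
    rw [← integral_sub (hbd k S.toTree (measurable_toTree S))
      (hbd k (fun x => S.toTree (proj S.cut S.glue m k x))
        ((measurable_toTree S).comp (measurable_proj' S.cut S.glue m k))), ← Real.norm_eq_abs]
    refine (norm_integral_le_lintegral_norm _).trans ?_
    have hle : ∫⁻ x, ENNReal.ofReal ‖f (S.toTree x) - f (S.toTree (proj S.cut S.glue m k x))‖ ∂p k
        ≤ ENNReal.ofReal (ε / 2) := by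
      calc _ ≤ ∫⁻ x, (K : ℝ≥0∞) * height S.cut S.glue m k x ∂p k := by
            refine lintegral_mono_ae ?_
            filter_upwards [hp k] with x hx
            rw [← ENNReal.coe_mul, ← ENNReal.ofReal_coe_nnreal]
            refine ENNReal.ofReal_le_ofReal ?_
            rw [Real.norm_eq_abs, ← Real.dist_eq, NNReal.coe_mul]
            refine (hf.dist_le_mul _ _).trans (mul_le_mul_of_nonneg_left ?_ K.2)
            rw [dist_toTree]
            exact lineDist_proj_le S hmk hx
        _ = K * ∫⁻ x, height S.cut S.glue m k x ∂p k := lintegral_const_mul' _ _ (by simp)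
        _ ≤ K * ENNReal.ofReal (ε / (2 * (K + 1))) := by gcongr
        _ ≤ ENNReal.ofReal (ε / 2) := by
            rw [← ENNReal.ofReal_coe_nnreal, ← ENNReal.ofReal_mul (NNReal.coe_nonneg K)]
            refine ENNReal.ofReal_le_ofReal ?_
            have := K.2
            rw [← mul_div_assoc, div_le_div_iff₀ (by positivity) (by positivity)]
            nlinarith
    exact ENNReal.toReal_le_of_le_ofReal (by positivity) hle
  calc _ ≤ _ := abs_sub_le _ (∫ x, f (S.toTree (proj S.cut S.glue m k x)) ∂p k) _
    _ ≤ ε := by linarith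

/-- Tightness: a set of points lying at height at most `2⁻ʲ` over a compact subtree, for every `j`,
is relatively compact. -/
theorem isTightMeasureSet_map (hp : ∀ k, ∀ᵐ x ∂p k, x ≤ S.cut k)
    (hheight : ∀ ε : ℝ≥0∞, 0 < ε → ∃ m, ∀ᶠ k in atTop,
      ∫⁻ x, height S.cut S.glue m k x ∂p k ≤ ε) :
    IsTightMeasureSet (range fun k => (p k).map S.toTree) := by
  rw [isTightMeasureSet_iff_exists_isCompact_measure_compl_le]
  intro ε hε
  obtain ⟨ε', hε', hε'sum⟩ := ENNReal.exists_pos_sum_of_countable' hε.ne' ℕ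
  have hr : ∀ j : ℕ, (0 : ℝ≥0) < (1 / 2) ^ j := fun j => by positivity
  -- by Markov's inequality; the case `k ≤ N` is trivial since the height then vanishes
  have hN : ∀ j, ∃ N, ∀ k,
      p k {x | ((1 / 2 : ℝ≥0) ^ j : ℝ≥0) ≤ height S.cut S.glue N k x} ≤ ε' j := by
    intro j
    have hr' : (((1 / 2 : ℝ≥0) ^ j : ℝ≥0) : ℝ≥0∞) ≠ 0 := by exact_mod_cast (hr j).ne'
    obtain ⟨m, hm⟩ := hheight (((1 / 2 : ℝ≥0) ^ j : ℝ≥0) * ε' j)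
      (ENNReal.mul_pos hr' (hε' j).ne')
    obtain ⟨k₀, hk₀⟩ := eventually_atTop.1 hm
    refine ⟨max m k₀, fun k => ?_⟩
    rcases le_or_gt k (max m k₀) with h | h
    · simp only [height_of_le h, (hr j).not_ge]
      simp
    · have hk := hk₀ k ((le_max_right _ _).trans h.le)
      calc p k {x | ((1 / 2 : ℝ≥0) ^ j : ℝ≥0) ≤ height S.cut S.glue (max m k₀) k x}
          ≤ p k {x | (((1 / 2 : ℝ≥0) ^ j : ℝ≥0) : ℝ≥0∞) ≤ height S.cut S.glue m k x} := by
            refine measure_mono_ae ?_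
            filter_upwards [hp k] with x hx hle
            have h2 : ((1 / 2 : ℝ≥0) ^ j : ℝ≥0) ≤ height S.cut S.glue m k x :=
              le_trans hle (height_anti S (le_max_left _ _) h.le hx)
            exact ENNReal.coe_le_coe.2 h2
        _ ≤ ε' j := by
            have h3 := (mul_meas_ge_le_lintegral (μ := p k)
              (measurable_height' S.cut S.glue m k).coe_nnreal_ennreal
              (((1 / 2 : ℝ≥0) ^ j : ℝ≥0) : ℝ≥0∞)).trans hk
            exact (ENNReal.mul_le_mul_iff_right hr' ENNReal.coe_ne_top).1 h3
  choose N hN using hN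
  let A : ℕ → Set S.Tree := fun j =>
    Metric.cthickening ((1 / 2) ^ j) (S.toTree '' Iic (S.cut (N j)))
  have hK : IsCompact (⋂ j, A j) := by
    refine TotallyBounded.isCompact_of_isClosed ?_
      (isClosed_iInter fun j => Metric.isClosed_cthickening)
    rw [Metric.totallyBounded_iff]
    intro r hr
    obtain ⟨j, hj⟩ := exists_pow_lt_of_lt_one (half_pos hr) (by norm_num : (1 / 2 : ℝ) < 1)
    obtain ⟨t, htf, ht⟩ := Metric.totallyBounded_iff.1
      (isCompact_image_Iic S (N j)).totallyBounded (r / 2) (half_pos hr)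
    refine ⟨t, htf, fun w hw => ?_⟩
    have hw' := Metric.cthickening_subset_thickening' (half_pos hr) hj _ (mem_iInter.1 hw j)
    obtain ⟨w', hw'mem, hw'd⟩ := Metric.mem_thickening_iff.1 hw'
    obtain ⟨c, hc, hcd⟩ := mem_iUnion₂.1 (ht hw'mem)
    refine mem_iUnion₂.2 ⟨c, hc, ?_⟩
    rw [Metric.mem_ball] at hcd ⊢
    linarith [dist_triangle w w' c]
  refine ⟨⋂ j, A j, hK, ?_⟩
  rintro _ ⟨k, rfl⟩
  simp only
  rw [Measure.map_apply (measurable_toTree S) hK.isClosed.measurableSet.compl, compl_iInter,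
    preimage_iUnion]
  refine (measure_iUnion_le _).trans (le_trans (ENNReal.tsum_le_tsum fun j => ?_) hε'sum.le)
  refine le_trans (measure_mono_ae ?_) (hN j k)
  filter_upwards [hp k] with x hx hxA
  by_contra hlt
  refine hxA ?_
  have hlt' : height S.cut S.glue (N j) k x < (1 / 2 : ℝ≥0) ^ j := not_le.1 hlt
  rcases le_or_gt k (N j) with h | h
  · exact Metric.self_subset_cthickening _ ⟨x, hx.trans (cut_mono S h), rfl⟩
  · refine Metric.mem_cthickening_of_dist_le _ (S.toTree (proj S.cut S.glue (N j) k x)) _ _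
      ⟨_, proj_le S h.le hx, rfl⟩ ?_
    rw [dist_toTree]
    refine (lineDist_proj_le S h.le hx).trans ?_
    exact_mod_cast hlt'.le

/-- The laws converge weakly along the cuts: tightness provides a limit point, which is identified
by the convergence of the integrals of Lipschitz functions. -/
theorem exists_tendsto_map [∀ k, IsProbabilityMeasure (p k)] (hp : ∀ k, ∀ᵐ x ∂p k, x ≤ S.cut k)
    (hcell : ∀ m n i l, ∃ L, Tendsto
      (fun k => (p k).real {x | proj S.cut S.glue m k x ∈ cell S.cut n i l}) atTop (𝓝 L))
    (hheight : ∀ ε : ℝ≥0∞, 0 < ε → ∃ m, ∀ᶠ k in atTop,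
      ∫⁻ x, height S.cut S.glue m k x ∂p k ≤ ε) :
    ∃ π : ProbabilityMeasure S.Tree, Tendsto (fun k => treeLaw S (p k)) atTop (𝓝 π) := by
  set q : ℕ → ProbabilityMeasure S.Tree := fun k => treeLaw S (p k) with hq
  have hcomp : IsCompact (closure (range q)) := by
    refine isCompact_closure_of_isTightMeasureSet ?_
    refine (isTightMeasureSet_map S p hp hheight).subset ?_
    rintro _ ⟨_, ⟨k, rfl⟩, rfl⟩
    exact ⟨k, rfl⟩
  obtain ⟨π, -, hπ⟩ := hcomp.exists_mapClusterPt (f := atTop) (u := q)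
    (tendsto_principal.2 (Eventually.of_forall fun k => subset_closure (mem_range_self k)))
  refine ⟨π, ?_⟩
  rw [tendsto_iff_forall_lipschitz_integral_tendsto]
  rintro f ⟨C, hC⟩ ⟨K, hK⟩
  let fb : BoundedContinuousFunction S.Tree ℝ := ⟨⟨f, hK.continuous⟩, C, hC⟩
  have hbd : ∀ x, |f x| ≤ |f (S.toTree 0)| + C := fun x => by
    have := hC x (S.toTree 0)
    rw [Real.dist_eq] at this
    have := abs_sub_abs_le_abs_sub (f x) (f (S.toTree 0))
    linarith
  obtain ⟨L, hL⟩ := exists_tendsto_integral S p hp hcell hheight f hK hbd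
  have hL' : Tendsto (fun k => ∫ w, f w ∂(q k : Measure S.Tree)) atTop (𝓝 L) := by
    refine hL.congr fun k => ?_
    rw [hq]
    exact (integral_map (measurable_toTree S).aemeasurable
      hK.continuous.aestronglyMeasurable).symm
  have hcont : Continuous fun ρ : ProbabilityMeasure S.Tree => ∫ w, f w ∂(ρ : Measure S.Tree) :=
    ProbabilityMeasure.continuous_integral_boundedContinuousFunction (f := fb)
  have hcl : MapClusterPt (∫ w, f w ∂(π : Measure S.Tree)) atTop
      (fun k => ∫ w, f w ∂(q k : Measure S.Tree)) :=
    hπ.continuousAt_comp hcont.continuousAt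
  have : ∫ w, f w ∂(π : Measure S.Tree) = L := by
    by_contra hne
    obtain ⟨U, V, hU, hV, hUm, hVm, hd⟩ := t2_separation hne
    have h1 := hcl.frequently (hU.mem_nhds hUm)
    have h2 := hL'.eventually (hV.mem_nhds hVm)
    obtain ⟨k, hk1, hk2⟩ := (h1.and_eventually h2).exists
    exact disjoint_left.1 hd hk1 hk2
  rw [this]
  exact hL'

end Limit

/-! ### Properties of the limiting measure -/

theorem exists_nnrat_btwn {a b : ℝ≥0} (h : a < b) : ∃ q : ℚ≥0, a < q ∧ (q : ℝ≥0) < b := by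
  obtain ⟨q, h1, h2⟩ := exists_rat_btwn (NNReal.coe_lt_coe.2 h)
  have hq : 0 ≤ q := by exact_mod_cast (NNReal.coe_nonneg a).trans h1.le
  lift q to ℚ≥0 using hq
  have hc : ((q : ℝ≥0) : ℝ) = (q : ℝ) := rfl
  refine ⟨q, NNReal.coe_lt_coe.1 ?_, NNReal.coe_lt_coe.1 ?_⟩ <;> rw [hc]
  · exact_mod_cast h1
  · exact_mod_cast h2

section LimitProperties

variable (S : StickBreaking) (p : ℕ → Measure ℝ≥0) [∀ k, IsProbabilityMeasure (p k)]
  (π : ProbabilityMeasure S.Tree)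

/-- If small neighbourhoods of each subtree have small mass, the limit law does not charge `ℝ⁺`. -/
theorem ae_mem_leaves (hp : ∀ k, ∀ᵐ x ∂p k, x ≤ S.cut k)
    (hπ : Tendsto (fun k => treeLaw S (p k)) atTop (𝓝 π))
    (hleaf : ∀ (n : ℕ) (ε : ℝ≥0∞), 0 < ε → ∃ δ : ℝ≥0, 0 < δ ∧ ∃ᶠ k in atTop,
      p k {x | height S.cut S.glue n k x < δ} ≤ ε) :
    ∀ᵐ w ∂(π : Measure S.Tree), w ∈ S.leaves := by
  have hzero : ∀ n, (π : Measure S.Tree) (S.toTree '' Iic (S.cut n)) = 0 := by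
    intro n
    refine le_antisymm (le_of_forall_pos_le_add fun ε hε => ?_) bot_le
    rw [zero_add]
    obtain ⟨δ, hδ, hfr⟩ := hleaf n ε hε
    have hopen : IsOpen (Metric.thickening (δ : ℝ) (S.toTree '' Iic (S.cut n))) :=
      Metric.isOpen_thickening
    refine (measure_mono (Metric.self_subset_thickening (NNReal.coe_pos.2 hδ) _)).trans
      ((ProbabilityMeasure.le_liminf_measure_open_of_tendsto hπ hopen).trans ?_)
    refine liminf_le_of_frequently_le' ?_
    refine (hfr.and_eventually (eventually_ge_atTop n)).mono fun k hk => le_trans ?_ hk.1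
    rw [coe_treeLaw, Measure.map_apply (measurable_toTree S) hopen.measurableSet]
    refine measure_mono_ae ?_
    filter_upwards [hp k] with x hx hxU
    obtain ⟨_, ⟨t, ht, rfl⟩, hd⟩ := Metric.mem_thickening_iff.1 hxU
    rw [dist_toTree] at hd
    exact NNReal.coe_lt_coe.1 ((height_le_lineDist S hk.2 hx ht).trans_lt hd)
  have h : (π : Measure S.Tree) (range S.toTree) = 0 := by
    rw [range_toTree_eq]
    exact measure_iUnion_null hzero
  filter_upwards [measure_eq_zero_iff_ae_notMem.1 h] with w hw
  exact mem_leaves_of_notMem_range S hw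

/-- If pairs of close points are rare, the limit law has no atom: a ball around an atom of mass `η`
would contain both points with probability at least `(η / 2) ^ 2`. -/
theorem measure_singleton_eq_zero (hπ : Tendsto (fun k => treeLaw S (p k)) atTop (𝓝 π))
    (hatom : ∀ ε : ℝ≥0∞, 0 < ε → ∃ δ : ℝ, 0 < δ ∧ ∃ᶠ k in atTop,
      ((p k).prod (p k)) {w | S.lineDist w.1 w.2 < δ} ≤ ε) (x : S.Tree) :
    (π : Measure S.Tree) {x} = 0 := by
  by_contra hne
  set η := (π : Measure S.Tree) {x} with hη
  have hηtop : η ≠ ∞ := measure_ne_top _ _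
  have hη2 : η / 2 ≠ 0 := (ENNReal.half_pos hne).ne'
  have hη2top : η / 2 ≠ ∞ := (ENNReal.half_lt_self hne hηtop).ne_top
  obtain ⟨δ, hδ, hfr⟩ := hatom ((η / 2) * (η / 2) / 2)
    (ENNReal.half_pos (mul_ne_zero hη2 hη2))
  have hopen : IsOpen (Metric.ball x (δ / 2)) := Metric.isOpen_ball
  have h1 := ProbabilityMeasure.le_liminf_measure_open_of_tendsto hπ hopen
  have h2 : η / 2 < liminf (fun k => (treeLaw S (p k) : Measure S.Tree) (Metric.ball x (δ / 2)))
      atTop :=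
    (ENNReal.half_lt_self hne hηtop).trans_le ((measure_mono (singleton_subset_iff.2
      (Metric.mem_ball_self (half_pos hδ)))).trans h1)
  obtain ⟨k, hk1, hk2⟩ := (hfr.and_eventually (eventually_lt_of_lt_liminf h2)).exists
  rw [coe_treeLaw, Measure.map_apply (measurable_toTree S) hopen.measurableSet] at hk2
  set B := S.toTree ⁻¹' Metric.ball x (δ / 2) with hB
  have h3 : p k B * p k B ≤ (η / 2) * (η / 2) / 2 := by
    rw [← Measure.prod_prod]
    refine (measure_mono ?_).trans hk1
    rintro ⟨s, t⟩ ⟨hs, ht⟩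
    change S.lineDist s t < δ
    rw [← dist_toTree]
    have hs' : dist (S.toTree s) x < δ / 2 := hs
    have ht' : dist (S.toTree t) x < δ / 2 := ht
    linarith [dist_triangle_right (S.toTree s) (S.toTree t) x]
  have h4 : (η / 2) * (η / 2) / 2 < (η / 2) * (η / 2) :=
    ENNReal.half_lt_self (mul_ne_zero hη2 hη2) (ENNReal.mul_ne_top hη2top hη2top)
  exact absurd (h3.trans_lt h4) (not_lt.2 (mul_le_mul' hk2.le hk2.le))

/-- Every point of the half-line is close, in the tree, to a whole rational interval. -/
theorem exists_Ioc_near (h0 : 0 < S.cut 0) (t : ℝ≥0) {r : ℝ≥0} (hr : 0 < r) :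
    ∃ (q q' : ℚ≥0) (m : ℕ), q < q' ∧ (q' : ℝ≥0) ≤ S.cut m ∧
      ∀ s ∈ Ioc (q : ℝ≥0) q', S.lineDist s t ≤ r := by
  -- it suffices to find a real interval to the left of a point
  have key : ∀ u v : ℝ≥0, u < v → (∃ m, v ≤ S.cut m) → (∀ s, u < s → s ≤ v → S.lineDist s t ≤ r) →
      ∃ (q q' : ℚ≥0) (m : ℕ), q < q' ∧ (q' : ℝ≥0) ≤ S.cut m ∧
      ∀ s ∈ Ioc (q : ℝ≥0) q', S.lineDist s t ≤ r := by
    rintro u v huv ⟨m, hm⟩ h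
    obtain ⟨q, hq1, hq2⟩ := exists_nnrat_btwn huv
    obtain ⟨q', hq1', hq2'⟩ := exists_nnrat_btwn hq2
    exact ⟨q, q', m, by exact_mod_cast hq1', hq2'.le.trans hm,
      fun s hs => h s (hq1.trans hs.1) (hs.2.trans hq2'.le)⟩
  obtain ⟨n, hn⟩ := (S.cut_tendsto.eventually_ge_atTop t).exists
  obtain ⟨i, -, hi, -⟩ := exists_cell S (n := 0) hn
  rcases eq_or_ne t 0 with rfl | ht
  · refine key 0 (min (S.cut 0) r) (lt_min h0 hr) ⟨0, min_le_left _ _⟩ fun s hs hs' => ?_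
    rw [lineDist_of_le_zero S (hs'.trans (min_le_left _ _)) h0.le, NNReal.coe_zero, sub_zero,
      abs_of_nonneg (NNReal.coe_nonneg s)]
    exact_mod_cast hs'.trans (min_le_right _ _)
  · have ht0 : 0 < t := pos_iff_ne_zero.2 ht
    have habs : ∀ s : ℝ≥0, t - r < s → s ≤ t → |(s : ℝ) - t| ≤ r := fun s hs hs' => by
      have h1 : (s : ℝ) ≤ t := by exact_mod_cast hs'
      have h2 : (t : ℝ) < s + r := by exact_mod_cast lt_add_of_tsub_lt_right hs
      rw [abs_le]; constructor <;> linarith [r.2]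
    cases i with
    | zero =>
      refine key (t - r) t (tsub_lt_self ht0 hr) ⟨n, hn⟩ fun s hs hs' => ?_
      rw [lineDist_of_le_zero S (hs'.trans hi.2.1) hi.2.1]
      exact habs s hs hs'
    | succ i =>
      have hit := hi.1 i i.lt_succ_self
      refine key (max (t - r) (S.cut i)) t (max_lt (tsub_lt_self ht0 hr) hit) ⟨n, hn⟩
        fun s hs hs' => ?_
      rw [lineDist_of_lt_of_lt S (lt_of_le_of_lt (le_max_right _ _) hs) (hs'.trans hi.2.1) hit
        hi.2.1]
      exact habs s (lt_of_le_of_lt (le_max_left _ _) hs) hs'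

/-- A point whose projection falls in a given interval, at a small height, is close in the tree to
every point of the interval; if the mass of such points does not vanish, the support is full. -/
theorem support_eq_univ (h0 : 0 < S.cut 0) (hp : ∀ k, ∀ᵐ x ∂p k, x ≤ S.cut k)
    (hπ : Tendsto (fun k => treeLaw S (p k)) atTop (𝓝 π))
    (hsupp : ∀ (q q' : ℚ≥0) (j : ℕ), q < q' → (∃ m, (q' : ℝ≥0) ≤ S.cut m) → ∃ (m : ℕ) (c : ℝ≥0∞),
      0 < c ∧ ∀ᶠ k in atTop, c ≤ p k {x | proj S.cut S.glue m k x ∈ Ioc (q : ℝ≥0) q' ∧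
        height S.cut S.glue m k x ≤ 1 / ((j : ℝ≥0) + 1)}) :
    (π : Measure S.Tree).support = univ := by
  refine eq_univ_of_forall fun x => Measure.mem_support_iff_forall _ |>.2 fun U hU => ?_
  obtain ⟨r, hr, hrU⟩ := Metric.nhds_basis_closedBall.mem_iff.1 hU
  obtain ⟨j, hj⟩ := exists_nat_one_div_lt (by positivity : 0 < r / 3)
  obtain ⟨t, ht⟩ := Metric.denseRange_iff.1 (denseRange_toTree S) x (r / 3) (by positivity)
  obtain ⟨q, q', m₀, hqq', hq'm, hnear⟩ := exists_Ioc_near S h0 t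
    (r := 1 / ((j : ℝ≥0) + 1)) (by positivity)
  obtain ⟨m, c, hc, hev⟩ := hsupp q q' j hqq' ⟨m₀, hq'm⟩
  have h1 := ProbabilityMeasure.limsup_measure_closed_le_of_tendsto hπ
    (Metric.isClosed_closedBall (x := x) (ε := r))
  refine lt_of_lt_of_le ?_ (measure_mono hrU)
  refine lt_of_lt_of_le hc (le_trans ?_ h1)
  refine le_limsup_of_frequently_le' (Eventually.frequently ?_)
  filter_upwards [hev, eventually_ge_atTop m] with k hk hmk
  refine hk.trans ?_
  rw [coe_treeLaw, Measure.map_apply (measurable_toTree S) Metric.isClosed_closedBall.measurableSet]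
  refine measure_mono_ae ?_
  filter_upwards [hp k] with w hw hwmem
  have hh := lineDist_proj_le S hmk hw
  have h2 := hnear _ hwmem.1
  have h3 : ((height S.cut S.glue m k w : ℝ≥0) : ℝ) ≤ ((1 / ((j : ℝ≥0) + 1) : ℝ≥0) : ℝ) :=
    NNReal.coe_le_coe.2 hwmem.2
  have hcoe : ((1 / ((j : ℝ≥0) + 1) : ℝ≥0) : ℝ) = 1 / ((j : ℝ) + 1) := by push_cast; rfl
  rw [hcoe] at h2 h3
  change dist (S.toTree w) x ≤ r
  rw [← dist_toTree] at hh h2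
  rw [dist_comm] at ht
  linarith [dist_triangle4 (S.toTree w) (S.toTree (proj S.cut S.glue m k w)) (S.toTree t) x]

end LimitProperties

/-! ### From the cuts to all truncation levels -/

section Interpolation

variable {μ : Measure ℝ≥0}

theorem isProbabilityMeasure_cond_Icc (hfin : ∀ l, μ (Icc 0 l) ≠ ∞)
    (hpos : ∀ l, 0 < l → μ (Icc 0 l) ≠ 0) {l : ℝ≥0} (hl : 0 < l) :
    IsProbabilityMeasure (μ[|Icc 0 l]) :=
  cond_isProbabilityMeasure_of_finite (hpos l hl) (hfin l)

/-- The laws on two truncation levels differ in total variation by the proportion of added mass. -/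
theorem abs_integral_cond_sub_le (hfin : ∀ l, μ (Icc 0 l) ≠ ∞)
    (hpos : ∀ l, 0 < l → μ (Icc 0 l) ≠ 0) {f : ℝ≥0 → ℝ} (hf : Measurable f) {C : ℝ}
    (hC : ∀ x, |f x| ≤ C) {a b : ℝ≥0} (ha : 0 < a) (hab : a ≤ b) :
    |∫ x, f x ∂μ[|Icc 0 b] - ∫ x, f x ∂μ[|Icc 0 a]| ≤
      2 * C * (1 - μ.real (Icc 0 a) / μ.real (Icc 0 b)) := by
  have hb := ha.trans_le hab
  have hA : 0 < μ.real (Icc 0 a) := ENNReal.toReal_pos (hpos a ha) (hfin a)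
  have hB : 0 < μ.real (Icc 0 b) := ENNReal.toReal_pos (hpos b hb) (hfin b)
  have hint : IntegrableOn f (Icc 0 b) μ :=
    Measure.integrableOn_of_bounded (hfin b) hf.aestronglyMeasurable (ae_of_all _ hC)
  have hsub : Icc 0 a ⊆ Icc 0 b := Icc_subset_Icc_right hab
  have hsub' : Ioc a b ⊆ Icc 0 b := fun x hx => ⟨zero_le, hx.2⟩
  have hsplit : ∫ x in Icc 0 b, f x ∂μ = ∫ x in Icc 0 a, f x ∂μ + ∫ x in Ioc a b, f x ∂μ := by
    rw [← setIntegral_union _ measurableSet_Ioc (hint.mono_set hsub)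
      (hint.mono_set hsub'), Icc_union_Ioc_eq_Icc zero_le hab]
    rw [disjoint_left]
    exact fun x hx hx' => hx'.1.not_ge hx.2
  have hmeas : μ.real (Ioc a b) = μ.real (Icc 0 b) - μ.real (Icc 0 a) := by
    rw [← Icc_union_Ioc_eq_Icc zero_le hab, measureReal_union _ measurableSet_Ioc (hfin a)
      (measure_ne_top_of_subset hsub' (hfin b))]
    · ring
    · rw [disjoint_left]
      exact fun x hx hx' => hx'.1.not_ge hx.2
  have h1 : |∫ x in Icc 0 a, f x ∂μ| ≤ C * μ.real (Icc 0 a) := by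
    rw [← Real.norm_eq_abs]
    exact norm_setIntegral_le_of_norm_le_const (lt_top_iff_ne_top.2 (hfin a)) fun x _ => hC x
  have h2 : |∫ x in Ioc a b, f x ∂μ| ≤ C * (μ.real (Icc 0 b) - μ.real (Icc 0 a)) := by
    rw [← Real.norm_eq_abs, ← hmeas]
    exact norm_setIntegral_le_of_norm_le_const (measure_lt_top_of_subset
      hsub' (hfin b)) fun x _ => hC x
  have hcond : ∀ l, ∫ x, f x ∂μ[|Icc 0 l] = (μ.real (Icc 0 l))⁻¹ * ∫ x in Icc 0 l, f x ∂μ := by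
    intro l
    rw [ProbabilityTheory.cond, integral_smul_measure, ENNReal.toReal_inv, smul_eq_mul]
    rfl
  rw [hcond, hcond, hsplit]
  set A := μ.real (Icc 0 a)
  set B := μ.real (Icc 0 b)
  set I := ∫ x in Icc 0 a, f x ∂μ
  set J := ∫ x in Ioc a b, f x ∂μ
  have e : B⁻¹ * (I + J) - A⁻¹ * I = (J * A - I * (B - A)) / (A * B) := by
    field_simp
    ring
  have hBA : 0 ≤ B - A := by
    rw [← hmeas]; exact measureReal_nonneg
  have e2 : 2 * C * (1 - A / B) = (C * (B - A) * A + C * A * (B - A)) / (A * B) := by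
    field_simp
    ring
  rw [e, e2, abs_div, abs_of_pos (mul_pos hA hB)]
  gcongr
  calc |J * A - I * (B - A)| ≤ |J * A| + |I * (B - A)| := abs_sub _ _
    _ = |J| * A + |I| * (B - A) := by rw [abs_mul, abs_mul, abs_of_pos hA, abs_of_nonneg hBA]
    _ ≤ _ := by gcongr

/-- If the relative mass of the newest stick tends to zero, convergence along the cuts implies
convergence along all truncation levels. -/
theorem exists_tendsto_of_tendsto_cut (S : StickBreaking) (hfin : ∀ l, μ (Icc 0 l) ≠ ∞)
    (hpos : ∀ l, 0 < l → μ (Icc 0 l) ≠ 0) (h0 : 0 < S.cut 0)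
    [∀ k, IsProbabilityMeasure (μ[|Icc 0 (S.cut k)])]
    (hratio : Tendsto (fun k => μ.real (Icc 0 (S.cut k)) / μ.real (Icc 0 (S.cut (k + 1))))
      atTop (𝓝 1))
    {π : ProbabilityMeasure S.Tree}
    (hπ : Tendsto (fun k => treeLaw S (μ[|Icc 0 (S.cut k)])) atTop (𝓝 π)) :
    ∃ q : ℝ≥0 → ProbabilityMeasure S.Tree,
      (∀ l, 0 < l → (q l : Measure S.Tree) = (μ[|Icc 0 l]).map S.toTree) ∧
      Tendsto q atTop (𝓝 π) := by
  classical
  have hprob : ∀ l : ℝ≥0, 0 < l → IsProbabilityMeasure (μ[|Icc 0 l]) := fun l hl =>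
    isProbabilityMeasure_cond_Icc hfin hpos hl
  refine ⟨fun l => if hl : 0 < l then haveI := hprob l hl; treeLaw S (μ[|Icc 0 l]) else π,
    fun l hl => by simp only [hl, dif_pos]; rfl, ?_⟩
  rw [tendsto_iff_forall_lipschitz_integral_tendsto] at hπ ⊢
  rintro f ⟨C, hC⟩ hf
  have hfc : Continuous f := hf.choose_spec.continuous
  set C' := |f (S.toTree 0)| + C
  have hbd : ∀ x, |f x| ≤ C' := fun x => by
    have := hC x (S.toTree 0)
    rw [Real.dist_eq] at this
    have := abs_sub_abs_le_abs_sub (f x) (f (S.toTree 0))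
    simp only [C']
    linarith
  have hC' : 0 ≤ C' := (abs_nonneg _).trans (hbd (S.toTree 0))
  have hπf := hπ f ⟨C, hC⟩ hf
  have hmap : ∀ l : ℝ≥0, ∫ w, f w ∂(μ[|Icc 0 l]).map S.toTree =
      ∫ x, f (S.toTree x) ∂μ[|Icc 0 l] := fun l =>
    integral_map (measurable_toTree S).aemeasurable hfc.aestronglyMeasurable
  rw [Metric.tendsto_atTop] at hπf hratio ⊢
  intro ε hε
  obtain ⟨K₁, hK₁⟩ := hπf (ε / 2) (by positivity)
  obtain ⟨K₂, hK₂⟩ := hratio (ε / (4 * (C' + 1))) (by positivity)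
  refine ⟨S.cut (max K₁ K₂), fun l hl => ?_⟩
  have hl0 : 0 < l := h0.trans_le ((cut_mono S (Nat.zero_le _)).trans hl)
  have hex : ∃ n, l < S.cut n := (S.cut_tendsto.eventually_gt_atTop l).exists
  obtain ⟨k, hk⟩ : ∃ k, Nat.find hex = k + 1 := by
    refine Nat.exists_eq_succ_of_ne_zero fun h => ?_
    have := Nat.find_spec hex
    rw [h] at this
    exact (hl.trans_lt this).not_ge (cut_mono S (Nat.zero_le _))
  have hkl : S.cut k ≤ l := not_lt.1 (Nat.find_min hex (by omega))
  have hlk : l < S.cut (k + 1) := hk ▸ Nat.find_spec hex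
  have hkK : max K₁ K₂ ≤ k := by
    by_contra! h
    exact (hl.trans_lt hlk).not_ge (cut_mono S h)
  have hk0 : 0 < S.cut k := h0.trans_le (cut_mono S (Nat.zero_le _))
  simp only [hl0, dif_pos]
  have h1 := hK₁ k ((le_max_left _ _).trans hkK)
  have h2 := hK₂ k ((le_max_right _ _).trans hkK)
  have h3 := abs_integral_cond_sub_le hfin hpos (hfc.measurable.comp (measurable_toTree S))
    (fun x => hbd _) hk0 hkl
  have := hprob l hl0
  rw [coe_treeLaw, hmap, Real.dist_eq] at h1 ⊢
  rw [Real.dist_eq, abs_lt] at h2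
  have hA : 0 < μ.real (Icc 0 (S.cut k)) := ENNReal.toReal_pos (hpos _ hk0) (hfin _)
  have hB : 0 < μ.real (Icc 0 l) := ENNReal.toReal_pos (hpos _ hl0) (hfin _)
  have hBB : μ.real (Icc 0 l) ≤ μ.real (Icc 0 (S.cut (k + 1))) :=
    measureReal_mono (Icc_subset_Icc_right hlk.le) (hfin _)
  have h4 : μ.real (Icc 0 (S.cut k)) / μ.real (Icc 0 (S.cut (k + 1))) ≤
      μ.real (Icc 0 (S.cut k)) / μ.real (Icc 0 l) := by gcongr
  have h5 : 2 * C' * (1 - μ.real (Icc 0 (S.cut k)) / μ.real (Icc 0 l)) ≤ ε / 2 := by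
    calc _ ≤ 2 * C' * (ε / (4 * (C' + 1))) := by gcongr; linarith [h2.1]
      _ ≤ ε / 2 := by
        rw [← mul_div_assoc, div_le_div_iff₀ (by positivity) (by positivity)]
        nlinarith
  refine (abs_sub_le _ (∫ x, f (S.toTree x) ∂μ[|Icc 0 (S.cut k)]) _).trans_lt ?_
  simp only [Function.comp_apply] at h3
  linarith

end Interpolation

/-! ### Independent glue points: averages along the construction as submartingales -/

/-- Forget the coordinates of index at least `k`. -/
def trunc (k : ℕ) (z : ℕ → ℝ≥0) : ℕ → ℝ≥0 := fun i => if i < k then z i else 0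

theorem measurable_trunc (k : ℕ) : Measurable (trunc k) := by
  refine measurable_pi_lambda _ fun i => ?_
  unfold trunc
  split_ifs <;> fun_prop

theorem trunc_trunc {j k : ℕ} (h : j ≤ k) (z : ℕ → ℝ≥0) : trunc j (trunc k z) = trunc j z := by
  funext i
  by_cases hi : i < j <;> simp [trunc, hi]
  intro hk
  omega

/-- Integrating the `k`-th coordinate out of a function which otherwise depends on the previous
coordinates only. -/
theorem lintegral_eval_eq (p : ℕ → Measure ℝ≥0) [∀ k, IsProbabilityMeasure (p k)] (k : ℕ)
    {G : (ℕ → ℝ≥0) → ℝ≥0 → ℝ≥0∞} (hG : Measurable (Function.uncurry G))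
    (hdep : ∀ z x, G (trunc k z) x = G z x) :
    ∫⁻ z, G z (z k) ∂Measure.infinitePi p =
      ∫⁻ z, ∫⁻ x, G z x ∂p k ∂Measure.infinitePi p := by
  set Q := Measure.infinitePi p
  have hind : IndepFun (trunc k) (fun z : ℕ → ℝ≥0 => z k) Q := by
    have h1 : iIndepFun (fun i (z : ℕ → ℝ≥0) => z i) Q :=
      iIndepFun_infinitePi (X := fun _ x => x) (fun i => measurable_id)
    have h2 := h1.indepFun_finset (Finset.range k) {k} (by simp)
      (fun i => measurable_pi_apply i)
    have hφ : Measurable fun (v : Finset.range k → ℝ≥0) (i : ℕ) =>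
        if h : i ∈ Finset.range k then v ⟨i, h⟩ else 0 :=
      measurable_pi_lambda _ fun i => by split_ifs <;> fun_prop
    have hψ : Measurable fun v : ({k} : Finset ℕ) → ℝ≥0 => v ⟨k, by simp⟩ :=
      measurable_pi_apply _
    have h3 := h2.comp hφ hψ
    convert h3 using 1
    · funext z i
      simp [trunc]
    · rfl
  have hmap : Q.map (fun z => (trunc k z, z k)) = (Q.map (trunc k)).prod (p k) := by
    rw [(indepFun_iff_map_prod_eq_prod_map_map (measurable_trunc k).aemeasurable
      (measurable_pi_apply k).aemeasurable).1 hind]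
    congr 1
    exact Measure.infinitePi_map_eval p k
  calc ∫⁻ z, G z (z k) ∂Q = ∫⁻ z, Function.uncurry G (trunc k z, z k) ∂Q := by
        simp only [Function.uncurry, hdep]
    _ = ∫⁻ w, Function.uncurry G w ∂(Q.map (trunc k)).prod (p k) := by
        rw [← hmap, lintegral_map hG ((measurable_trunc k).prodMk (measurable_pi_apply k))]
    _ = ∫⁻ z, ∫⁻ x, G z x ∂p k ∂Q.map (trunc k) := by
        rw [lintegral_prod _ hG.aemeasurable]; rfl
    _ = ∫⁻ z, ∫⁻ x, G (trunc k z) x ∂p k ∂Q := by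
        exact lintegral_map (Measurable.lintegral_prod_right' hG) (measurable_trunc k)
    _ = _ := by simp only [hdep]

/-- The laws `p k` of the glue points evolve by mixing: `p (k + 1)` gives weight `a k` to a measure
`ν k` living on the `k`-th stick, beyond `Y k`, and the remaining weight to `p k`. -/
structure IsUrn (Y : ℕ → ℝ≥0) (p ν : ℕ → Measure ℝ≥0) (a : ℕ → ℝ≥0) : Prop where
  prob_ν : ∀ k, IsProbabilityMeasure (ν k)
  le_one : ∀ k, a k ≤ 1
  succ : ∀ k, p (k + 1) = (1 - a k) • p k + a k • ν k
  p_le : ∀ k, ∀ᵐ x ∂p k, x ≤ Y k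
  ν_gt : ∀ k, ∀ᵐ x ∂ν k, Y k < x

/-- A functional `Φ k z x` of the point `x` of the `k`-th tree which is transported along the
gluing: on the stick glued at `z k` it equals its value at the glue point, plus an increment
`c k x` weighted by another functional `θ`. From level `m` on, both functionals depend on the glue
points of index less than `k` only. -/
structure IsSprouting (Y : ℕ → ℝ≥0) (m : ℕ) (c : ℕ → ℝ≥0 → ℝ≥0∞)
    (θ Φ : ℕ → (ℕ → ℝ≥0) → ℝ≥0 → ℝ≥0∞) : Prop where
  meas_c : ∀ k, Measurable (c k)
  meas_θ : ∀ k, Measurable (Function.uncurry (θ k))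
  meas_Φ : ∀ k, Measurable (Function.uncurry (Φ k))
  dep_θ : ∀ k, m ≤ k → ∀ z x, θ k (trunc k z) x = θ k z x
  dep_Φ : ∀ k, m ≤ k → ∀ z x, Φ k (trunc k z) x = Φ k z x
  of_le : ∀ k, m ≤ k → ∀ z x, x ≤ Y k → Φ (k + 1) z x = Φ k z x
  of_lt : ∀ k, m ≤ k → ∀ z x, Y k < x → Φ (k + 1) z x = Φ k z (z k) + θ k z (z k) * c k x
  θ_le : ∀ k z x, θ k z x ≤ 1

/-- The average of a functional against the law of the next glue point, that is, against the
normalized mass of the `k`-th tree. -/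
noncomputable def avg (p : ℕ → Measure ℝ≥0) (Φ : ℕ → (ℕ → ℝ≥0) → ℝ≥0 → ℝ≥0∞) (k : ℕ)
    (z : ℕ → ℝ≥0) : ℝ≥0∞ := ∫⁻ x, Φ k z x ∂p k

section Urn

variable {Y : ℕ → ℝ≥0} {p ν : ℕ → Measure ℝ≥0} {a : ℕ → ℝ≥0} {m : ℕ}
  {c : ℕ → ℝ≥0 → ℝ≥0∞} {θ Φ : ℕ → (ℕ → ℝ≥0) → ℝ≥0 → ℝ≥0∞}

theorem IsUrn.lintegral_succ (hU : IsUrn Y p ν a) (k : ℕ) (f : ℝ≥0 → ℝ≥0∞) :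
    ∫⁻ x, f x ∂p (k + 1) = (1 - a k : ℝ≥0) * ∫⁻ x, f x ∂p k + a k * ∫⁻ x, f x ∂ν k := by
  rw [hU.succ, lintegral_add_measure, lintegral_smul_measure, lintegral_smul_measure]
  rfl

theorem IsSprouting.avg_trunc (hΦ : IsSprouting Y m c θ Φ) {k : ℕ} (hk : m ≤ k) (z : ℕ → ℝ≥0) :
    avg p Φ k (trunc k z) = avg p Φ k z := by
  simp only [avg, hΦ.dep_Φ k hk]

theorem IsSprouting.avg_succ (hU : IsUrn Y p ν a) (hΦ : IsSprouting Y m c θ Φ) {k : ℕ}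
    (hk : m ≤ k) (z : ℕ → ℝ≥0) :
    avg p Φ (k + 1) z = (1 - a k : ℝ≥0) * avg p Φ k z +
      a k * (Φ k z (z k) + θ k z (z k) * ∫⁻ x, c k x ∂ν k) := by
  have := hU.prob_ν k
  rw [avg, hU.lintegral_succ]
  congr 2
  · refine lintegral_congr_ae ?_
    filter_upwards [hU.p_le k] with x hx using hΦ.of_le k hk z x hx
  · rw [← lintegral_const_mul _ (hΦ.meas_c k)]
    calc _ = ∫⁻ x, Φ k z (z k) + θ k z (z k) * c k x ∂ν k := by
          refine lintegral_congr_ae ?_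
          filter_upwards [hU.ν_gt k] with x hx using hΦ.of_lt k hk z x hx
      _ = _ := by rw [lintegral_add_left measurable_const]; simp

theorem IsUrn.one_sub_add (hU : IsUrn Y p ν a) (k : ℕ) :
    ((1 - a k : ℝ≥0) : ℝ≥0∞) + a k = 1 := by
  rw [← ENNReal.coe_add, tsub_add_cancel_of_le (hU.le_one k), ENNReal.coe_one]

variable [∀ k, IsProbabilityMeasure (p k)]

theorem IsSprouting.measurable_avg (hΦ : IsSprouting Y m c θ Φ) (k : ℕ) :
    Measurable (avg p Φ k) :=
  Measurable.lintegral_prod_right' (hΦ.meas_Φ k)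

theorem IsSprouting.measurable_avg_weight (hΦ : IsSprouting Y m c θ Φ) (k : ℕ) :
    Measurable (avg p θ k) :=
  Measurable.lintegral_prod_right' (hΦ.meas_θ k)

/-- The submartingale property: since `z k` has law `p k` and is independent of the previous glue
points, replacing a proportion `a k` of the mass by a stick glued at `z k` does not change the
conditional expectation of the average, except for the increment carried by the new stick. The
function `g` tests against events depending on the first `k` glue points. -/
theorem IsSprouting.lintegral_avg_succ (hU : IsUrn Y p ν a) (hΦ : IsSprouting Y m c θ Φ) {k : ℕ}
    (hk : m ≤ k) {g : (ℕ → ℝ≥0) → ℝ≥0∞} (hg : Measurable g) (hgdep : ∀ z, g (trunc k z) = g z) :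
    ∫⁻ z, g z * avg p Φ (k + 1) z ∂Measure.infinitePi p =
      ∫⁻ z, g z * avg p Φ k z ∂Measure.infinitePi p +
        a k * (∫⁻ x, c k x ∂ν k) * ∫⁻ z, g z * avg p θ k z ∂Measure.infinitePi p := by
  have m1 := hΦ.measurable_avg (p := p) k
  have m2 := hΦ.measurable_avg_weight (p := p) k
  have m3 : Measurable fun z : ℕ → ℝ≥0 => Φ k z (z k) :=
    (hΦ.meas_Φ k).comp (measurable_id.prodMk (measurable_pi_apply k))
  have m4 : Measurable fun z : ℕ → ℝ≥0 => θ k z (z k) :=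
    (hΦ.meas_θ k).comp (measurable_id.prodMk (measurable_pi_apply k))
  have key : ∀ Ψ : ℕ → (ℕ → ℝ≥0) → ℝ≥0 → ℝ≥0∞, Measurable (Function.uncurry (Ψ k)) →
      (∀ z x, Ψ k (trunc k z) x = Ψ k z x) →
      ∫⁻ z, g z * Ψ k z (z k) ∂Measure.infinitePi p =
        ∫⁻ z, g z * avg p Ψ k z ∂Measure.infinitePi p := by
    intro Ψ h1 h2
    rw [lintegral_eval_eq p k (G := fun z x => g z * Ψ k z x) (by
      exact (hg.comp measurable_fst).mul h1) (fun z x => by rw [hgdep, h2])]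
    refine lintegral_congr fun z => ?_
    rw [lintegral_const_mul _ (h1.of_uncurry_left)]
    rfl
  have h1 : Measurable fun z => g z * avg p Φ k z := hg.mul m1
  have h3 : Measurable fun z => g z * Φ k z (z k) := hg.mul m3
  have h4 : Measurable fun z => g z * θ k z (z k) := hg.mul m4
  set C := ∫⁻ x, c k x ∂ν k
  calc ∫⁻ z, g z * avg p Φ (k + 1) z ∂Measure.infinitePi p
      = ∫⁻ z, ((1 - a k : ℝ≥0) * (g z * avg p Φ k z) + (a k * (g z * Φ k z (z k)) +
          a k * C * (g z * θ k z (z k)))) ∂Measure.infinitePi p := by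
        refine lintegral_congr fun z => ?_
        rw [hΦ.avg_succ hU hk]
        ring
    _ = (1 - a k : ℝ≥0) * ∫⁻ z, g z * avg p Φ k z ∂Measure.infinitePi p +
        (a k * ∫⁻ z, g z * avg p Φ k z ∂Measure.infinitePi p +
          a k * C * ∫⁻ z, g z * avg p θ k z ∂Measure.infinitePi p) := by
        rw [lintegral_add_left (h1.const_mul _),
          lintegral_add_left (h3.const_mul _), lintegral_const_mul _ h1,
          lintegral_const_mul _ h3, lintegral_const_mul _ h4, key Φ (hΦ.meas_Φ k) (hΦ.dep_Φ k hk),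
          key θ (hΦ.meas_θ k) (hΦ.dep_θ k hk)]
    _ = _ := by rw [← add_assoc, ← add_mul, hU.one_sub_add, one_mul]

theorem IsSprouting.avg_weight_le (hΦ : IsSprouting Y m c θ Φ) (k : ℕ) (z : ℕ → ℝ≥0) :
    avg p θ k z ≤ 1 :=
  (lintegral_mono fun x => hΦ.θ_le k z x).trans (by simp)

theorem IsSprouting.lintegral_avg_le (hU : IsUrn Y p ν a) (hΦ : IsSprouting Y m c θ Φ)
    {B : ℝ≥0∞} (hB : ∀ k, m ≤ k → ∫⁻ z, avg p θ k z ∂Measure.infinitePi p ≤ B) {k : ℕ}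
    (hk : m ≤ k) :
    ∫⁻ z, avg p Φ k z ∂Measure.infinitePi p ≤ ∫⁻ z, avg p Φ m z ∂Measure.infinitePi p +
      (∑ j ∈ Finset.Ico m k, a j * ∫⁻ x, c j x ∂ν j) * B := by
  induction k, hk using Nat.le_induction with
  | base => simp
  | succ k hk ih =>
    have := hΦ.lintegral_avg_succ hU hk (g := fun _ => 1) measurable_const (fun _ => rfl)
    simp only [one_mul] at this
    rw [this, Finset.sum_Ico_succ_top hk, add_mul, ← add_assoc]
    gcongr
    exact hB k hk

theorem IsSprouting.lintegral_avg_le_tsum (hU : IsUrn Y p ν a) (hΦ : IsSprouting Y m c θ Φ)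
    {B : ℝ≥0∞} (hB : ∀ k, m ≤ k → ∫⁻ z, avg p θ k z ∂Measure.infinitePi p ≤ B) {k : ℕ}
    (hk : m ≤ k) :
    ∫⁻ z, avg p Φ k z ∂Measure.infinitePi p ≤ ∫⁻ z, avg p Φ m z ∂Measure.infinitePi p +
      (∑' j, a (j + m) * ∫⁻ x, c (j + m) x ∂ν (j + m)) * B := by
  refine (hΦ.lintegral_avg_le hU hB hk).trans ?_
  gcongr
  rw [Finset.sum_Ico_eq_sum_range]
  simp only [add_comm m]
  exact ENNReal.sum_le_tsum _

/-- The information carried by the glue points of index less than `m + k`. -/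
def truncFiltration (m : ℕ) : Filtration ℕ (inferInstance : MeasurableSpace (ℕ → ℝ≥0)) where
  seq k := MeasurableSpace.comap (trunc (m + k)) inferInstance
  mono' i j hij := by
    have : trunc (m + i) = trunc (m + i) ∘ trunc (m + j) := by
      funext z
      exact (trunc_trunc (by omega) z).symm
    simp only
    rw [this, ← MeasurableSpace.comap_comp]
    exact MeasurableSpace.comap_mono (measurable_trunc _).comap_le
  le' k := (measurable_trunc _).comap_le

/-- Averages of transported functionals converge almost surely: they form a submartingale bounded
in `L¹`. -/
theorem IsSprouting.ae_tendsto_avg (hU : IsUrn Y p ν a) (hΦ : IsSprouting Y m c θ Φ)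
    (hsum : ∑' j, a (j + m) * ∫⁻ x, c (j + m) x ∂ν (j + m) ≠ ∞)
    (hm : ∫⁻ z, avg p Φ m z ∂Measure.infinitePi p ≠ ∞) :
    ∀ᵐ z ∂Measure.infinitePi p, ∃ L, L ≠ ∞ ∧ Tendsto (fun k => avg p Φ k z) atTop (𝓝 L) := by
  set Q := Measure.infinitePi p
  set R := ∫⁻ z, avg p Φ m z ∂Q + ∑' j, a (j + m) * ∫⁻ x, c (j + m) x ∂ν (j + m) with hR
  have hRtop : R ≠ ∞ := ENNReal.add_ne_top.2 ⟨hm, hsum⟩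
  have hbound : ∀ k, ∫⁻ z, avg p Φ (m + k) z ∂Q ≤ R := fun k => by
    have := hΦ.lintegral_avg_le_tsum hU (B := 1) (fun k _ =>
      (lintegral_mono fun z => hΦ.avg_weight_le k z).trans (by simp)) (Nat.le_add_right m k)
    rwa [mul_one] at this
  have hmeas : ∀ k, Measurable (avg p Φ k) := hΦ.measurable_avg
  have hfin : ∀ k, ∀ᵐ z ∂Q, avg p Φ (m + k) z < ∞ := fun k =>
    ae_lt_top (hmeas _) ((hbound k).trans_lt hRtop.lt_top).ne
  let f : ℕ → (ℕ → ℝ≥0) → ℝ := fun k z => (avg p Φ (m + k) z).toReal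
  have hint : ∀ k, Integrable (f k) Q := fun k =>
    integrable_toReal_of_lintegral_ne_top (hmeas _).aemeasurable
      ((hbound k).trans_lt hRtop.lt_top).ne
  have hadp : StronglyAdapted (truncFiltration m) f := fun k => by
    refine Measurable.stronglyMeasurable ?_
    have : f k = f k ∘ trunc (m + k) := by
      funext z
      simp only [f, Function.comp_apply, hΦ.avg_trunc (Nat.le_add_right m k)]
    rw [this]
    exact (hmeas _).ennreal_toReal.comp (comap_measurable _)
  have hset : ∀ k (s : Set (ℕ → ℝ≥0)), MeasurableSet s →
      ∫ z in s, f k z ∂Q = (∫⁻ z in s, avg p Φ (m + k) z ∂Q).toReal := fun k s hs =>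
    integral_toReal (hmeas _).aemeasurable (ae_restrict_of_ae (hfin k))
  have hsub : Submartingale f (truncFiltration m) Q := by
    refine submartingale_of_setIntegral_le_succ hadp hint fun k s hs => ?_
    have hs' : MeasurableSet s := (truncFiltration m).le k s hs
    obtain ⟨t, ht, rfl⟩ := hs
    rw [hset k _ hs', hset (k + 1) _ hs']
    refine ENNReal.toReal_mono ?_ ?_
    · exact ((setLIntegral_le_lintegral _ _).trans (hbound (k + 1))).trans_lt hRtop.lt_top |>.ne
    · have h := hΦ.lintegral_avg_succ hU (Nat.le_add_right m k)
        (g := (trunc (m + k) ⁻¹' t).indicator 1) (measurable_one.indicator hs') (fun z => by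
          have := trunc_trunc (le_refl (m + k)) z
          by_cases hz : trunc (m + k) z ∈ t <;> simp [indicator, this, hz])
      have hind : ∀ N : (ℕ → ℝ≥0) → ℝ≥0∞, ∫⁻ z, (trunc (m + k) ⁻¹' t).indicator 1 z * N z ∂Q =
          ∫⁻ z in trunc (m + k) ⁻¹' t, N z ∂Q := fun N => by
        rw [← lintegral_indicator hs']
        refine lintegral_congr fun z => ?_
        by_cases hz : z ∈ trunc (m + k) ⁻¹' t <;> simp [hz]
      rw [hind, hind] at h
      rw [← add_assoc, h]
      exact le_self_add
  have hconv := hsub.exists_ae_tendsto_of_bdd (R := R.toNNReal) fun k => by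
    rw [eLpNorm_one_eq_lintegral_enorm, ENNReal.coe_toNNReal hRtop]
    refine le_trans (lintegral_mono fun z => ?_) (hbound k)
    rw [Real.enorm_eq_ofReal ENNReal.toReal_nonneg]
    exact ENNReal.ofReal_toReal_le
  filter_upwards [hconv, ae_all_iff.2 hfin] with z ⟨L, hz⟩ hz'
  refine ⟨ENNReal.ofReal L, ENNReal.ofReal_ne_top, ?_⟩
  rw [← tendsto_add_atTop_iff_nat m]
  refine (ENNReal.tendsto_ofReal hz).congr fun k => ?_
  rw [ENNReal.ofReal_toReal (hz' k).ne, add_comm]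

end Urn

/-! ### Almost sure properties of the glued tree, for fixed masses and cuts -/

section Dependence

variable {Y : ℕ → ℝ≥0} {m k n : ℕ}

theorem proj_congr {z z' : ℕ → ℝ≥0} (h : ∀ i < k, z i = z' i) (x : ℝ≥0) :
    proj Y z m k x = proj Y z' m k x := by
  induction k generalizing x with
  | zero => rfl
  | succ k ih =>
    have ih' := ih fun i hi => h i (hi.trans k.lt_succ_self)
    simp only [proj, h k k.lt_succ_self, ih']

theorem height_congr {z z' : ℕ → ℝ≥0} (h : ∀ i < k, z i = z' i) (x : ℝ≥0) :
    height Y z m k x = height Y z' m k x := by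
  induction k generalizing x with
  | zero => rfl
  | succ k ih =>
    have ih' := ih fun i hi => h i (hi.trans k.lt_succ_self)
    simp only [height, h k k.lt_succ_self, ih']

theorem rawDist_congr {z z' : ℕ → ℝ≥0} (h : ∀ i < k, z i = z' i) (s t : ℝ≥0) :
    rawDist Y z k s t = rawDist Y z' k s t := by
  induction k generalizing s t with
  | zero => rfl
  | succ k ih =>
    have ih' := ih fun i hi => h i (hi.trans k.lt_succ_self)
    simp only [rawDist, h k k.lt_succ_self, ih']

theorem trunc_apply_of_lt {i : ℕ} (h : i < k) (z : ℕ → ℝ≥0) : trunc k z i = z i := by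
  simp [trunc, h]

theorem measurable_proj_right (Y : ℕ → ℝ≥0) (m k : ℕ) :
    Measurable fun w : (ℕ → ℝ≥0) × ℝ≥0 => proj Y w.1 m k w.2 :=
  (measurable_proj m k).comp (f := fun w : (ℕ → ℝ≥0) × ℝ≥0 => ((Y, w.1), w.2)) (by fun_prop)

theorem measurable_height_right (Y : ℕ → ℝ≥0) (m k : ℕ) :
    Measurable fun w : (ℕ → ℝ≥0) × ℝ≥0 => height Y w.1 m k w.2 :=
  (measurable_height m k).comp (f := fun w : (ℕ → ℝ≥0) × ℝ≥0 => ((Y, w.1), w.2)) (by fun_prop)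

theorem measurable_rawDist (k : ℕ) : Measurable
    fun w : ((ℕ → ℝ≥0) × (ℕ → ℝ≥0)) × (ℝ≥0 × ℝ≥0) => rawDist w.1.1 w.1.2 k w.2.1 w.2.2 := by
  induction k with
  | zero => simp only [rawDist]; fun_prop
  | succ k ih =>
    simp only [rawDist]
    refine Measurable.ite (measurableSet_le (by fun_prop) (by fun_prop)) ?_ ?_
    · refine Measurable.ite (measurableSet_le (by fun_prop) (by fun_prop)) ih ?_
      refine Measurable.add ?_ (by fun_prop)
      exact ih.comp (f := fun w : ((ℕ → ℝ≥0) × (ℕ → ℝ≥0)) × (ℝ≥0 × ℝ≥0) =>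
        (w.1, (w.2.1, w.1.2 k))) (by fun_prop)
    · refine Measurable.ite (measurableSet_le (by fun_prop) (by fun_prop)) ?_ (by fun_prop)
      refine Measurable.add ?_ (by fun_prop)
      exact ih.comp (f := fun w : ((ℕ → ℝ≥0) × (ℕ → ℝ≥0)) × (ℝ≥0 × ℝ≥0) =>
        (w.1, (w.2.2, w.1.2 k))) (by fun_prop)

theorem measurable_rawDist_right (Y : ℕ → ℝ≥0) (k : ℕ) : Measurable
    fun w : (ℕ → ℝ≥0) × (ℝ≥0 × ℝ≥0) => rawDist Y w.1 k w.2.1 w.2.2 :=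
  (measurable_rawDist k).comp
    (f := fun w : (ℕ → ℝ≥0) × (ℝ≥0 × ℝ≥0) => ((Y, w.1), w.2)) (by fun_prop)

theorem height_proj_le (z : ℕ → ℝ≥0) (hnm : n ≤ m) (hk : m ≤ k) (x : ℝ≥0) :
    height Y z n m (proj Y z m k x) ≤ height Y z n k x := by
  induction k, hk using Nat.le_induction generalizing x with
  | base => rw [proj_of_le le_rfl]
  | succ k hk ih =>
    rcases le_or_gt x (Y k) with h | h
    · rw [proj_succ_of_le h, height_succ_of_le h]; exact ih x
    · rw [proj_succ_of_lt hk h, height_succ_of_lt (hnm.trans hk) h]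
      exact (ih (z k)).trans le_self_add

theorem height_pos (z : ℕ → ℝ≥0) (hk : n ≤ k) {x : ℝ≥0} (hx : Y n < x)
    (hxk : x ≤ Y k) : 0 < height Y z n k x := by
  induction k, hk using Nat.le_induction generalizing x with
  | base => exact absurd hxk hx.not_ge
  | succ k hk ih =>
    rcases le_or_gt x (Y k) with h | h
    · rw [height_succ_of_le h]; exact ih hx h
    · rw [height_succ_of_lt hk h]
      exact (tsub_pos_of_lt h).trans_le le_add_self

/-- Evaluating a function at the projection gives a functional constant along the new sticks. -/
theorem isSprouting_proj (Y : ℕ → ℝ≥0) (m : ℕ) {φ : (ℕ → ℝ≥0) → ℝ≥0 → ℝ≥0∞}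
    (hφ : Measurable (Function.uncurry φ)) (hdep : ∀ z x, φ (trunc m z) x = φ z x) :
    IsSprouting Y m 0 0 (fun k z x => φ z (proj Y z m k x)) where
  meas_c _ := measurable_const
  meas_θ _ := measurable_const
  meas_Φ k := hφ.comp (measurable_fst.prodMk (measurable_proj_right Y m k))
  dep_θ _ _ _ _ := rfl
  dep_Φ k hk z x := by
    rw [proj_congr (fun i hi => trunc_apply_of_lt hi z), ← hdep, trunc_trunc hk, hdep]
  of_le k _ z x hx := by rw [proj_succ_of_le hx]
  of_lt k hk z x hx := by simp [proj_succ_of_lt hk hx]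
  θ_le k z x := by simp

/-- The height above level `m`, restricted to the points projecting into `I`. -/
theorem isSprouting_height (Y : ℕ → ℝ≥0) (m : ℕ) {I : Set ℝ≥0} (hI : MeasurableSet I) :
    IsSprouting Y m (fun k x => ((x - Y k : ℝ≥0) : ℝ≥0∞))
      (fun k z x => I.indicator 1 (proj Y z m k x))
      (fun k z x => I.indicator 1 (proj Y z m k x) * height Y z m k x) where
  meas_c k := by fun_prop
  meas_θ k := (measurable_one.indicator hI).comp (measurable_proj_right Y m k)
  meas_Φ k := ((measurable_one.indicator hI).comp (measurable_proj_right Y m k)).mul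
    (measurable_height_right Y m k).coe_nnreal_ennreal
  dep_θ k hk z x := by rw [proj_congr (fun i hi => trunc_apply_of_lt hi z)]
  dep_Φ k hk z x := by
    rw [proj_congr (fun i hi => trunc_apply_of_lt hi z),
      height_congr (fun i hi => trunc_apply_of_lt hi z)]
  of_le k hk z x hx := by rw [proj_succ_of_le hx, height_succ_of_le hx]
  of_lt k hk z x hx := by
    rw [proj_succ_of_lt hk hx, height_succ_of_lt hk hx, ENNReal.coe_add, mul_add]
  θ_le k z x := indicator_le' (fun _ _ => le_rfl) (fun _ _ => zero_le) _

end Dependence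

section Events

variable {Y : ℕ → ℝ≥0} {p ν : ℕ → Measure ℝ≥0} {a : ℕ → ℝ≥0}

/-- The law of the projection of a random point, one level up. -/
theorem IsUrn.lintegral_proj_succ (hU : IsUrn Y p ν a) {m k : ℕ} (hk : m ≤ k) (z : ℕ → ℝ≥0)
    (h : ℝ≥0 → ℝ≥0∞) :
    ∫⁻ x, h (proj Y z m (k + 1) x) ∂p (k + 1) =
      (1 - a k : ℝ≥0) * ∫⁻ x, h (proj Y z m k x) ∂p k + a k * h (proj Y z m k (z k)) := by
  have := hU.prob_ν k
  rw [hU.lintegral_succ]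
  congr 2
  · refine lintegral_congr_ae ?_
    filter_upwards [hU.p_le k] with x hx
    rw [proj_succ_of_le hx]
  · calc _ = ∫⁻ x, h (proj Y z m k (z k)) ∂ν k := by
          refine lintegral_congr_ae ?_
          filter_upwards [hU.ν_gt k] with x hx
          rw [proj_succ_of_lt hk hx]
      _ = _ := by simp

variable [∀ k, IsProbabilityMeasure (p k)]

theorem IsUrn.ae_le (hU : IsUrn Y p ν a) :
    ∀ᵐ z ∂Measure.infinitePi p, ∀ k, z k ≤ Y k := by
  refine ae_all_iff.2 fun k => ?_
  have h := hU.p_le k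
  rw [← Measure.infinitePi_map_eval p k] at h
  exact ae_of_ae_map (measurable_pi_apply k).aemeasurable h

theorem lintegral_indicator_proj (z : ℕ → ℝ≥0) (m k : ℕ) {E : Set ℝ≥0} (hE : MeasurableSet E)
    (ρ : Measure ℝ≥0) :
    ∫⁻ x, E.indicator 1 (proj Y z m k x) ∂ρ = ρ {x | proj Y z m k x ∈ E} := by
  have : (fun x => E.indicator (1 : ℝ≥0 → ℝ≥0∞) (proj Y z m k x)) =
      {x | proj Y z m k x ∈ E}.indicator 1 := rfl
  rw [this, lintegral_indicator_one]
  exact measurable_proj' Y z m k hE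

theorem IsUrn.ae_tendsto_proj (hU : IsUrn Y p ν a) (m : ℕ) {E : Set ℝ≥0} (hE : MeasurableSet E) :
    ∀ᵐ z ∂Measure.infinitePi p, ∃ L, L ≠ ∞ ∧
      Tendsto (fun k => p k {x | proj Y z m k x ∈ E}) atTop (𝓝 L) := by
  have hΦ := isSprouting_proj Y m (φ := fun _ x => E.indicator 1 x)
    ((measurable_one.indicator hE).comp measurable_snd) (fun _ _ => rfl)
  have h := hΦ.ae_tendsto_avg (p := p) hU (by simp) (by
    refine ((lintegral_mono fun z => ?_).trans_lt (b := ∫⁻ z, 1 ∂Measure.infinitePi p)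
      (by simp)).ne
    simp only [avg, lintegral_indicator_proj _ _ _ hE]
    exact prob_le_one)
  simpa only [avg, lintegral_indicator_proj _ _ _ hE] using h

/-- The expected increments of the mean height above a level are `a k ∫ (x - Y k) dν k`; if they are
summable, the mean height above a high level is eventually small. -/
theorem IsUrn.ae_height_small (hU : IsUrn Y p ν a)
    (hsum : ∑' k, a k * ∫⁻ x, ((x - Y k : ℝ≥0) : ℝ≥0∞) ∂ν k ≠ ∞) :
    ∀ᵐ z ∂Measure.infinitePi p, ∀ ε : ℝ≥0∞, 0 < ε → ∃ m, ∀ᶠ k in atTop,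
      ∫⁻ x, height Y z m k x ∂p k ≤ ε := by
  set Q := Measure.infinitePi p
  set b : ℕ → ℝ≥0∞ := fun k => a k * ∫⁻ x, ((x - Y k : ℝ≥0) : ℝ≥0∞) ∂ν k with hb
  let Φ : ℕ → ℕ → (ℕ → ℝ≥0) → ℝ≥0 → ℝ≥0∞ := fun m k z x =>
    (univ : Set ℝ≥0).indicator 1 (proj Y z m k x) * height Y z m k x
  have hΦ : ∀ m, IsSprouting Y m _ _ (Φ m) := fun m => isSprouting_height Y m MeasurableSet.univ
  have hN : ∀ m k z, avg p (Φ m) k z = ∫⁻ x, height Y z m k x ∂p k := fun m k z => by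
    simp [avg, Φ]
  have h0 : ∀ m, ∫⁻ z, avg p (Φ m) m z ∂Q = 0 := fun m => by
    simp [hN, height_of_le le_rfl]
  have htail : ∀ m, ∑' j, b (j + m) ≠ ∞ := fun m =>
    (ENNReal.tsum_comp_le_tsum_of_injective (add_left_injective m) b).trans_lt hsum.lt_top |>.ne
  have hconv : ∀ᵐ z ∂Q, ∀ m, ∃ L, L ≠ ∞ ∧ Tendsto (fun k => avg p (Φ m) k z) atTop (𝓝 L) :=
    ae_all_iff.2 fun m => (hΦ m).ae_tendsto_avg hU (htail m) (by rw [h0]; simp)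
  have hmeas : ∀ m, Measurable fun z => liminf (fun k => avg p (Φ m) k z) atTop := fun m =>
    Measurable.liminf fun k => (hΦ m).measurable_avg k
  have hle : ∀ m, ∫⁻ z, liminf (fun k => avg p (Φ m) k z) atTop ∂Q ≤ ∑' j, b (j + m) := by
    intro m
    refine (lintegral_liminf_le fun k => (hΦ m).measurable_avg k).trans ?_
    refine liminf_le_of_frequently_le' (Eventually.frequently ?_)
    filter_upwards [eventually_ge_atTop m] with k hk
    have := (hΦ m).lintegral_avg_le_tsum hU (p := p) (B := 1) (fun k _ =>
      (lintegral_mono fun z => (hΦ m).avg_weight_le k z).trans (by simp)) hk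
    rwa [h0, zero_add, mul_one] at this
  -- the expected limiting mean height over level `m` is at most the `m`-th tail of the series
  have hzero : ∫⁻ z, ⨅ m, liminf (fun k => avg p (Φ m) k z) atTop ∂Q = 0 := by
    refine le_antisymm (ge_of_tendsto' (ENNReal.tendsto_sum_nat_add b hsum) fun m => ?_) bot_le
    exact (lintegral_mono fun z => iInf_le _ m).trans (hle m)
  rw [lintegral_eq_zero_iff (Measurable.iInf hmeas)] at hzero
  filter_upwards [hzero, hconv] with z hz hz' ε hε
  have : ⨅ m, liminf (fun k => avg p (Φ m) k z) atTop < ε := by rw [hz]; exact hε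
  obtain ⟨m, hm⟩ := iInf_lt_iff.1 this
  obtain ⟨L, -, hL⟩ := hz' m
  rw [hL.liminf_eq] at hm
  refine ⟨m, ?_⟩
  filter_upwards [hL.eventually (gt_mem_nhds hm)] with k hk
  rw [← hN]
  exact hk.le

/-- Small neighbourhoods of the subtree built from `[0, Y n]` have small mass. A point within `δ` of
this subtree projects at level `m` to a point within `δ` of it, and the expected mass of the points
with that property is the same at all levels `k ≥ m`. For `δ → 0` the expected mass at level `m`
tends to the mass `p m [0, Y n]` of the subtree itself, which tends to zero as `m → ∞`. -/
theorem IsUrn.ae_mass_near_subtree (hU : IsUrn Y p ν a) (n : ℕ)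
    (hvanish : Tendsto (fun m => p m (Iic (Y n))) atTop (𝓝 0)) :
    ∀ᵐ z ∂Measure.infinitePi p, ∀ ε : ℝ≥0∞, 0 < ε → ∃ δ : ℝ≥0, 0 < δ ∧ ∃ᶠ k in atTop,
      p k {x | height Y z n k x < δ} ≤ ε := by
  set Q := Measure.infinitePi p
  let δ : ℕ → ℝ≥0 := fun j => 1 / (j + 1)
  have hδpos : ∀ j, 0 < δ j := fun j => by positivity
  let A : ℕ → ℕ → Set ((ℕ → ℝ≥0) × ℝ≥0) := fun m j => {w | height Y w.1 n m w.2 < δ j}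
  have hA : ∀ m j, MeasurableSet (A m j) := fun m j =>
    measurableSet_lt (measurable_height_right Y n m) measurable_const
  let φ : ℕ → ℕ → (ℕ → ℝ≥0) → ℝ≥0 → ℝ≥0∞ := fun m j z x => (A m j).indicator 1 (z, x)
  have hφ : ∀ m j, IsSprouting Y m 0 0 (fun k z x => φ m j z (proj Y z m k x)) := fun m j =>
    isSprouting_proj Y m (measurable_one.indicator (hA m j)) fun z x => by
      simp only [φ, A, indicator, mem_ofPred_eq, height_congr (fun i hi => trunc_apply_of_lt hi z),
        Pi.one_apply]
  let N : ℕ → ℕ → ℕ → (ℕ → ℝ≥0) → ℝ≥0∞ := fun m j k z =>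
    avg p (fun k z x => φ m j z (proj Y z m k x)) k z
  have hstart : ∀ m j, ∫⁻ z, N m j m z ∂Q = (Q.prod (p m)) (A m j) := fun m j => by
    rw [Measure.prod_apply (hA m j)]
    refine lintegral_congr fun z => ?_
    simp only [N, avg, proj_of_le le_rfl, φ]
    exact lintegral_indicator_one (measurable_prodMk_left (hA m j))
  have hlim : ∀ m, n ≤ m → ∫⁻ z, ⨅ j, ⨅ m, liminf (fun k => N m j k z) atTop ∂Q ≤
      p m (Iic (Y n)) := by
    intro m hm
    have hle : ∀ j, ∫⁻ z, ⨅ j, ⨅ m, liminf (fun k => N m j k z) atTop ∂Q ≤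
        (Q.prod (p m)) (A m j) := fun j => by
      refine (lintegral_mono fun z => (iInf_le _ j).trans (iInf_le _ m)).trans ?_
      refine (lintegral_liminf_le fun k => (hφ m j).measurable_avg k).trans ?_
      refine liminf_le_of_frequently_le' (Eventually.frequently ?_)
      filter_upwards [eventually_ge_atTop m] with k hk
      have := (hφ m j).lintegral_avg_le hU (p := p) (B := 0) (fun k _ => by simp [avg]) hk
      rw [mul_zero, add_zero] at this
      rw [← hstart]
      exact this
    have hanti : Antitone fun j => A m j := fun i j hij w hw => by
      refine lt_of_lt_of_le (show height Y w.1 n m w.2 < δ j from hw) ?_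
      exact one_div_le_one_div_of_le (by positivity) (by gcongr)
    have ht := tendsto_measure_iInter_atTop (μ := Q.prod (p m))
      (fun j => (hA m j).nullMeasurableSet) hanti ⟨0, measure_ne_top _ _⟩
    refine (ge_of_tendsto' ht hle).trans ?_
    calc (Q.prod (p m)) (⋂ j, A m j) ≤ (Q.prod (p m)) (univ ×ˢ Iic (Y n)) := by
          refine measure_mono_ae ?_
          have h1 : ∀ᵐ w ∂Q.prod (p m), w.2 ≤ Y m :=
            Measure.quasiMeasurePreserving_snd.ae (hU.p_le m)
          filter_upwards [h1] with w hw hwA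
          refine ⟨mem_univ _, mem_Iic.2 (not_lt.1 fun hlt => ?_)⟩
          have hpos := height_pos w.1 hm hlt hw
          obtain ⟨j, hj⟩ := exists_nat_one_div_lt (NNReal.coe_pos.2 hpos)
          have hwj : height Y w.1 n m w.2 < δ j := mem_iInter.1 hwA j
          rw [← NNReal.coe_lt_coe] at hwj
          simp only [δ] at hwj
          push_cast at hwj
          linarith
      _ = p m (Iic (Y n)) := by rw [Measure.prod_prod]; simp
  have hzero : ∫⁻ z, ⨅ j, ⨅ m, liminf (fun k => N m j k z) atTop ∂Q = 0 := by
    refine le_antisymm (ge_of_tendsto hvanish ?_) bot_le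
    filter_upwards [eventually_ge_atTop n] with m hm using hlim m hm
  rw [lintegral_eq_zero_iff (Measurable.iInf fun j => Measurable.iInf fun m =>
    Measurable.liminf fun k => (hφ m j).measurable_avg k)] at hzero
  filter_upwards [hzero] with z hz ε hε
  have hlt : ⨅ j, ⨅ m, liminf (fun k => N m j k z) atTop < ε := by rw [hz]; exact hε
  obtain ⟨j, hj⟩ := iInf_lt_iff.1 hlt
  obtain ⟨m, hm⟩ := iInf_lt_iff.1 hj
  refine ⟨δ j, hδpos j, ?_⟩
  have hfr := frequently_lt_of_liminf_lt (by isBoundedDefault) hm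
  refine (hfr.and_eventually (eventually_ge_atTop (max m n))).mono fun k hk => le_trans ?_ hk.1.le
  have hmk : m ≤ k := (le_max_left _ _).trans hk.2
  calc p k {x | height Y z n k x < δ j}
      = ∫⁻ x, {x | height Y z n k x < δ j}.indicator 1 x ∂p k := by
        rw [lintegral_indicator_one]
        exact measurableSet_lt (measurable_height' Y z n k) measurable_const
    _ ≤ N m j k z := by
        refine lintegral_mono fun x => ?_
        by_cases hx : height Y z n k x < δ j
        · have hmem : (z, proj Y z m k x) ∈ A m j := by
            change height Y z n m (proj Y z m k x) < δ j
            rcases le_or_gt n m with h | h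
            · exact (height_proj_le z h hmk x).trans_lt hx
            · rw [height_of_le h.le]; exact hδpos j
          simp only [φ, indicator_of_mem hmem]
          exact indicator_le' (fun _ _ => le_rfl) (fun _ _ => zero_le) _
        · simp [indicator, hx]

/-- For two independent random points, the expectation of a bounded function of the projections
increases by at most `a k ^ 2` at each step: the probability that both points are on the new
stick. -/
theorem IsUrn.lintegral_pair_le (hU : IsUrn Y p ν a) (m : ℕ)
    {κ : (ℕ → ℝ≥0) → ℝ≥0 → ℝ≥0 → ℝ≥0∞}
    (hκ : Measurable fun w : (ℕ → ℝ≥0) × (ℝ≥0 × ℝ≥0) => κ w.1 w.2.1 w.2.2)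
    (hdep : ∀ z x y, κ (trunc m z) x y = κ z x y) (hκ1 : ∀ z x y, κ z x y ≤ 1) {k : ℕ}
    (hk : m ≤ k) :
    ∫⁻ z, ∫⁻ x, ∫⁻ y, κ z (proj Y z m k x) (proj Y z m k y) ∂p k ∂p k ∂Measure.infinitePi p ≤
      ∫⁻ z, ∫⁻ x, ∫⁻ y, κ z x y ∂p m ∂p m ∂Measure.infinitePi p +
        ∑' j, (a (j + m) : ℝ≥0∞) ^ 2 := by
  set Q := Measure.infinitePi p
  suffices h : ∫⁻ z, ∫⁻ x, ∫⁻ y, κ z (proj Y z m k x) (proj Y z m k y) ∂p k ∂p k ∂Q ≤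
      ∫⁻ z, ∫⁻ x, ∫⁻ y, κ z x y ∂p m ∂p m ∂Q + ∑ j ∈ Finset.Ico m k, (a j : ℝ≥0∞) ^ 2 by
    refine h.trans ?_
    gcongr
    rw [Finset.sum_Ico_eq_sum_range]
    simp only [add_comm m]
    exact ENNReal.sum_le_tsum _
  induction k, hk using Nat.le_induction with
  | base => simp [proj_of_le le_rfl]
  | succ k hk ih =>
    rw [Finset.sum_Ico_succ_top hk, ← add_assoc]
    refine le_trans ?_ (add_le_add_left ih _)
    let K : (ℕ → ℝ≥0) → ℝ≥0 → ℝ≥0 → ℝ≥0∞ := fun z x y => κ z (proj Y z m k x) (proj Y z m k y)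
    have hK : Measurable fun w : (ℕ → ℝ≥0) × (ℝ≥0 × ℝ≥0) => K w.1 w.2.1 w.2.2 := by
      refine hκ.comp (f := fun w : (ℕ → ℝ≥0) × (ℝ≥0 × ℝ≥0) =>
        (w.1, (proj Y w.1 m k w.2.1, proj Y w.1 m k w.2.2)))
        (measurable_fst.prodMk (Measurable.prodMk ?_ ?_))
      · exact (measurable_proj_right Y m k).comp
          (f := fun w : (ℕ → ℝ≥0) × (ℝ≥0 × ℝ≥0) => (w.1, w.2.1)) (by fun_prop)
      · exact (measurable_proj_right Y m k).comp
          (f := fun w : (ℕ → ℝ≥0) × (ℝ≥0 × ℝ≥0) => (w.1, w.2.2)) (by fun_prop)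
    have hKdep : ∀ z x y, K (trunc k z) x y = K z x y := fun z x y => by
      simp only [K, proj_congr (fun i hi => trunc_apply_of_lt hi z)]
      rw [← hdep, trunc_trunc hk, hdep]
    let R : (ℕ → ℝ≥0) → ℝ≥0 → ℝ≥0∞ := fun z x => ∫⁻ y, K z x y ∂p k
    let C : (ℕ → ℝ≥0) → ℝ≥0 → ℝ≥0∞ := fun z y => ∫⁻ x, K z x y ∂p k
    have hR : Measurable (Function.uncurry R) :=
      Measurable.lintegral_prod_right' (f := fun w : ((ℕ → ℝ≥0) × ℝ≥0) × ℝ≥0 => K w.1.1 w.1.2 w.2)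
        (hK.comp (by fun_prop : Measurable fun w : ((ℕ → ℝ≥0) × ℝ≥0) × ℝ≥0 =>
          (w.1.1, (w.1.2, w.2))))
    have hC : Measurable (Function.uncurry C) :=
      Measurable.lintegral_prod_right' (f := fun w : ((ℕ → ℝ≥0) × ℝ≥0) × ℝ≥0 => K w.1.1 w.2 w.1.2)
        (hK.comp (by fun_prop : Measurable fun w : ((ℕ → ℝ≥0) × ℝ≥0) × ℝ≥0 =>
          (w.1.1, (w.2, w.1.2))))
    let D : (ℕ → ℝ≥0) → ℝ≥0∞ := fun z => ∫⁻ x, ∫⁻ y, K z x y ∂p k ∂p k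
    have hDm : Measurable D := Measurable.lintegral_prod_right' hR
    have e1 : ∫⁻ z, R z (z k) ∂Q = ∫⁻ z, D z ∂Q :=
      lintegral_eval_eq p k hR fun z x => by simp only [R, hKdep]
    have e2 : ∫⁻ z, C z (z k) ∂Q = ∫⁻ z, D z ∂Q := by
      rw [lintegral_eval_eq p k hC fun z x => by simp only [C, hKdep]]
      refine lintegral_congr fun z => ?_
      refine lintegral_lintegral_swap (f := fun y x => K z x y) ?_
      exact (hK.comp (by fun_prop : Measurable fun w : ℝ≥0 × ℝ≥0 =>
        (z, (w.2, w.1)))).aemeasurable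
    have hstep : ∀ z, ∫⁻ x, ∫⁻ y, κ z (proj Y z m (k + 1) x) (proj Y z m (k + 1) y) ∂p (k + 1)
        ∂p (k + 1) ≤ (1 - a k : ℝ≥0) * ((1 - a k : ℝ≥0) * D z + a k * C z (z k)) +
          a k * ((1 - a k : ℝ≥0) * R z (z k) + a k) := fun z => by
      have h1 : ∀ x, ∫⁻ y, κ z x (proj Y z m (k + 1) y) ∂p (k + 1) = (1 - a k : ℝ≥0) *
          ∫⁻ y, κ z x (proj Y z m k y) ∂p k + a k * κ z x (proj Y z m k (z k)) := fun x =>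
        hU.lintegral_proj_succ hk z (κ z x)
      simp only [h1]
      rw [hU.lintegral_proj_succ hk z (fun x => (1 - a k : ℝ≥0) *
        ∫⁻ y, κ z x (proj Y z m k y) ∂p k + a k * κ z x (proj Y z m k (z k)))]
      gcongr
      · have hKz : Measurable fun x => ∫⁻ y, κ z (proj Y z m k x) (proj Y z m k y) ∂p k :=
          hR.of_uncurry_left (x := z)
        have hKz' : Measurable fun x => κ z (proj Y z m k x) (proj Y z m k (z k)) :=
          hK.comp (by fun_prop : Measurable fun x : ℝ≥0 => (z, (x, z k)))
        rw [lintegral_add_left (hKz.const_mul _), lintegral_const_mul _ hKz,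
          lintegral_const_mul _ hKz']
      · exact mul_le_of_le_one_right' (hκ1 _ _ _)
    have hcm : Measurable fun z : ℕ → ℝ≥0 => C z (z k) :=
      hC.comp (measurable_id.prodMk (measurable_pi_apply k))
    have hrm : Measurable fun z : ℕ → ℝ≥0 => R z (z k) :=
      hR.comp (measurable_id.prodMk (measurable_pi_apply k))
    refine (lintegral_mono hstep).trans ?_
    rw [lintegral_add_left (by fun_prop), lintegral_const_mul _ (by fun_prop),
      lintegral_const_mul _ (by fun_prop), lintegral_add_left (by fun_prop),
      lintegral_add_left (by fun_prop), lintegral_const_mul _ hDm, lintegral_const_mul _ hcm,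
      lintegral_const_mul _ hrm, e1, e2, lintegral_const, measure_univ, mul_one]
    change _ ≤ ∫⁻ z, D z ∂Q + _
    rw [← add_mul, hU.one_sub_add, one_mul, mul_add, ← add_assoc, ← sq]
    gcongr
    calc _ ≤ ((1 - a k : ℝ≥0) : ℝ≥0∞) * ∫⁻ z, D z ∂Q + a k * ∫⁻ z, D z ∂Q := by
          gcongr
          exact mul_le_of_le_one_left' (by exact_mod_cast tsub_le_self)
      _ = _ := by rw [← add_mul, hU.one_sub_add, one_mul]

end Events

/-! ### Almost sure absence of atoms, for fixed masses and cuts -/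

section Atoms

variable {Y : ℕ → ℝ≥0} {p ν : ℕ → Measure ℝ≥0} {a : ℕ → ℝ≥0}

/-- The largest atom of `p m` tends to zero: an atom beyond `Y K` appears as part of some `ν k` with
`k ≥ K`, with mass at most `a k`, and its mass only decreases afterwards. -/
theorem IsUrn.tendsto_iSup_singleton (hU : IsUrn Y p ν a)
    (hvanish : ∀ n, Tendsto (fun m => p m (Iic (Y n))) atTop (𝓝 0))
    (ha : Tendsto a atTop (𝓝 0)) : Tendsto (fun m => ⨆ x, p m {x}) atTop (𝓝 0) := by
  refine ENNReal.tendsto_nhds_zero.2 fun ε hε => ?_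
  have ha' : Tendsto (fun k => (a k : ℝ≥0∞)) atTop (𝓝 0) := ENNReal.tendsto_coe.2 ha
  obtain ⟨K, hK⟩ := eventually_atTop.1 (ENNReal.tendsto_nhds_zero.1 ha' ε hε)
  have hfar : ∀ m, K ≤ m → ∀ x, Y K < x → p m {x} ≤ ε := by
    intro m hm
    induction m, hm using Nat.le_induction with
    | base =>
      intro x hx
      have : p K {x} = 0 := measure_mono_null (singleton_subset_iff.2 (not_le.2 hx)) (hU.p_le K)
      simp [this]
    | succ m hm ih =>
      intro x hx
      have := hU.prob_ν m
      rw [hU.succ, Measure.add_apply, Measure.smul_apply, Measure.smul_apply]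
      simp only [ENNReal.smul_def, smul_eq_mul]
      rcases le_or_gt x (Y m) with h | h
      · have : ν m {x} = 0 := measure_mono_null (singleton_subset_iff.2 (not_lt.2 h)) (hU.ν_gt m)
        rw [this, mul_zero, add_zero]
        exact (mul_le_of_le_one_left' (by exact_mod_cast tsub_le_self)).trans (ih x hx)
      · have : p m {x} = 0 := measure_mono_null (singleton_subset_iff.2 (not_le.2 h)) (hU.p_le m)
        rw [this, mul_zero, zero_add]
        exact (mul_le_of_le_one_right' prob_le_one).trans (hK m hm)
  filter_upwards [eventually_ge_atTop K, ENNReal.tendsto_nhds_zero.1 (hvanish K) ε hε]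
    with m hm hm'
  refine iSup_le fun x => ?_
  rcases le_or_gt x (Y K) with h | h
  · exact (measure_mono (singleton_subset_iff.2 (mem_Iic.2 h))).trans hm'
  · exact hfar m hm x h

/-- The stick-breaking data with given cuts and glue points. -/
def mkStick (hY : StrictMono Y) (hY' : Tendsto Y atTop atTop) {z : ℕ → ℝ≥0}
    (hz : ∀ k, z k ≤ Y k) : StickBreaking := ⟨Y, z, hY, hY', hz⟩

theorem rawDist_pos (hY : StrictMono Y) (hY' : Tendsto Y atTop atTop) {z : ℕ → ℝ≥0}
    (hz : ∀ k, z k ≤ Y k) {m : ℕ} {s t : ℝ≥0} (hs : s ≤ Y m) (ht : t ≤ Y m) (hst : s ≠ t) :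
    0 < rawDist Y z m s t := by
  have h := rawDist_eq_lineDist (mkStick hY hY' hz) hs ht
  change rawDist Y z m s t = _ at h
  rw [h]
  exact lt_of_le_of_ne (lineDist_nonneg _ s t)
    fun h => hst (StickBreaking.eq_of_lineDist_eq_zero _ s t h.symm)

theorem rawDist_proj_proj_le (hY : StrictMono Y) (hY' : Tendsto Y atTop atTop) {z : ℕ → ℝ≥0}
    (hz : ∀ k, z k ≤ Y k) {m k : ℕ} (hk : m ≤ k) {s t : ℝ≥0} (hs : s ≤ Y k) (ht : t ≤ Y k) :
    rawDist Y z m (proj Y z m k s) (proj Y z m k t) ≤ rawDist Y z k s t := by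
  have h1 := rawDist_eq_lineDist (mkStick hY hY' hz) hs ht
  have h2 := rawDist_eq_lineDist (mkStick hY hY' hz) (proj_le (mkStick hY hY' hz) hk hs)
    (proj_le (mkStick hY hY' hz) hk ht)
  exact h2.trans_le ((lineDist_proj_proj_le (mkStick hY hY' hz) hk hs ht).trans h1.symm.le)

variable [∀ k, IsProbabilityMeasure (p k)]

/-- Two independent random points are unlikely to be close. Projections do not increase distances,
so it is enough to bound the probability that the projections at level `m` are close. Up to the tail
`∑ j ≥ m, a j ^ 2`, it is the probability of the same event for two independent points of law `p m`,
and for `δ → 0` this tends to the probability that they coincide. -/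
theorem IsUrn.ae_pair_far (hU : IsUrn Y p ν a) (hY : StrictMono Y) (hY' : Tendsto Y atTop atTop)
    (hatom : Tendsto (fun m => ⨆ x, p m {x}) atTop (𝓝 0)) (hsq : ∑' k, (a k : ℝ≥0∞) ^ 2 ≠ ∞) :
    ∀ᵐ z ∂Measure.infinitePi p, ∀ ε : ℝ≥0∞, 0 < ε → ∃ δ : ℝ≥0, 0 < δ ∧ ∃ᶠ k in atTop,
      ((p k).prod (p k)) {w | rawDist Y z k w.1 w.2 < δ} ≤ ε := by
  set Q := Measure.infinitePi p
  let δ : ℕ → ℝ≥0 := fun j => 1 / (j + 1)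
  have hδpos : ∀ j, 0 < δ j := fun j => by positivity
  let A : ℕ → ℕ → Set ((ℕ → ℝ≥0) × (ℝ≥0 × ℝ≥0)) := fun m j =>
    {w | rawDist Y w.1 m w.2.1 w.2.2 < δ j}
  have hA : ∀ m j, MeasurableSet (A m j) := fun m j =>
    measurableSet_lt (measurable_rawDist_right Y m) measurable_const
  let κ : ℕ → ℕ → (ℕ → ℝ≥0) → ℝ≥0 → ℝ≥0 → ℝ≥0∞ := fun m j z x y =>
    (A m j).indicator 1 (z, (x, y))
  have hκ : ∀ m j, Measurable fun w : (ℕ → ℝ≥0) × (ℝ≥0 × ℝ≥0) => κ m j w.1 w.2.1 w.2.2 :=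
    fun m j => measurable_one.indicator (hA m j)
  have hκ1 : ∀ m j z x y, κ m j z x y ≤ 1 := fun m j z x y =>
    indicator_le' (fun _ _ => le_rfl) (fun _ _ => zero_le) _
  have hκdep : ∀ m j z x y, κ m j (trunc m z) x y = κ m j z x y := fun m j z x y => by
    simp only [κ, A, indicator, mem_ofPred_eq, rawDist_congr (fun i hi => trunc_apply_of_lt hi z),
      Pi.one_apply]
  let N : ℕ → ℕ → ℕ → (ℕ → ℝ≥0) → ℝ≥0∞ := fun m j k z =>
    ∫⁻ x, ∫⁻ y, κ m j z (proj Y z m k x) (proj Y z m k y) ∂p k ∂p k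
  have hN : ∀ m j k, Measurable (N m j k) := fun m j k => by
    have h1 : Measurable fun w : ((ℕ → ℝ≥0) × ℝ≥0) × ℝ≥0 =>
        κ m j w.1.1 (proj Y w.1.1 m k w.1.2) (proj Y w.1.1 m k w.2) := by
      refine (hκ m j).comp (f := fun w : ((ℕ → ℝ≥0) × ℝ≥0) × ℝ≥0 =>
        (w.1.1, (proj Y w.1.1 m k w.1.2, proj Y w.1.1 m k w.2)))
        (Measurable.prodMk (by fun_prop) (Measurable.prodMk ?_ ?_))
      · exact (measurable_proj_right Y m k).comp measurable_fst
      · exact (measurable_proj_right Y m k).comp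
          (f := fun w : ((ℕ → ℝ≥0) × ℝ≥0) × ℝ≥0 => (w.1.1, w.2)) (by fun_prop)
    exact Measurable.lintegral_prod_right'
      (f := fun w : (ℕ → ℝ≥0) × ℝ≥0 => ∫⁻ y, κ m j w.1 (proj Y w.1 m k w.2) (proj Y w.1 m k y) ∂p k)
      (Measurable.lintegral_prod_right' h1)
  have hlim : ∀ m, ∫⁻ z, ⨅ j, ⨅ m, liminf (fun k => N m j k z) atTop ∂Q ≤
      (⨆ x, p m {x}) + ∑' j, (a (j + m) : ℝ≥0∞) ^ 2 := by
    intro m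
    have hle : ∀ j, ∫⁻ z, ⨅ j, ⨅ m, liminf (fun k => N m j k z) atTop ∂Q ≤
        (Q.prod ((p m).prod (p m))) (A m j) + ∑' j, (a (j + m) : ℝ≥0∞) ^ 2 := fun j => by
      refine (lintegral_mono fun z => (iInf_le _ j).trans (iInf_le _ m)).trans ?_
      refine (lintegral_liminf_le fun k => hN m j k).trans ?_
      refine liminf_le_of_frequently_le' (Eventually.frequently ?_)
      filter_upwards [eventually_ge_atTop m] with k hk
      refine (hU.lintegral_pair_le m (hκ m j) (hκdep m j) (hκ1 m j) hk).trans ?_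
      gcongr
      rw [← lintegral_indicator_one (hA m j), lintegral_prod _
        (measurable_one.indicator (hA m j)).aemeasurable]
      refine (lintegral_congr fun z => ?_).le
      rw [lintegral_prod _ (by
        exact ((hκ m j).comp measurable_prodMk_left).aemeasurable)]
    have hanti : Antitone fun j => A m j := fun i j hij w hw => by
      refine lt_of_lt_of_le (show rawDist Y w.1 m w.2.1 w.2.2 < δ j from hw) ?_
      exact NNReal.coe_le_coe.2 (one_div_le_one_div_of_le (by positivity) (by gcongr))
    have ht := (tendsto_measure_iInter_atTop (μ := Q.prod ((p m).prod (p m)))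
      (fun j => (hA m j).nullMeasurableSet) hanti ⟨0, measure_ne_top _ _⟩).add_const
      (∑' j, (a (j + m) : ℝ≥0∞) ^ 2)
    refine (ge_of_tendsto' ht hle).trans ?_
    gcongr
    calc (Q.prod ((p m).prod (p m))) (⋂ j, A m j)
        ≤ (Q.prod ((p m).prod (p m))) (univ ×ˢ diagonal ℝ≥0) := by
          refine measure_mono_ae ?_
          have h0 : ∀ᵐ w ∂Q.prod ((p m).prod (p m)), ∀ k, w.1 k ≤ Y k :=
            Measure.quasiMeasurePreserving_fst.ae hU.ae_le
          have h1 : ∀ᵐ w ∂Q.prod ((p m).prod (p m)), w.2.1 ≤ Y m :=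
            Measure.quasiMeasurePreserving_snd.ae
              (Measure.quasiMeasurePreserving_fst.ae (hU.p_le m))
          have h2 : ∀ᵐ w ∂Q.prod ((p m).prod (p m)), w.2.2 ≤ Y m :=
            Measure.quasiMeasurePreserving_snd.ae
              (Measure.quasiMeasurePreserving_snd.ae (hU.p_le m))
          filter_upwards [h0, h1, h2] with w hz hs ht hwA
          refine ⟨mem_univ _, by_contra fun hne => ?_⟩
          have hpos := rawDist_pos hY hY' hz hs ht hne
          obtain ⟨j, hj⟩ := exists_nat_one_div_lt hpos
          have hwj : rawDist Y w.1 m w.2.1 w.2.2 < δ j := mem_iInter.1 hwA j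
          simp only [δ] at hwj
          push_cast at hwj
          linarith
      _ = ∫⁻ x, p m {x} ∂p m := by
          rw [Measure.prod_prod, measure_univ, one_mul,
            Measure.prod_apply measurableSet_diagonal]
          refine lintegral_congr fun x => ?_
          congr 1
          ext y
          simp [eq_comm]
      _ ≤ ∫⁻ _, ⨆ x, p m {x} ∂p m := lintegral_mono fun x => le_iSup (fun x => p m {x}) x
      _ = ⨆ x, p m {x} := by simp
  have hzero : ∫⁻ z, ⨅ j, ⨅ m, liminf (fun k => N m j k z) atTop ∂Q = 0 := by
    have h := hatom.add (ENNReal.tendsto_sum_nat_add (fun k => (a k : ℝ≥0∞) ^ 2) hsq)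
    rw [add_zero] at h
    exact le_antisymm (ge_of_tendsto' h hlim) bot_le
  rw [lintegral_eq_zero_iff (Measurable.iInf fun j => Measurable.iInf fun m =>
    Measurable.liminf fun k => hN m j k)] at hzero
  filter_upwards [hzero, hU.ae_le] with z hz hzY ε hε
  have hlt : ⨅ j, ⨅ m, liminf (fun k => N m j k z) atTop < ε := by rw [hz]; exact hε
  obtain ⟨j, hj⟩ := iInf_lt_iff.1 hlt
  obtain ⟨m, hm⟩ := iInf_lt_iff.1 hj
  refine ⟨δ j, hδpos j, ?_⟩
  have hfr := frequently_lt_of_liminf_lt (by isBoundedDefault) hm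
  refine (hfr.and_eventually (eventually_ge_atTop m)).mono fun k hk => le_trans ?_ hk.1.le
  have hmk : m ≤ k := hk.2
  have hset : MeasurableSet {w : ℝ≥0 × ℝ≥0 | rawDist Y z k w.1 w.2 < δ j} :=
    measurableSet_lt ((measurable_rawDist_right Y k).comp measurable_prodMk_left) measurable_const
  rw [Measure.prod_apply hset]
  refine lintegral_mono_ae ?_
  filter_upwards [hU.p_le k] with x hx
  rw [← lintegral_indicator_one (measurable_prodMk_left hset)]
  refine lintegral_mono_ae ?_
  filter_upwards [hU.p_le k] with y hy
  by_cases hxy : rawDist Y z k x y < δ j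
  · have hmem : (z, (proj Y z m k x, proj Y z m k y)) ∈ A m j :=
      (rawDist_proj_proj_le hY hY' hzY hmk hx hy).trans_lt hxy
    simp only [κ, indicator_of_mem hmem]
    exact indicator_le' (fun _ _ => le_rfl) (fun _ _ => zero_le) _
  · simp [indicator, hxy]

end Atoms

/-! ### Almost sure positivity of masses, for fixed masses and cuts -/

section Support

variable {Y : ℕ → ℝ≥0} {p ν : ℕ → Measure ℝ≥0} {a : ℕ → ℝ≥0} [∀ k, IsProbabilityMeasure (p k)]

/-- The mass of the points projecting into `I`, as a transported functional. -/
theorem isSprouting_indicator (Y : ℕ → ℝ≥0) (m : ℕ) {I : Set ℝ≥0} (hI : MeasurableSet I) :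
    IsSprouting Y m 0 0 (fun k z x => I.indicator 1 (proj Y z m k x)) :=
  isSprouting_proj Y m (φ := fun _ x => I.indicator 1 x)
    ((measurable_one.indicator hI).comp measurable_snd) (fun _ _ => rfl)

/-- The expected mass of the points projecting into `I` does not depend on the level. -/
theorem IsUrn.lintegral_mass (hU : IsUrn Y p ν a) {I : Set ℝ≥0} (hI : MeasurableSet I) {m k : ℕ}
    (hk : m ≤ k) :
    ∫⁻ z, avg p (fun k z x => I.indicator 1 (proj Y z m k x)) k z ∂Measure.infinitePi p =
      p m I := by
  induction k, hk using Nat.le_induction with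
  | base => simp [avg, proj_of_le, lintegral_indicator_one hI]
  | succ k hk ih =>
    have := (isSprouting_indicator Y m hI).lintegral_avg_succ hU hk (g := fun _ => 1)
      measurable_const (fun _ => rfl)
    simp only [one_mul] at this
    rw [this, ih]
    simp

/-- The mass of the points projecting into `I` is a martingale with mean `p m I`; its conditional
variance increases at the `k`-th step by at most `a k ^ 2` times the probability that the `k`-th
glue point projects into `I`, whose mean is also `p m I`. -/
theorem IsUrn.lintegral_mass_sq_le (hU : IsUrn Y p ν a) {I : Set ℝ≥0} (hI : MeasurableSet I)
    {m k : ℕ} (hk : m ≤ k) :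
    ∫⁻ z, avg p (fun k z x => I.indicator 1 (proj Y z m k x)) k z ^ 2 ∂Measure.infinitePi p ≤
      p m I ^ 2 + (∑ j ∈ Finset.Ico m k, (a j : ℝ≥0∞) ^ 2) * p m I := by
  set Q := Measure.infinitePi p
  induction k, hk using Nat.le_induction with
  | base => simp [avg, proj_of_le, lintegral_indicator_one hI]
  | succ k hk ih =>
    set Φ : ℕ → (ℕ → ℝ≥0) → ℝ≥0 → ℝ≥0∞ := fun k z x => I.indicator 1 (proj Y z m k x) with hΦdef
    have hΦ : IsSprouting Y m 0 0 Φ := isSprouting_indicator Y m hI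
    have hsq : ∀ z x, Φ k z x * Φ k z x = Φ k z x := fun z x => by
      by_cases h : proj Y z m k x ∈ I <;> simp [Φ, h]
    have m1 : Measurable (avg p Φ k) := hΦ.measurable_avg k
    have m2 : Measurable fun z : ℕ → ℝ≥0 => Φ k z (z k) :=
      (hΦ.meas_Φ k).comp (measurable_id.prodMk (measurable_pi_apply k))
    have m12 : Measurable fun z : ℕ → ℝ≥0 => avg p Φ k z * Φ k z (z k) := m1.mul m2
    have e1 : ∫⁻ z, Φ k z (z k) ∂Q = p m I := by
      rw [lintegral_eval_eq p k (hΦ.meas_Φ k) (hΦ.dep_Φ k hk)]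
      exact hU.lintegral_mass hI hk
    have e2 : ∫⁻ z, avg p Φ k z * Φ k z (z k) ∂Q = ∫⁻ z, avg p Φ k z ^ 2 ∂Q := by
      rw [lintegral_eval_eq p k (G := fun z x => avg p Φ k z * Φ k z x)
        ((m1.comp measurable_fst).mul (hΦ.meas_Φ k))
        (fun z x => by rw [hΦ.avg_trunc hk, hΦ.dep_Φ k hk])]
      refine lintegral_congr fun z => ?_
      rw [lintegral_const_mul _ (hΦ.meas_Φ k).of_uncurry_left, sq]
      rfl
    have hs := hU.one_sub_add k
    set s : ℝ≥0∞ := ((1 - a k : ℝ≥0) : ℝ≥0∞)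
    have hstep : ∀ z, avg p Φ (k + 1) z ^ 2 = s ^ 2 * avg p Φ k z ^ 2 +
        (2 * s * a k * (avg p Φ k z * Φ k z (z k)) + (a k : ℝ≥0∞) ^ 2 * Φ k z (z k)) := fun z => by
      rw [hΦ.avg_succ hU hk]
      simp only [Pi.zero_apply, zero_mul, add_zero]
      calc _ = s ^ 2 * avg p Φ k z ^ 2 + (2 * s * a k * (avg p Φ k z * Φ k z (z k)) +
          (a k : ℝ≥0∞) ^ 2 * (Φ k z (z k) * Φ k z (z k))) := by ring
        _ = _ := by rw [hsq]
    simp only [hstep]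
    rw [lintegral_add_left ((m1.pow_const 2).const_mul _),
      lintegral_add_left (m12.const_mul _), lintegral_const_mul _ (m1.pow_const 2),
      lintegral_const_mul _ m12, lintegral_const_mul _ m2, e1, e2,
      Finset.sum_Ico_succ_top hk, add_mul, ← add_assoc, ← add_assoc, ← add_mul]
    gcongr
    calc (s ^ 2 + 2 * s * a k) * ∫⁻ z, avg p Φ k z ^ 2 ∂Q
        ≤ (s + a k) ^ 2 * ∫⁻ z, avg p Φ k z ^ 2 ∂Q := by
          gcongr
          rw [add_sq]
          exact le_self_add
      _ ≤ _ := by rw [hs, one_pow, one_mul]; exact ih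

/-- A form of the expansion of `(ρ - x) ^ 2` which avoids subtracting and is valid for the truncated
subtraction. -/
theorem ennreal_sub_sq_add_le {ρ x : ℝ≥0∞} (hρ : ρ ≠ ∞) (hx : x ≠ ∞) :
    (ρ - x) ^ 2 + 2 * ρ * x ≤ ρ ^ 2 + x ^ 2 := by
  lift ρ to ℝ≥0 using hρ
  lift x to ℝ≥0 using hx
  norm_cast
  rcases le_total x ρ with h | h
  · obtain ⟨d, rfl⟩ := exists_add_of_le h
    rw [add_tsub_cancel_left]
    exact le_of_eq (by ring)
  · rw [tsub_eq_zero_of_le h, ← NNReal.coe_le_coe]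
    push_cast
    nlinarith [sq_nonneg ((ρ : ℝ) - x)]

/-- A one-sided variance bound for the mass of the points projecting into `I`. -/
theorem IsUrn.lintegral_sub_mass_sq_le (hU : IsUrn Y p ν a) {I : Set ℝ≥0} (hI : MeasurableSet I)
    {m k : ℕ} (hk : m ≤ k) :
    ∫⁻ z, (p m I - avg p (fun k z x => I.indicator 1 (proj Y z m k x)) k z) ^ 2
      ∂Measure.infinitePi p ≤ (∑' j, (a (j + m) : ℝ≥0∞) ^ 2) * p m I := by
  set Q := Measure.infinitePi p
  set N := avg p (fun k z x => I.indicator 1 (proj Y z m k x)) k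
  set ρ := p m I
  have hρ : ρ ≠ ∞ := measure_ne_top _ _
  have hN : ∀ z, N z ≤ 1 := fun z => by
    simp only [N, avg, lintegral_indicator_proj _ _ _ hI]
    exact prob_le_one
  have hNm : Measurable N := (isSprouting_indicator Y m hI).measurable_avg k
  have h1 : ∫⁻ z, ((ρ - N z) ^ 2 + 2 * ρ * N z) ∂Q ≤ ∫⁻ z, (ρ ^ 2 + N z ^ 2) ∂Q :=
    lintegral_mono fun z => ennreal_sub_sq_add_le hρ ((hN z).trans_lt (by simp)).ne
  rw [lintegral_add_right _ (hNm.const_mul _), lintegral_const_mul _ hNm,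
    lintegral_add_left measurable_const, lintegral_const, measure_univ, mul_one,
    hU.lintegral_mass hI hk] at h1
  have h2 := h1.trans (add_le_add_right (hU.lintegral_mass_sq_le hI hk) _)
  have h3 : ρ ^ 2 + (ρ ^ 2 + (∑ j ∈ Finset.Ico m k, (a j : ℝ≥0∞) ^ 2) * ρ) =
      (∑ j ∈ Finset.Ico m k, (a j : ℝ≥0∞) ^ 2) * ρ + 2 * ρ * ρ := by ring
  have h4 : 2 * ρ * ρ ≠ ∞ := by finiteness
  refine ((ENNReal.add_le_add_iff_right h4).1 (h2.trans_eq h3)).trans ?_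
  gcongr
  rw [Finset.sum_Ico_eq_sum_range]
  simp only [add_comm m]
  exact ENNReal.sum_le_tsum _

/-- The limit law charges every small ball around a point of the skeleton. The mass `N` projecting
into `I` stays comparable to its initial value `ρ`, by a second moment estimate, and most of this
mass stays close to `I`, because the mean height is small. -/
theorem IsUrn.ae_mass_pos (hU : IsUrn Y p ν a) {I : Set ℝ≥0} (hI : MeasurableSet I)
    (hsum : ∑' k, a k * ∫⁻ x, ((x - Y k : ℝ≥0) : ℝ≥0∞) ∂ν k ≠ ∞)
    (hpos : ∀ᶠ m in atTop, p m I ≠ 0)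
    (hsq : Tendsto (fun m => (∑' j, (a (j + m) : ℝ≥0∞) ^ 2) / p m I) atTop (𝓝 0))
    {r : ℝ≥0} (hr : 0 < r) :
    ∀ᵐ z ∂Measure.infinitePi p, ∃ (m : ℕ) (c : ℝ≥0∞), 0 < c ∧ ∀ᶠ k in atTop,
      c ≤ p k {x | proj Y z m k x ∈ I ∧ height Y z m k x ≤ r} := by
  set Q := Measure.infinitePi p
  obtain ⟨m₀, hm₀⟩ := eventually_atTop.1 hpos
  set b : ℕ → ℝ≥0∞ := fun k => a k * ∫⁻ x, ((x - Y k : ℝ≥0) : ℝ≥0∞) ∂ν k with hb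
  have htail : ∀ m, ∑' j, b (j + m) ≠ ∞ := fun m =>
    (ENNReal.tsum_comp_le_tsum_of_injective (add_left_injective m) b).trans_lt hsum.lt_top |>.ne
  let N : ℕ → ℕ → (ℕ → ℝ≥0) → ℝ≥0∞ := fun m k z =>
    avg p (fun k z x => I.indicator 1 (proj Y z m k x)) k z
  let W : ℕ → ℕ → (ℕ → ℝ≥0) → ℝ≥0∞ := fun m k z =>
    avg p (fun k z x => I.indicator 1 (proj Y z m k x) * height Y z m k x) k z
  have hΦ : ∀ m, IsSprouting Y m 0 0 _ := fun m => isSprouting_indicator Y m hI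
  have hΨ : ∀ m, IsSprouting Y m _ _ _ := fun m => isSprouting_height Y m hI
  have hNm : ∀ m k, Measurable (N m k) := fun m k => (hΦ m).measurable_avg k
  have hWm : ∀ m k, Measurable (W m k) := fun m k => (hΨ m).measurable_avg k
  have hW0 : ∀ m, ∫⁻ z, W m m z ∂Q = 0 := fun m => by
    simp [W, avg, height_of_le le_rfl]
  -- if `T < 1`, then `N > ρ / 2`, and the part `W / r` of that mass which may lie at height more
  -- than `r` is less than `ρ / 4`
  let T : ℕ → ℕ → (ℕ → ℝ≥0) → ℝ≥0∞ := fun m k z =>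
    4 * (p m I)⁻¹ ^ 2 * (p m I - N m k z) ^ 2 + 4 * (p m I)⁻¹ * (r : ℝ≥0∞)⁻¹ * W m k z
  have hTm : ∀ m k, Measurable (T m k) := fun m k => by
    have h1 := hNm m k
    have h2 := hWm m k
    fun_prop
  have hr0 : (r : ℝ≥0∞)⁻¹ ≠ ∞ := by simpa using hr.ne'
  have hTconv : ∀ᵐ z ∂Q, ∀ m, m₀ ≤ m → ∃ L, Tendsto (fun k => T m k z) atTop (𝓝 L) := by
    refine ae_all_iff.2 fun m => ?_
    have h1 := (hΦ m).ae_tendsto_avg (p := p) hU (by simp) (by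
      rw [hU.lintegral_mass hI le_rfl]; exact measure_ne_top _ _)
    have h2 := (hΨ m).ae_tendsto_avg (p := p) hU (htail m) (by
      change ∫⁻ z, W m m z ∂Q ≠ ∞
      rw [hW0]; simp)
    filter_upwards [h1, h2] with z ⟨L, hL, hN⟩ ⟨L', hL', hW⟩ hm
    have hρ : (p m I)⁻¹ ≠ ∞ := ENNReal.inv_ne_top.2 (hm₀ m hm)
    refine ⟨4 * (p m I)⁻¹ ^ 2 * (p m I - L) ^ 2 + 4 * (p m I)⁻¹ * (r : ℝ≥0∞)⁻¹ * L', ?_⟩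
    refine Tendsto.add (ENNReal.Tendsto.const_mul (ENNReal.Tendsto.pow
      (ENNReal.Tendsto.sub tendsto_const_nhds hN (Or.inl (measure_ne_top _ _)))) (Or.inr ?_))
      (ENNReal.Tendsto.const_mul hW (Or.inr ?_))
    · finiteness
    · finiteness
  let e : ℕ → ℝ≥0∞ := fun m => 4 * ((∑' j, (a (j + m) : ℝ≥0∞) ^ 2) / p m I) +
    4 * (r : ℝ≥0∞)⁻¹ * ∑' j, b (j + m)
  have hele : ∀ m, m₀ ≤ m → ∫⁻ z, liminf (fun k => T m k z) atTop ∂Q ≤ e m := by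
    intro m hm
    have hρ0 := hm₀ m hm
    have hρ : (p m I)⁻¹ * p m I = 1 := ENNReal.inv_mul_cancel hρ0 (measure_ne_top _ _)
    refine (lintegral_liminf_le fun k => hTm m k).trans ?_
    refine liminf_le_of_frequently_le' (Eventually.frequently ?_)
    filter_upwards [eventually_ge_atTop m] with k hk
    have h1 : ∫⁻ z, W m k z ∂Q ≤ (∑' j, b (j + m)) * p m I := by
      have := (hΨ m).lintegral_avg_le_tsum (p := p) hU (B := p m I)
        (fun k hk => (hU.lintegral_mass hI hk).le) hk
      change ∫⁻ z, W m k z ∂Q ≤ ∫⁻ z, W m m z ∂Q + _ at this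
      rwa [hW0, zero_add] at this
    have h2 := hU.lintegral_sub_mass_sq_le hI hk
    have m1 : Measurable fun z => (p m I - N m k z) ^ 2 := by
      have := hNm m k
      fun_prop
    simp only [T]
    rw [lintegral_add_left (m1.const_mul _), lintegral_const_mul _ m1,
      lintegral_const_mul _ (hWm m k)]
    refine (add_le_add (mul_le_mul_right h2 _) (mul_le_mul_right h1 _)).trans_eq ?_
    calc _ = 4 * ((∑' j, (a (j + m) : ℝ≥0∞) ^ 2) * (p m I)⁻¹) * ((p m I)⁻¹ * p m I) +
          4 * (r : ℝ≥0∞)⁻¹ * (∑' j, b (j + m)) * ((p m I)⁻¹ * p m I) := by ring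
      _ = _ := by rw [hρ, mul_one, mul_one, ← div_eq_mul_inv]
  have he : Tendsto e atTop (𝓝 0) := by
    have h1 := ENNReal.Tendsto.const_mul (a := 4) hsq (Or.inr (by simp))
    have h2 := ENNReal.Tendsto.const_mul (a := 4 * (r : ℝ≥0∞)⁻¹)
      (ENNReal.tendsto_sum_nat_add b hsum) (Or.inr (by finiteness))
    simpa using h1.add h2
  have hzero : ∫⁻ z, ⨅ i, liminf (fun k => T (i + m₀) k z) atTop ∂Q = 0 := by
    refine le_antisymm (ge_of_tendsto' (he.comp (tendsto_add_atTop_nat m₀)) fun i => ?_) bot_le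
    exact (lintegral_mono fun z => iInf_le _ i).trans (hele _ (Nat.le_add_left _ _))
  rw [lintegral_eq_zero_iff (Measurable.iInf fun i => Measurable.liminf fun k => hTm _ k)] at hzero
  filter_upwards [hzero, hTconv] with z hz hconv
  have hlt : ⨅ i, liminf (fun k => T (i + m₀) k z) atTop < 1 := by rw [hz]; exact one_pos
  obtain ⟨i, hi⟩ := iInf_lt_iff.1 hlt
  set m := i + m₀
  obtain ⟨L, hL⟩ := hconv m (Nat.le_add_left _ _)
  rw [hL.liminf_eq] at hi
  have hρ0 := hm₀ m (Nat.le_add_left _ _)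
  set ρ := p m I with hρdef
  have hρtop : ρ ≠ ∞ := measure_ne_top _ _
  refine ⟨m, ρ / 4, ENNReal.div_pos hρ0 (by simp), ?_⟩
  filter_upwards [hL.eventually (gt_mem_nhds hi)] with k hk
  set E := {x | proj Y z m k x ∈ I ∧ height Y z m k x ≤ r}
  have hheight : MeasurableSet {x | height Y z m k x ≤ r} :=
    measurableSet_le (measurable_height' Y z m k) measurable_const
  have hE : MeasurableSet E := (measurable_proj' Y z m k hI).inter hheight
  have hmass : N m k z ≤ p k E + (r : ℝ≥0∞)⁻¹ * W m k z := by
    have hWz : Measurable fun x => I.indicator (1 : ℝ≥0 → ℝ≥0∞) (proj Y z m k x) *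
        height Y z m k x := ((hΨ m).meas_Φ k).of_uncurry_left
    simp only [N, W, avg]
    rw [← lintegral_indicator_one hE, ← lintegral_const_mul _ hWz,
      ← lintegral_add_left (measurable_one.indicator hE)]
    refine lintegral_mono fun x => ?_
    by_cases hx : proj Y z m k x ∈ I
    · by_cases hh : height Y z m k x ≤ r
      · have hxE : x ∈ E := ⟨hx, hh⟩
        simp [hx, hxE]
      · simp only [hx, indicator_of_mem, Pi.one_apply, one_mul]
        refine le_add_left ?_
        rw [← ENNReal.div_eq_inv_mul, ENNReal.le_div_iff_mul_le (by simp [hr.ne']) (by simp),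
          one_mul]
        exact_mod_cast (not_le.1 hh).le
    · simp [hx]
  have hρρ : ρ⁻¹ * ρ = 1 := ENNReal.inv_mul_cancel hρ0 hρtop
  have h4 : (4 : ℝ≥0∞) * 4⁻¹ = 1 := ENNReal.mul_inv_cancel (by simp) (by simp)
  have h42 : (4 : ℝ≥0∞)⁻¹ + 4⁻¹ = 2⁻¹ := by
    rw [← two_mul, show (4 : ℝ≥0∞) = 2 * 2 by norm_num, ENNReal.mul_inv (by simp) (by simp),
      ← mul_assoc, ENNReal.mul_inv_cancel (by simp) (by simp), one_mul]
  have hhalf : ρ / 4 + ρ / 4 = ρ / 2 := by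
    rw [div_eq_mul_inv, ← mul_add, h42, div_eq_mul_inv]
  have hA : ρ / 2 < N m k z := by
    by_contra! hle
    have h1 : ρ / 2 ≤ ρ - N m k z := by
      refine ENNReal.le_sub_of_add_le_left (hle.trans_lt (ENNReal.div_lt_top hρtop (by simp))).ne ?_
      calc N m k z + ρ / 2 ≤ ρ / 2 + ρ / 2 := by gcongr
        _ = ρ := ENNReal.add_halves ρ
    refine absurd hk (not_lt.2 ?_)
    calc (1 : ℝ≥0∞) = 4 * ρ⁻¹ ^ 2 * (ρ / 2) ^ 2 := by
          rw [div_eq_mul_inv]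
          calc (1 : ℝ≥0∞) = 4 * (2⁻¹ * 2⁻¹) * (ρ⁻¹ * ρ) * (ρ⁻¹ * ρ) := by
                rw [hρρ, mul_one, mul_one, ← ENNReal.mul_inv (by simp) (by simp)]
                norm_num [h4]
            _ = _ := by ring
      _ ≤ 4 * ρ⁻¹ ^ 2 * (ρ - N m k z) ^ 2 := by gcongr
      _ ≤ T m k z := le_self_add
  have hB : (r : ℝ≥0∞)⁻¹ * W m k z < ρ / 4 := by
    by_contra! hle
    refine absurd hk (not_lt.2 ?_)
    calc (1 : ℝ≥0∞) = 4 * ρ⁻¹ * (ρ / 4) := by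
          rw [div_eq_mul_inv]
          calc (1 : ℝ≥0∞) = (4 * 4⁻¹) * (ρ⁻¹ * ρ) := by rw [hρρ, h4, mul_one]
            _ = _ := by ring
      _ ≤ 4 * ρ⁻¹ * ((r : ℝ≥0∞)⁻¹ * W m k z) := by gcongr
      _ = 4 * ρ⁻¹ * (r : ℝ≥0∞)⁻¹ * W m k z := by ring
      _ ≤ T m k z := le_add_self
  by_contra! hlt
  refine absurd (hA.trans_le hmass) (not_lt.2 ?_)
  calc p k E + (r : ℝ≥0∞)⁻¹ * W m k z ≤ ρ / 4 + ρ / 4 := by gcongr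
    _ = ρ / 2 := hhalf

end Support

/-! ### Convergence of the normalized masses, for fixed masses and cuts -/

/-- The properties of glue points `z` which make the laws `p k`, carried by the first `k + 1`
sticks, converge to a diffuse law with full support on the leaves of the tree. They are expressed
through countably many conditions on measurable functionals. -/
structure IsGoodGluing (p : ℕ → Measure ℝ≥0) (Y z : ℕ → ℝ≥0) : Prop where
  le : ∀ k, z k ≤ Y k
  tendsto_cell : ∀ m n i l, ∃ L, Tendsto (fun k => (p k).real {x | proj Y z m k x ∈ cell Y n i l})
    atTop (𝓝 L)
  height_le : ∀ j : ℕ, ∃ m, ∀ᶠ k in atTop, ∫⁻ x, height Y z m k x ∂p k ≤ (j : ℝ≥0∞)⁻¹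
  le_mass : ∀ (q q' : ℚ≥0) (j : ℕ), q < q' → ∃ m i : ℕ, ∀ᶠ k in atTop, (i : ℝ≥0∞)⁻¹ ≤
    p k {x | proj Y z m k x ∈ Ioc (q : ℝ≥0) q' ∧ height Y z m k x ≤ 1 / ((j : ℝ≥0) + 1)}
  near_le : ∀ n j : ℕ, ∃ i : ℕ, ∃ᶠ k in atTop,
    p k {x | height Y z n k x < 1 / ((i : ℝ≥0) + 1)} ≤ (j : ℝ≥0∞)⁻¹
  pair_le : ∀ j : ℕ, ∃ i : ℕ, ∃ᶠ k in atTop,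
    ((p k).prod (p k)) {w | rawDist Y z k w.1 w.2 < (1 / ((i : ℝ≥0) + 1) : ℝ≥0)} ≤ (j : ℝ≥0∞)⁻¹

/-- The properties of the mass measure used in the construction: locally finite, charging every
interval, and of infinite total mass. -/
structure IsGoodMass (μ : Measure ℝ≥0) : Prop where
  ne_top : ∀ l, μ (Icc 0 l) ≠ ∞
  ne_zero : ∀ q q' : ℚ≥0, q < q' → μ (Ioc (q : ℝ≥0) q') ≠ 0
  tendsto : Tendsto (fun l => μ (Icc 0 l)) atTop (𝓝 ∞)

/-- The proportion of the mass of `[0, Y (k + 1)]` which is carried by the last stick. -/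
noncomputable def weight (μ : Measure ℝ≥0) (Y : ℕ → ℝ≥0) (k : ℕ) : ℝ≥0 :=
  (μ (Ioc (Y k) (Y (k + 1))) / μ (Icc 0 (Y (k + 1)))).toNNReal

/-- The properties of the cuts used in the construction. -/
structure IsGoodCut (μ : Measure ℝ≥0) (Y : ℕ → ℝ≥0) : Prop where
  strictMono : StrictMono Y
  tendsto : Tendsto Y atTop atTop
  pos : 0 < Y 0
  sum_length : ∑' k, (weight μ Y k : ℝ≥0∞) * ((Y (k + 1) - Y k : ℝ≥0) : ℝ≥0∞) ≠ ∞
  sum_sq : ∑' k, μ (Icc 0 (Y k)) * (weight μ Y k : ℝ≥0∞) ^ 2 ≠ ∞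

open Classical in
/-- The normalized mass of the last stick (a Dirac mass if that stick has no mass). -/
noncomputable def stickLaw (μ : Measure ℝ≥0) (Y : ℕ → ℝ≥0) (k : ℕ) : Measure ℝ≥0 :=
  if μ (Ioc (Y k) (Y (k + 1))) = 0 then Measure.dirac (Y (k + 1)) else
    μ[|Ioc (Y k) (Y (k + 1))]

section Mass

variable {μ : Measure ℝ≥0} {Y : ℕ → ℝ≥0}

theorem IsGoodMass.pos (hμ : IsGoodMass μ) {l : ℝ≥0} (hl : 0 < l) : μ (Icc 0 l) ≠ 0 := by
  obtain ⟨n, hn⟩ := exists_nat_one_div_lt hl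
  have h := hμ.ne_zero 0 (1 / ((n : ℚ≥0) + 1)) (by positivity)
  refine fun h0 => h (measure_mono_null ?_ h0)
  rintro x ⟨-, hx⟩
  push_cast at hx
  exact ⟨zero_le, hx.trans hn.le⟩

theorem IsGoodMass.Ioc_ne_top (hμ : IsGoodMass μ) (s t : ℝ≥0) : μ (Ioc s t) ≠ ∞ :=
  measure_ne_top_of_subset (show Ioc s t ⊆ Icc 0 t from fun _ hx => ⟨zero_le, hx.2⟩) (hμ.ne_top t)

theorem IsGoodCut.cut_pos (hY : IsGoodCut μ Y) (k : ℕ) : 0 < Y k :=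
  hY.pos.trans_le (hY.strictMono.monotone k.zero_le)

theorem IsGoodMass.isProbabilityMeasure (hμ : IsGoodMass μ) (hY : IsGoodCut μ Y) (k : ℕ) :
    IsProbabilityMeasure (μ[|Icc 0 (Y k)]) :=
  isProbabilityMeasure_cond_Icc hμ.ne_top (fun _ => hμ.pos) (hY.cut_pos k)

theorem coe_weight (hμ : IsGoodMass μ) {k : ℕ} (hY : 0 < Y (k + 1)) :
    (weight μ Y k : ℝ≥0∞) = μ (Ioc (Y k) (Y (k + 1))) / μ (Icc 0 (Y (k + 1))) := by
  exact ENNReal.coe_toNNReal (ENNReal.div_lt_top (hμ.Ioc_ne_top _ _) (hμ.pos hY)).ne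

theorem measure_Icc_succ (hY : Monotone Y) (k : ℕ) :
    μ (Icc 0 (Y (k + 1))) = μ (Icc 0 (Y k)) + μ (Ioc (Y k) (Y (k + 1))) := by
  rw [← measure_union _ measurableSet_Ioc,
    Icc_union_Ioc_eq_Icc zero_le (hY k.le_succ)]
  exact disjoint_left.2 fun x hx hx' => absurd hx.2 (not_le.2 hx'.1)

theorem one_sub_weight (hμ : IsGoodMass μ) (hY : IsGoodCut μ Y) (k : ℕ) :
    ((1 - weight μ Y k : ℝ≥0) : ℝ≥0∞) = μ (Icc 0 (Y k)) / μ (Icc 0 (Y (k + 1))) := by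
  have h0 := hμ.pos (hY.cut_pos (k + 1))
  have hw : (weight μ Y k : ℝ≥0∞) ≠ ∞ := ENNReal.coe_ne_top
  rw [ENNReal.coe_sub, ENNReal.coe_one]
  refine ENNReal.sub_eq_of_eq_add hw ?_
  rw [coe_weight hμ (hY.cut_pos _), ← ENNReal.add_div, ← measure_Icc_succ hY.strictMono.monotone,
    ENNReal.div_self h0 (hμ.ne_top _)]

theorem weight_le_one (hμ : IsGoodMass μ) (hY : IsGoodCut μ Y) (k : ℕ) : weight μ Y k ≤ 1 := by
  rw [← ENNReal.coe_le_coe, coe_weight hμ (hY.cut_pos _), ENNReal.coe_one]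
  refine ENNReal.div_le_of_le_mul ?_
  rw [one_mul]
  exact measure_mono fun x hx => ⟨zero_le, hx.2⟩

/-- Adding the last stick mixes the normalized mass of the previous ones with the law of the
stick. -/
theorem isUrn_cond (hμ : IsGoodMass μ) (hY : IsGoodCut μ Y) :
    IsUrn Y (fun k => μ[|Icc 0 (Y k)]) (stickLaw μ Y) (weight μ Y) where
  prob_ν k := by
    unfold stickLaw
    split_ifs with h
    · infer_instance
    · exact cond_isProbabilityMeasure_of_finite h (hμ.Ioc_ne_top _ _)
  le_one := weight_le_one hμ hY
  succ k := by
    have h0 := hμ.pos (hY.cut_pos k)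
    have hunion : Icc 0 (Y (k + 1)) = Icc 0 (Y k) ∪ Ioc (Y k) (Y (k + 1)) :=
      (Icc_union_Ioc_eq_Icc zero_le (hY.strictMono.monotone k.le_succ)).symm
    have hdisj : Disjoint (Icc 0 (Y k)) (Ioc (Y k) (Y (k + 1))) :=
      disjoint_left.2 fun x hx hx' => absurd hx.2 (not_le.2 hx'.1)
    have h1 : (weight μ Y k : ℝ≥0∞) • stickLaw μ Y k =
        (μ (Icc 0 (Y (k + 1))))⁻¹ • μ.restrict (Ioc (Y k) (Y (k + 1))) := by
      rw [coe_weight hμ (hY.cut_pos _), stickLaw]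
      split_ifs with h
      · rw [h, ENNReal.zero_div, zero_smul, Measure.restrict_eq_zero.2 h, smul_zero]
      · rw [ProbabilityTheory.cond, smul_smul, div_eq_mul_inv, mul_comm (μ _), mul_assoc,
          ENNReal.mul_inv_cancel h (hμ.Ioc_ne_top _ _), mul_one]
    have h2 : ((1 - weight μ Y k : ℝ≥0) : ℝ≥0∞) • μ[|Icc 0 (Y k)] =
        (μ (Icc 0 (Y (k + 1))))⁻¹ • μ.restrict (Icc 0 (Y k)) := by
      rw [one_sub_weight hμ hY, ProbabilityTheory.cond, smul_smul, div_eq_mul_inv,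
        mul_comm (μ _), mul_assoc, ENNReal.mul_inv_cancel h0 (hμ.ne_top _), mul_one]
    have hs : ∀ (c : ℝ≥0) (ρ : Measure ℝ≥0), c • ρ = (c : ℝ≥0∞) • ρ := fun _ _ => rfl
    rw [hs, hs, h1, h2, ← smul_add, ← Measure.restrict_union hdisj measurableSet_Ioc, ← hunion]
    rfl
  p_le k := by
    filter_upwards [ae_cond_mem (μ := μ) (measurableSet_Icc (a := 0) (b := Y k))] with x hx
      using hx.2
  ν_gt k := by
    have hlt := hY.strictMono k.lt_succ_self
    unfold stickLaw
    split_ifs with h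
    · rw [ae_dirac_eq]; exact hlt
    · filter_upwards [ae_cond_mem (μ := μ) (measurableSet_Ioc (a := Y k) (b := Y (k + 1)))]
        with x hx using hx.1

theorem ae_stickLaw_le (k : ℕ) : ∀ᵐ x ∂stickLaw μ Y k, x ≤ Y (k + 1) := by
  unfold stickLaw
  split_ifs with h
  · rw [ae_dirac_eq]; exact le_refl (Y (k + 1))
  · filter_upwards [ae_cond_mem (μ := μ) (measurableSet_Ioc (a := Y k) (b := Y (k + 1)))]
      with x hx using hx.2

theorem IsGoodCut.sum_sq_weight (hμ : IsGoodMass μ) (hY : IsGoodCut μ Y) :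
    ∑' k, (weight μ Y k : ℝ≥0∞) ^ 2 ≠ ∞ := by
  have h0 := hμ.pos hY.pos
  have h : μ (Icc 0 (Y 0)) * ∑' k, (weight μ Y k : ℝ≥0∞) ^ 2 ≠ ∞ := by
    rw [← ENNReal.tsum_mul_left]
    refine ((ENNReal.tsum_le_tsum fun k => ?_).trans_lt hY.sum_sq.lt_top).ne
    gcongr
    exact hY.strictMono.monotone k.zero_le
  exact fun htop => h (by rw [htop, ENNReal.mul_top h0])

theorem IsGoodCut.tendsto_weight (hμ : IsGoodMass μ) (hY : IsGoodCut μ Y) :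
    Tendsto (weight μ Y) atTop (𝓝 0) := by
  have h := ENNReal.tendsto_atTop_zero_of_tsum_ne_top (hY.sum_sq_weight hμ)
  have h2 : Tendsto (fun k => weight μ Y k ^ 2) atTop (𝓝 0) := by
    rw [← ENNReal.tendsto_coe]; simpa using h
  have h3 := (NNReal.continuous_sqrt.tendsto 0).comp h2
  simpa [Function.comp_def] using h3

theorem IsGoodCut.tendsto_measure_Iic (hμ : IsGoodMass μ) (hY : IsGoodCut μ Y) (n : ℕ) :
    Tendsto (fun m => μ[|Icc 0 (Y m)] (Iic (Y n))) atTop (𝓝 0) := by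
  have h1 : Tendsto (fun m => (μ (Icc 0 (Y m)))⁻¹) atTop (𝓝 0) := by
    rw [← ENNReal.inv_top]
    exact (hμ.tendsto.comp hY.tendsto).inv
  have h2 := ENNReal.Tendsto.mul_const (b := μ (Icc 0 (Y n))) h1 (Or.inr (hμ.ne_top _))
  rw [zero_mul] at h2
  refine tendsto_of_tendsto_of_tendsto_of_le_of_le tendsto_const_nhds h2 (fun _ => bot_le)
    fun m => ?_
  change μ[|Icc 0 (Y m)] (Iic (Y n)) ≤ _
  rw [cond_apply measurableSet_Icc]
  gcongr
  rintro x ⟨-, hx⟩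
  exact ⟨zero_le, hx⟩

/-- For good masses and cuts, independent glue points with laws `μ[|Icc 0 (Y k)]` are almost surely
good. -/
theorem ae_isGoodGluing (hμ : IsGoodMass μ) (hY : IsGoodCut μ Y) :
    ∀ᵐ z ∂Measure.infinitePi (fun k => μ[|Icc 0 (Y k)]),
      IsGoodGluing (fun k => μ[|Icc 0 (Y k)]) Y z := by
  have hprob := hμ.isProbabilityMeasure hY
  have hU := isUrn_cond hμ hY
  have hsum : ∑' k, (weight μ Y k : ℝ≥0∞) *
      ∫⁻ x, ((x - Y k : ℝ≥0) : ℝ≥0∞) ∂stickLaw μ Y k ≠ ∞ := by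
    refine ((ENNReal.tsum_le_tsum fun k => ?_).trans_lt hY.sum_length.lt_top).ne
    gcongr
    have := hU.prob_ν k
    calc _ ≤ ∫⁻ x, ((Y (k + 1) - Y k : ℝ≥0) : ℝ≥0∞) ∂stickLaw μ Y k := by
          refine lintegral_mono_ae ?_
          filter_upwards [ae_stickLaw_le k] with x hx
          gcongr
      _ = _ := by simp
  have hvanish := hY.tendsto_measure_Iic hμ
  have hcell : ∀ᵐ z ∂Measure.infinitePi (fun k => μ[|Icc 0 (Y k)]), ∀ m n i l, ∃ L, Tendsto
      (fun k => (μ[|Icc 0 (Y k)]).real {x | proj Y z m k x ∈ cell Y n i l}) atTop (𝓝 L) := by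
    simp only [ae_all_iff]
    intro m n i l
    filter_upwards [hU.ae_tendsto_proj m (measurableSet_cell Y n i l)] with z ⟨L, hL, h⟩
    exact ⟨L.toReal, (ENNReal.tendsto_toReal hL).comp h⟩
  have hleaf := ae_all_iff.2 fun n => hU.ae_mass_near_subtree n (hvanish n)
  have hatom := hU.ae_pair_far hY.strictMono hY.tendsto
    (hU.tendsto_iSup_singleton hvanish (hY.tendsto_weight hμ)) (hY.sum_sq_weight hμ)
  have hmass : ∀ᵐ z ∂Measure.infinitePi (fun k => μ[|Icc 0 (Y k)]), ∀ (q q' : ℚ≥0) (j : ℕ),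
      q < q' → ∃ (m : ℕ) (c : ℝ≥0∞), 0 < c ∧ ∀ᶠ k in atTop, c ≤ μ[|Icc 0 (Y k)]
        {x | proj Y z m k x ∈ Ioc (q : ℝ≥0) q' ∧ height Y z m k x ≤ 1 / ((j : ℝ≥0) + 1)} := by
    simp only [ae_all_iff]
    intro q q' j hq
    have hI0 := hμ.ne_zero q q' hq
    set I := Ioc (q : ℝ≥0) q' with hI
    have hev : ∀ᶠ m in atTop, μ[|Icc 0 (Y m)] I = (μ (Icc 0 (Y m)))⁻¹ * μ I := by
      filter_upwards [hY.tendsto.eventually_ge_atTop (q' : ℝ≥0)] with m hm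
      rw [cond_apply measurableSet_Icc, inter_eq_right.2]
      exact fun x hx => ⟨zero_le, hx.2.trans hm⟩
    refine hU.ae_mass_pos measurableSet_Ioc hsum ?_ ?_ (by positivity)
    · filter_upwards [hev] with m hm
      rw [hm]
      exact mul_ne_zero (ENNReal.inv_ne_zero.2 (hμ.ne_top _)) hI0
    · have h1 := ENNReal.Tendsto.mul_const (b := (μ I)⁻¹)
        (ENNReal.tendsto_sum_nat_add _ hY.sum_sq) (Or.inr (ENNReal.inv_ne_top.2 hI0))
      rw [zero_mul] at h1
      refine tendsto_of_tendsto_of_tendsto_of_le_of_le' tendsto_const_nhds h1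
        (Eventually.of_forall fun _ => bot_le) ?_
      filter_upwards [hev] with m hm
      have hItop : μ I ≠ ∞ := hμ.Ioc_ne_top _ _
      rw [hm, div_eq_mul_inv, ENNReal.mul_inv (Or.inr hItop) (Or.inr hI0), inv_inv, ← mul_assoc]
      gcongr
      rw [mul_comm, ← ENNReal.tsum_mul_left]
      refine ENNReal.tsum_le_tsum fun j => ?_
      gcongr
      exact hY.strictMono.monotone (Nat.le_add_left _ _)
  filter_upwards [hU.ae_le, hcell, hU.ae_height_small hsum, hleaf, hatom, hmass]
    with z h1 h2 h3 h4 h5 h6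
  have hpos : ∀ j : ℕ, 0 < (j : ℝ≥0∞)⁻¹ := fun j => ENNReal.inv_pos.2 (by simp)
  have hδ : ∀ δ : ℝ≥0, 0 < δ → ∃ i : ℕ, 1 / ((i : ℝ≥0) + 1) < δ := fun δ hδ =>
    exists_nat_one_div_lt hδ
  refine ⟨h1, h2, fun j => h3 _ (hpos j), fun q q' j hq => ?_, fun n j => ?_, fun j => ?_⟩
  · obtain ⟨m, c, hc, hm⟩ := h6 q q' j hq
    obtain ⟨i, hi⟩ := ENNReal.exists_inv_nat_lt hc.ne'
    exact ⟨m, i, hm.mono fun k hk => hi.le.trans hk⟩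
  · obtain ⟨δ, hδ0, hfr⟩ := h4 n _ (hpos j)
    obtain ⟨i, hi⟩ := hδ δ hδ0
    refine ⟨i, hfr.mono fun k hk => le_trans (measure_mono fun x hx => ?_) hk⟩
    exact lt_trans hx hi
  · obtain ⟨δ, hδ0, hfr⟩ := h5 _ (hpos j)
    obtain ⟨i, hi⟩ := hδ δ hδ0
    refine ⟨i, hfr.mono fun k hk => le_trans (measure_mono fun x hx => ?_) hk⟩
    exact lt_trans hx (NNReal.coe_lt_coe.2 hi)

/-- The deterministic part of the argument: good masses, cuts and glue points give the convergence
of the normalized masses and the properties of the limit. -/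
theorem exists_limit (hμ : IsGoodMass μ) (hY : IsGoodCut μ Y) {z : ℕ → ℝ≥0}
    (hz : IsGoodGluing (fun k => μ[|Icc 0 (Y k)]) Y z) :
    ∃ S : StickBreaking, S.cut = Y ∧ S.glue = z ∧ ∃ π : ProbabilityMeasure S.Tree,
      (∃ q : ℝ≥0 → ProbabilityMeasure S.Tree,
        (∀ l, 0 < l → (q l : Measure S.Tree) = (μ[|Icc 0 l]).map S.toTree) ∧
        Tendsto q atTop (𝓝 π)) ∧
      (π : Measure S.Tree).support = univ ∧ (∀ x, (π : Measure S.Tree) {x} = 0) ∧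
      ∀ᵐ x ∂(π : Measure S.Tree), x ∈ S.leaves := by
  refine ⟨⟨Y, z, hY.strictMono, hY.tendsto, hz.le⟩, rfl, rfl, ?_⟩
  set S : StickBreaking := ⟨Y, z, hY.strictMono, hY.tendsto, hz.le⟩
  have hprob : ∀ k, IsProbabilityMeasure (μ[|Icc 0 (S.cut k)]) := hμ.isProbabilityMeasure hY
  have hp : ∀ k, ∀ᵐ x ∂μ[|Icc 0 (S.cut k)], x ≤ S.cut k := (isUrn_cond hμ hY).p_le
  have hratio : Tendsto (fun k => μ.real (Icc 0 (S.cut k)) / μ.real (Icc 0 (S.cut (k + 1))))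
      atTop (𝓝 1) := by
    have h1 : Tendsto (fun k => ((1 - weight μ Y k : ℝ≥0) : ℝ)) atTop (𝓝 1) := by
      have := (hY.tendsto_weight hμ).const_sub 1
      rw [tsub_zero] at this
      exact NNReal.tendsto_coe.2 this
    refine h1.congr fun k => ?_
    have := congrArg ENNReal.toReal (one_sub_weight hμ hY k)
    rw [ENNReal.toReal_div] at this
    exact this
  obtain ⟨π, hπ⟩ := exists_tendsto_map S (fun k => μ[|Icc 0 (S.cut k)]) hp hz.tendsto_cell
      fun ε hε => by
    obtain ⟨j, hj⟩ := ENNReal.exists_inv_nat_lt hε.ne'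
    obtain ⟨m, hm⟩ := hz.height_le j
    exact ⟨m, hm.mono fun k hk => hk.trans hj.le⟩
  refine ⟨π, exists_tendsto_of_tendsto_cut S hμ.ne_top (fun _ => hμ.pos) hY.pos hratio hπ,
    support_eq_univ S _ π hY.pos hp hπ fun q q' j hq _ => ?_,
    measure_singleton_eq_zero S _ π hπ fun ε hε => ?_,
    ae_mem_leaves S _ π hp hπ fun n ε hε => ?_⟩
  · obtain ⟨m, i, hm⟩ := hz.le_mass q q' j hq
    exact ⟨m, (i : ℝ≥0∞)⁻¹, ENNReal.inv_pos.2 (by simp), hm⟩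
  · obtain ⟨j, hj⟩ := ENNReal.exists_inv_nat_lt hε.ne'
    obtain ⟨i, hi⟩ := hz.pair_le j
    refine ⟨(1 / ((i : ℝ≥0) + 1) : ℝ≥0), by positivity, hi.mono fun k hk => ?_⟩
    refine le_trans (measure_mono_ae ?_) (hk.trans hj.le)
    have h1 : ∀ᵐ w ∂(μ[|Icc 0 (S.cut k)]).prod (μ[|Icc 0 (S.cut k)]), w.1 ≤ S.cut k :=
      Measure.quasiMeasurePreserving_fst.ae (hp k)
    have h2 : ∀ᵐ w ∂(μ[|Icc 0 (S.cut k)]).prod (μ[|Icc 0 (S.cut k)]), w.2 ≤ S.cut k :=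
      Measure.quasiMeasurePreserving_snd.ae (hp k)
    filter_upwards [h1, h2] with w hw1 hw2 hw
    exact (rawDist_eq_lineDist S hw1 hw2).trans_lt hw
  · obtain ⟨j, hj⟩ := ENNReal.exists_inv_nat_lt hε.ne'
    obtain ⟨i, hi⟩ := hz.near_le n j
    exact ⟨1 / ((i : ℝ≥0) + 1), by positivity, hi.mono fun k hk => hk.trans hj.le⟩

end Mass

/-! ### Measures on the half-line -/

theorem measurableEmbedding_coe : MeasurableEmbedding ((↑) : ℝ≥0 → ℝ) :=
  MeasurableEmbedding.subtype_coe measurableSet_Ici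

theorem lebesgue_Icc (s t : ℝ≥0) : lebesgue (Icc s t) = ((t - s : ℝ≥0) : ℝ≥0∞) := by
  have himage : ((↑) : ℝ≥0 → ℝ) '' Icc s t = Icc (s : ℝ) t := by
    ext x
    constructor
    · rintro ⟨y, ⟨h1, h2⟩, rfl⟩
      exact ⟨NNReal.coe_le_coe.2 h1, NNReal.coe_le_coe.2 h2⟩
    · rintro ⟨h1, h2⟩
      exact ⟨⟨x, s.2.trans h1⟩, ⟨h1, h2⟩, rfl⟩
  rw [lebesgue, measurableEmbedding_coe.comap_apply, himage, Real.volume_Icc]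
  rcases le_total s t with h | h
  · rw [← NNReal.coe_sub h, ENNReal.ofReal_coe_nnreal]
  · rw [tsub_eq_zero_of_le h, ENNReal.ofReal_of_nonpos (by simpa using h)]
    rfl

instance : NullSingletonClass lebesgue where
  measure_singleton x := by rw [← Icc_self, lebesgue_Icc]; simp

instance : IsLocallyFiniteMeasure lebesgue where
  finiteAtNhds x := ⟨Icc 0 (x + 1), by
    rw [← NNReal.bot_eq_zero, Icc_bot]
    exact Iic_mem_nhds (by simp), by rw [lebesgue_Icc]; exact ENNReal.coe_lt_top⟩

/-- A locally finite measure on a set is bounded by its values on the segments joining points of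
the set. -/
theorem measure_le_of_forall_Icc_le {μ : Measure ℝ≥0} [IsLocallyFiniteMeasure μ] {S : Set ℝ≥0}
    (hS : MeasurableSet S) {c : ℝ≥0∞} (h : ∀ u ∈ S, ∀ v ∈ S, u ≤ v → μ (Icc u v) ≤ c) :
    μ S ≤ c := by
  rw [hS.measure_eq_iSup_isCompact]
  refine iSup_le fun K => iSup_le fun hK => iSup_le fun hKc => ?_
  rcases K.eq_empty_or_nonempty with rfl | hne
  · simp
  · obtain ⟨u, hu, hu'⟩ := hKc.exists_isLeast hne
    obtain ⟨v, hv, hv'⟩ := hKc.exists_isGreatest hne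
    exact (measure_mono (show K ⊆ Icc u v from fun x hx => ⟨hu' hx, hv' hx⟩)).trans
      (h u (hK hu) v (hK hv) (hu' hv))

section Profile

variable (μ : Measure ℝ≥0)

theorem monotone_measure_Icc : Monotone fun x : ℝ≥0 => μ (Icc 0 x) :=
  fun _ _ h => measure_mono (Icc_subset_Icc_right h)

theorem measurable_measure_Icc : Measurable fun x : ℝ≥0 => μ (Icc 0 x) :=
  (monotone_measure_Icc μ).measurable

/-- The integral of `F⁻²` against `dF` over `F ≥ 1`, where `F` is the distribution function of `μ`,
is bounded: the part with `F ∈ [2ⁿ, 2ⁿ⁺¹)` has mass at most `2ⁿ⁺¹`. -/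
theorem lintegral_inv_sq_le [IsLocallyFiniteMeasure μ] :
    ∫⁻ x, {x | 1 ≤ μ (Icc 0 x)}.indicator (fun x => (μ (Icc 0 x))⁻¹ ^ 2) x ∂μ ≤ 4 := by
  have hF := measurable_measure_Icc μ
  have hfin : ∀ x : ℝ≥0, μ (Icc 0 x) ≠ ∞ := fun x => isCompact_Icc.measure_lt_top.ne
  have hS : ∀ n : ℕ, MeasurableSet {x : ℝ≥0 | μ (Icc 0 x) < 2 ^ n} := fun n =>
    measurableSet_lt hF measurable_const
  have hSle : ∀ n : ℕ, μ {x : ℝ≥0 | μ (Icc 0 x) < 2 ^ n} ≤ 2 ^ n := fun n =>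
    measure_le_of_forall_Icc_le (hS n) fun u _ v hv _ =>
      (measure_mono (Icc_subset_Icc_left zero_le)).trans (le_of_lt hv)
  have hpt : ∀ x : ℝ≥0, {x | 1 ≤ μ (Icc 0 x)}.indicator (fun x => (μ (Icc 0 x))⁻¹ ^ 2) x ≤
      ∑' n : ℕ, {x : ℝ≥0 | μ (Icc 0 x) < 2 ^ (n + 1)}.indicator (fun _ => (2⁻¹ ^ n) ^ 2) x := by
    intro x
    by_cases hx : 1 ≤ μ (Icc 0 x)
    · rw [indicator_of_mem (by exact hx)]
      obtain ⟨n, hn1, hn2⟩ := exists_nat_pow_near (x := (μ (Icc 0 x)).toNNReal) (y := 2)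
        (by rw [← ENNReal.coe_le_coe, ENNReal.coe_toNNReal (hfin x)]; exact hx) one_lt_two
      rw [← ENNReal.coe_le_coe, ENNReal.coe_toNNReal (hfin x)] at hn1
      rw [← ENNReal.coe_lt_coe, ENNReal.coe_toNNReal (hfin x)] at hn2
      push_cast at hn1 hn2
      refine le_trans ?_ (ENNReal.le_tsum n)
      rw [indicator_of_mem (by exact hn2)]
      gcongr
      rw [← ENNReal.inv_pow]
      exact ENNReal.inv_le_inv.2 hn1
    · rw [indicator_of_notMem (by exact hx)]
      exact zero_le
  refine (lintegral_mono hpt).trans ?_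
  rw [lintegral_tsum fun n => (measurable_const.indicator (hS _)).aemeasurable]
  calc ∑' n : ℕ, ∫⁻ x, {x : ℝ≥0 | μ (Icc 0 x) < 2 ^ (n + 1)}.indicator
        (fun _ => ((2 : ℝ≥0∞)⁻¹ ^ n) ^ 2) x ∂μ
      ≤ ∑' n : ℕ, 2 * (2 : ℝ≥0∞)⁻¹ ^ n := by
        refine ENNReal.tsum_le_tsum fun n => ?_
        rw [lintegral_indicator_const (hS _)]
        refine (mul_le_mul_right (hSle (n + 1)) _).trans_eq ?_
        have h2 : (2 : ℝ≥0∞)⁻¹ ^ n * 2 ^ n = 1 := by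
          rw [← mul_pow, ENNReal.inv_mul_cancel (by simp) (by simp), one_pow]
        calc _ = 2 * (2 : ℝ≥0∞)⁻¹ ^ n * (2⁻¹ ^ n * 2 ^ n) := by ring
          _ = _ := by rw [h2, mul_one]
    _ = 4 := by
        rw [ENNReal.tsum_mul_left, ENNReal.tsum_geometric, ENNReal.one_sub_inv_two, inv_inv]
        norm_num

end Profile

section Void

variable (Λ : Measure ℝ≥0)

/-- The probability that a Poisson process of intensity `Λ` has no point in `[s, t)`. -/
noncomputable def voidProb (s t : ℝ≥0) : ℝ≥0∞ := ENNReal.ofReal (Real.exp (-(Λ (Ico s t)).toReal))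

variable {Λ}

theorem measurable_voidProb [SFinite Λ] :
    Measurable fun w : ℝ≥0 × ℝ≥0 => voidProb Λ (w.1 ⊓ w.2) (w.1 ⊔ w.2) := by
  have h : MeasurableSet {q : (ℝ≥0 × ℝ≥0) × ℝ≥0 | q.1.1 ⊓ q.1.2 ≤ q.2 ∧ q.2 < q.1.1 ⊔ q.1.2} :=
    (measurableSet_le (by fun_prop) (by fun_prop)).inter
      (measurableSet_lt (by fun_prop) (by fun_prop))
  have h2 : Measurable fun w : ℝ≥0 × ℝ≥0 => Λ (Ico (w.1 ⊓ w.2) (w.1 ⊔ w.2)) :=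
    measurable_measure_prodMk_left h
  exact (Real.measurable_exp.comp h2.ennreal_toReal.neg).ennreal_ofReal

/-- The integral of the avoidance probability around a point is bounded by a constant: after the time
change by the distribution function of `Λ`, it is the integral of `exp (-|u|)`. Here the points `u`
are sorted according to the integer part `n` of the `Λ`-mass between `u` and `x`, and on each side of
`x` the points with a given `n` have mass at most one. -/
theorem lintegral_voidProb_le [IsLocallyFiniteMeasure Λ] [NullSingletonClass Λ] (x : ℝ≥0) :
    ∫⁻ u, voidProb Λ (u ⊓ x) (u ⊔ x) ∂Λ ≤ 2 * (1 - ENNReal.ofReal (Real.exp (-1)))⁻¹ := by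
  set r := ENNReal.ofReal (Real.exp (-1))
  let D : ℝ≥0 → ℝ≥0∞ := fun u => Λ (Ico (u ⊓ x) (u ⊔ x))
  have hDfin : ∀ u, D u ≠ ∞ := fun u =>
    measure_ne_top_of_subset Ico_subset_Icc_self isCompact_Icc.measure_lt_top.ne
  have hD : Measurable D := by
    have h : MeasurableSet {q : ℝ≥0 × ℝ≥0 | q.1 ⊓ x ≤ q.2 ∧ q.2 < q.1 ⊔ x} :=
      (measurableSet_le (by fun_prop) (by fun_prop)).inter
        (measurableSet_lt (by fun_prop) (by fun_prop))
    exact measurable_measure_prodMk_left h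
  let S : ℕ → Set ℝ≥0 := fun n => {u | n ≤ D u ∧ D u ≤ n + 1}
  have hS : ∀ n, MeasurableSet (S n) := fun n =>
    (measurableSet_le measurable_const hD).inter (measurableSet_le hD measurable_const)
  have hsplit : ∀ s t u : ℝ≥0, s ≤ t → t ≤ u → Λ (Ico s u) = Λ (Ico s t) + Λ (Ico t u) := by
    intro s t u h1 h2
    rw [← Ico_union_Ico_eq_Ico h1 h2, measure_union _ measurableSet_Ico]
    exact disjoint_left.2 fun y hy hy' => absurd hy.2 (not_lt.2 hy'.1)
  have hcancel : ∀ (n : ℕ) (b c : ℝ≥0∞), n ≤ b → b + c ≤ n + 1 → c ≤ 1 := fun n b c h1 h2 =>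
    (ENNReal.add_le_add_iff_left (ENNReal.natCast_ne_top n)).1 ((add_le_add_left h1 c).trans h2)
  have hright : ∀ n, Λ (S n ∩ Ici x) ≤ 1 := fun n => by
    refine measure_le_of_forall_Icc_le ((hS n).inter measurableSet_Ici) fun u hu v hv huv => ?_
    rw [← measure_congr Ico_ae_eq_Icc]
    have h1 : D u = Λ (Ico x u) := by
      simp only [D, inf_eq_right.2 (mem_Ici.1 hu.2), sup_eq_left.2 (mem_Ici.1 hu.2)]
    have h2 : D v = Λ (Ico x v) := by
      simp only [D, inf_eq_right.2 (mem_Ici.1 hv.2), sup_eq_left.2 (mem_Ici.1 hv.2)]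
    refine hcancel n (D u) _ hu.1.1 ?_
    rw [h1, ← hsplit x u v hu.2 huv, ← h2]
    exact hv.1.2
  have hleft : ∀ n, Λ (S n ∩ Iic x) ≤ 1 := fun n => by
    refine measure_le_of_forall_Icc_le ((hS n).inter measurableSet_Iic) fun u hu v hv huv => ?_
    rw [← measure_congr Ico_ae_eq_Icc]
    have h1 : D u = Λ (Ico u x) := by
      simp only [D, inf_eq_left.2 (mem_Iic.1 hu.2), sup_eq_right.2 (mem_Iic.1 hu.2)]
    have h2 : D v = Λ (Ico v x) := by
      simp only [D, inf_eq_left.2 (mem_Iic.1 hv.2), sup_eq_right.2 (mem_Iic.1 hv.2)]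
    refine hcancel n (D v) _ hv.1.1 ?_
    rw [h2, add_comm, ← hsplit u v x huv hv.2, ← h1]
    exact hu.1.2
  have hpt : ∀ u, voidProb Λ (u ⊓ x) (u ⊔ x) ≤ ∑' n, (S n).indicator (fun _ => r ^ n) u := by
    intro u
    set n := ⌊(D u).toReal⌋₊
    have h1 : (n : ℝ) ≤ (D u).toReal := Nat.floor_le ENNReal.toReal_nonneg
    have h2 : (D u).toReal ≤ n + 1 := (Nat.lt_floor_add_one _).le
    have hu : u ∈ S n := by
      constructor
      · rw [← ENNReal.ofReal_natCast]
        exact ENNReal.ofReal_le_of_le_toReal h1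
      · rw [← ENNReal.ofReal_toReal (hDfin u), ← ENNReal.ofReal_natCast, ← ENNReal.ofReal_one,
          ← ENNReal.ofReal_add (by positivity) (by positivity)]
        exact ENNReal.ofReal_le_ofReal h2
    refine le_trans ?_ (ENNReal.le_tsum n)
    rw [indicator_of_mem hu, ← ENNReal.ofReal_pow (Real.exp_nonneg _), ← Real.exp_nat_mul]
    refine ENNReal.ofReal_le_ofReal (Real.exp_le_exp.2 ?_)
    change -(D u).toReal ≤ _
    linarith
  refine (lintegral_mono hpt).trans ?_
  rw [lintegral_tsum fun n => (measurable_const.indicator (hS _)).aemeasurable]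
  calc ∑' n, ∫⁻ u, (S n).indicator (fun _ => r ^ n) u ∂Λ ≤ ∑' n, 2 * r ^ n := by
        refine ENNReal.tsum_le_tsum fun n => ?_
        rw [lintegral_indicator_const (hS _), mul_comm]
        gcongr
        calc Λ (S n) ≤ Λ (S n ∩ Ici x ∪ S n ∩ Iic x) := measure_mono fun u hu =>
              (le_total x u).imp (fun h => ⟨hu, h⟩) (fun h => ⟨hu, h⟩)
          _ ≤ 1 + 1 := (measure_union_le _ _).trans (add_le_add (hright n) (hleft n))
          _ = 2 := one_add_one_eq_two
    _ = _ := by rw [ENNReal.tsum_mul_left, ENNReal.tsum_geometric]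

/-- Two points of the same stick are not separated by a cut, so the expectation of a sum over the
sticks is controlled by void probabilities. -/
theorem lintegral_tsum_gap_le {ρ : Measure (ℕ → ℝ≥0)} [SFinite ρ] (hmono : ∀ᵐ y ∂ρ, Monotone y)
    (hvoid : ∀ s t, s ≤ t → ρ {y | ∀ i, y i ∉ Ico s t} ≤ voidProb Λ s t)
    (γ : Measure (ℝ≥0 × ℝ≥0)) [SFinite γ] {g : ℝ≥0 × ℝ≥0 → ℝ≥0∞} (hg : Measurable g) :
    ∫⁻ y, ∑' k, ∫⁻ w in Ioc (y k) (y (k + 1)) ×ˢ Ioc (y k) (y (k + 1)), g w ∂γ ∂ρ ≤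
      ∫⁻ w, g w * voidProb Λ (w.1 ⊓ w.2) (w.1 ⊔ w.2) ∂γ := by
  let N : Set ((ℕ → ℝ≥0) × (ℝ≥0 × ℝ≥0)) :=
    {q | ∀ i, q.1 i ∉ Ico (q.2.1 ⊓ q.2.2) (q.2.1 ⊔ q.2.2)}
  have hN : MeasurableSet N := by
    have : N = ⋂ i, {q | q.2.1 ⊓ q.2.2 ≤ q.1 i ∧ q.1 i < q.2.1 ⊔ q.2.2}ᶜ := by
      ext q; simp [N, mem_iInter]
    rw [this]
    exact MeasurableSet.iInter fun i => ((measurableSet_le (by fun_prop) (by fun_prop)).inter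
      (measurableSet_lt (by fun_prop) (by fun_prop))).compl
  have hpt : ∀ᵐ y ∂ρ, ∑' k, ∫⁻ w in Ioc (y k) (y (k + 1)) ×ˢ Ioc (y k) (y (k + 1)), g w ∂γ ≤
      ∫⁻ w, N.indicator 1 (y, w) * g w ∂γ := by
    filter_upwards [hmono] with y hy
    have hdisj : Pairwise (Function.onFun Disjoint
        fun k => Ioc (y k) (y (k + 1)) ×ˢ Ioc (y k) (y (k + 1))) := fun i j hij =>
      Disjoint.set_prod_left (hy.pairwise_disjoint_on_Ioc_succ hij) _ _
    rw [← lintegral_iUnion (fun k => measurableSet_Ioc.prod measurableSet_Ioc) hdisj,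
      ← lintegral_indicator (MeasurableSet.iUnion fun k =>
        measurableSet_Ioc.prod measurableSet_Ioc)]
    refine lintegral_mono fun w => ?_
    by_cases hw : w ∈ ⋃ k, Ioc (y k) (y (k + 1)) ×ˢ Ioc (y k) (y (k + 1))
    · have hwN : (y, w) ∈ N := by
        obtain ⟨k, ⟨h1, h2⟩, h3, h4⟩ := mem_iUnion.1 hw
        intro i hi
        rcases le_or_gt i k with h | h
        · exact absurd hi.1 (not_le.2 ((hy h).trans_lt (lt_inf_iff.2 ⟨h1, h3⟩)))
        · exact absurd hi.2 (not_lt.2 ((sup_le h2 h4).trans (hy h)))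
      simp [hw, hwN]
    · simp [hw]
  refine (lintegral_mono_ae hpt).trans ?_
  have hm : Measurable (Function.uncurry fun (y : ℕ → ℝ≥0) (w : ℝ≥0 × ℝ≥0) =>
      N.indicator (1 : (ℕ → ℝ≥0) × (ℝ≥0 × ℝ≥0) → ℝ≥0∞) (y, w) * g w) :=
    (measurable_one.indicator hN).mul (hg.comp measurable_snd)
  rw [lintegral_lintegral_swap hm.aemeasurable]
  refine lintegral_mono fun w => ?_
  have hNw : MeasurableSet {y : ℕ → ℝ≥0 | (y, w) ∈ N} := measurable_prodMk_right hN
  calc ∫⁻ y, N.indicator 1 (y, w) * g w ∂ρ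
      = (∫⁻ y, {y : ℕ → ℝ≥0 | (y, w) ∈ N}.indicator 1 y ∂ρ) * g w :=
        lintegral_mul_const _ (measurable_one.indicator hNw)
    _ = ρ {y | (y, w) ∈ N} * g w := by rw [lintegral_indicator_one hNw]
    _ ≤ voidProb Λ (w.1 ⊓ w.2) (w.1 ⊔ w.2) * g w := by
        gcongr
        exact hvoid _ _ inf_le_sup
    _ = _ := mul_comm _ _

end Void

/-! ### The cuts, for a fixed mass measure -/

/-- The intensity measure of the cuts. -/
noncomputable def rate (μ : Measure ℝ≥0) : Measure ℝ≥0 :=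
  lebesgue.withDensity fun l => μ (Icc 0 l)

instance (μ : Measure ℝ≥0) : NullSingletonClass (rate μ) where
  measure_singleton x := withDensity_absolutelyContinuous _ _ (measure_singleton x)

section Rate

variable {μ : Measure ℝ≥0}

theorem IsGoodMass.isLocallyFiniteMeasure (hμ : IsGoodMass μ) : IsLocallyFiniteMeasure μ where
  finiteAtNhds x := ⟨Icc 0 (x + 1), by
    rw [← NNReal.bot_eq_zero, Icc_bot]
    exact Iic_mem_nhds (by simp), (hμ.ne_top _).lt_top⟩

theorem rate_Icc_le (t : ℝ≥0) : rate μ (Icc 0 t) ≤ μ (Icc 0 t) * t := by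
  rw [rate, withDensity_apply _ measurableSet_Icc]
  calc ∫⁻ l in Icc 0 t, μ (Icc 0 l) ∂lebesgue ≤ ∫⁻ _ in Icc 0 t, μ (Icc 0 t) ∂lebesgue :=
        setLIntegral_mono measurable_const fun l hl => monotone_measure_Icc μ hl.2
    _ = _ := by rw [setLIntegral_const, lebesgue_Icc, tsub_zero]

theorem le_rate_Icc (s t : ℝ≥0) : μ (Icc 0 s) * ((t - s : ℝ≥0) : ℝ≥0∞) ≤ rate μ (Icc s t) := by
  rw [rate, withDensity_apply _ measurableSet_Icc]
  calc _ = ∫⁻ _ in Icc s t, μ (Icc 0 s) ∂lebesgue := by rw [setLIntegral_const, lebesgue_Icc]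
    _ ≤ _ := setLIntegral_mono (measurable_measure_Icc μ) fun l hl => monotone_measure_Icc μ hl.1

theorem IsGoodMass.rate_ne_top (hμ : IsGoodMass μ) (t : ℝ≥0) : rate μ (Icc 0 t) ≠ ∞ :=
  ((rate_Icc_le t).trans_lt (ENNReal.mul_lt_top (hμ.ne_top t).lt_top ENNReal.coe_lt_top)).ne

theorem IsGoodMass.isLocallyFiniteMeasure_rate (hμ : IsGoodMass μ) :
    IsLocallyFiniteMeasure (rate μ) where
  finiteAtNhds x := ⟨Icc 0 (x + 1), by
    rw [← NNReal.bot_eq_zero, Icc_bot]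
    exact Iic_mem_nhds (by simp), (hμ.rate_ne_top _).lt_top⟩

theorem IsGoodMass.rate_Ico_ne_top (hμ : IsGoodMass μ) (s t : ℝ≥0) : rate μ (Ico s t) ≠ ∞ :=
  measure_ne_top_of_subset (show Ico s t ⊆ Icc 0 t from fun _ hx => ⟨zero_le, hx.2.le⟩)
    (hμ.rate_ne_top t)

theorem ae_tsum_gap_ne_top {Λ : Measure ℝ≥0} {ρ : Measure (ℕ → ℝ≥0)} [SFinite ρ]
    (hmono : ∀ᵐ y ∂ρ, Monotone y)
    (hvoid : ∀ s t, s ≤ t → ρ {y | ∀ i, y i ∉ Ico s t} ≤ voidProb Λ s t)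
    (γ : Measure (ℝ≥0 × ℝ≥0)) [SFinite γ] {g : ℝ≥0 × ℝ≥0 → ℝ≥0∞} (hg : Measurable g)
    (hfin : ∫⁻ w, g w * voidProb Λ (w.1 ⊓ w.2) (w.1 ⊔ w.2) ∂γ ≠ ∞) :
    ∀ᵐ y ∂ρ, ∑' k, ∫⁻ w in Ioc (y k) (y (k + 1)) ×ˢ Ioc (y k) (y (k + 1)), g w ∂γ ≠ ∞ := by
  have hmeas : Measurable fun y : ℕ → ℝ≥0 =>
      ∑' k, ∫⁻ w in Ioc (y k) (y (k + 1)) ×ˢ Ioc (y k) (y (k + 1)), g w ∂γ := by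
    refine Measurable.tsum fun k => ?_
    let A : Set ((ℕ → ℝ≥0) × (ℝ≥0 × ℝ≥0)) := {q | (q.1 k < q.2.1 ∧ q.2.1 ≤ q.1 (k + 1)) ∧
      (q.1 k < q.2.2 ∧ q.2.2 ≤ q.1 (k + 1))}
    have hA : MeasurableSet A :=
      ((measurableSet_lt (by fun_prop) (by fun_prop)).inter
        (measurableSet_le (by fun_prop) (by fun_prop))).inter
      ((measurableSet_lt (by fun_prop) (by fun_prop)).inter
        (measurableSet_le (by fun_prop) (by fun_prop)))
    have h1 : Measurable fun q : (ℕ → ℝ≥0) × (ℝ≥0 × ℝ≥0) => A.indicator (fun q => g q.2) q :=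
      (hg.comp measurable_snd).indicator hA
    have h2 : Measurable fun y : ℕ → ℝ≥0 => ∫⁻ w, A.indicator (fun q => g q.2) (y, w) ∂γ :=
      h1.lintegral_prod_right'
    convert h2 using 2 with y
    rw [← lintegral_indicator (measurableSet_Ioc.prod measurableSet_Ioc)]
    rfl
  filter_upwards [ae_lt_top hmeas
    ((lintegral_tsum_gap_le hmono hvoid γ hg).trans_lt hfin.lt_top).ne] with y hy using hy.ne

theorem IsGoodMass.continuousWithinAt (hμ : IsGoodMass μ) (x : ℝ≥0) :
    ContinuousWithinAt (fun x => μ.real (Icc 0 x)) (Ici x) x := by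
  rw [← continuousWithinAt_Ioi_iff_Ici]
  have h := tendsto_measure_biInter_gt (μ := μ) (s := fun r : ℝ≥0 => Icc 0 r) (a := x)
    (fun r _ => measurableSet_Icc.nullMeasurableSet) (fun i j _ hij => Icc_subset_Icc_right hij)
    ⟨x + 1, by simp, hμ.ne_top _⟩
  have hI : ⋂ r > x, Icc 0 r = Icc 0 x := by
    ext u
    simp only [mem_iInter, mem_Icc, zero_le, true_and]
    exact ⟨fun h => le_of_forall_gt_imp_ge_of_dense h, fun h r hr => h.trans hr.le⟩
  rw [hI] at h
  exact (ENNReal.tendsto_toReal (hμ.ne_top x)).comp h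

theorem IsGoodMass.monotone_real (hμ : IsGoodMass μ) : Monotone fun x => μ.real (Icc 0 x) :=
  fun _ t h => ENNReal.toReal_mono (hμ.ne_top t) (monotone_measure_Icc μ h)

/-- The Stieltjes function `-1 / (1 + F)`, where `F` is the distribution function of `μ`. -/
noncomputable def IsGoodMass.stieltjes (hμ : IsGoodMass μ) : StieltjesFunction ℝ≥0 where
  toFun x := -(1 + μ.real (Icc 0 x))⁻¹
  mono' s t h := neg_le_neg (inv_anti₀ (by positivity) (add_le_add_right
    (show μ.real (Icc 0 s) ≤ μ.real (Icc 0 t) from hμ.monotone_real h) 1))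
  right_continuous' x := ContinuousWithinAt.neg <| ContinuousWithinAt.inv₀
    (continuousWithinAt_const.add (hμ.continuousWithinAt x)) (by positivity)

theorem IsGoodMass.isFiniteMeasure_stieltjes (hμ : IsGoodMass μ) :
    IsFiniteMeasure hμ.stieltjes.measure := by
  refine hμ.stieltjes.isFiniteMeasure (l := hμ.stieltjes 0) (u := 0) ?_ ?_
  · rw [OrderBot.atBot_eq]
    exact tendsto_pure_nhds _ _
  · have h : Tendsto (fun x => μ.real (Icc 0 x)) atTop atTop := by
      have := hμ.tendsto
      refine tendsto_atTop.2 fun b => ?_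
      filter_upwards [hμ.tendsto.eventually (eventually_ge_nhds
        (show ENNReal.ofReal b < ∞ from ENNReal.ofReal_lt_top))] with x hx
      exact (ENNReal.ofReal_le_iff_le_toReal (hμ.ne_top x)).1 hx
    have h2 := (tendsto_inv_atTop_zero.comp (tendsto_atTop_add_const_left _ 1 h)).neg
    rw [neg_zero] at h2
    exact h2

theorem coe_weight_real (hμ : IsGoodMass μ) {Y : ℕ → ℝ≥0} (hY : Monotone Y) {k : ℕ}
    (h : 0 < Y (k + 1)) : (weight μ Y k : ℝ≥0∞) = ENNReal.ofReal
      ((μ.real (Icc 0 (Y (k + 1))) - μ.real (Icc 0 (Y k))) / μ.real (Icc 0 (Y (k + 1)))) := by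
  have h1 : μ (Ioc (Y k) (Y (k + 1))) =
      ENNReal.ofReal (μ.real (Icc 0 (Y (k + 1))) - μ.real (Icc 0 (Y k))) := by
    rw [ENNReal.ofReal_sub _ measureReal_nonneg, ofReal_measureReal (hμ.ne_top _),
      ofReal_measureReal (hμ.ne_top _), measure_Icc_succ hY,
      ENNReal.add_sub_cancel_left (hμ.ne_top _)]
  have h2 : 0 < μ.real (Icc 0 (Y (k + 1))) := ENNReal.toReal_pos (hμ.pos h) (hμ.ne_top _)
  rw [coe_weight hμ h, ENNReal.ofReal_div_of_pos h2, ← h1, ofReal_measureReal (hμ.ne_top _)]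

/-- The lengths of the sticks, weighted by the proportion of mass they carry, are summable: up to
constants, the `k`-th term is the product of the masses of the `k`-th gap for the intensity
measure `F dx` and for the finite measure `-d(1 / (1 + F))`. -/
theorem ae_sum_length (hμ : IsGoodMass μ) {ρ : Measure (ℕ → ℝ≥0)} [SFinite ρ]
    (hmono : ∀ᵐ y ∂ρ, Monotone y)
    (hvoid : ∀ s t, s ≤ t → ρ {y | ∀ i, y i ∉ Ico s t} ≤ voidProb (rate μ) s t) :
    ∀ᵐ y ∂ρ, 0 < y 0 →
      ∑' k, (weight μ y k : ℝ≥0∞) * ((y (k + 1) - y k : ℝ≥0) : ℝ≥0∞) ≠ ∞ := by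
  have := hμ.isLocallyFiniteMeasure_rate
  have := hμ.isFiniteMeasure_stieltjes
  set m := hμ.stieltjes.measure
  have hfin : ∫⁻ w, 1 * voidProb (rate μ) (w.1 ⊓ w.2) (w.1 ⊔ w.2) ∂(rate μ).prod m ≠ ∞ := by
    simp only [one_mul]
    rw [lintegral_prod_symm _ measurable_voidProb.aemeasurable]
    refine ((lintegral_mono fun x => lintegral_voidProb_le x).trans_lt ?_).ne
    rw [lintegral_const]
    refine ENNReal.mul_lt_top (ENNReal.mul_lt_top (by simp) ?_) (measure_lt_top _ _)
    rw [ENNReal.inv_lt_top, tsub_pos_iff_lt, ENNReal.ofReal_lt_one]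
    rw [← Real.exp_zero]
    exact Real.exp_lt_exp.2 (by norm_num)
  filter_upwards [ae_tsum_gap_ne_top hmono hvoid ((rate μ).prod m) measurable_const hfin, hmono]
    with y hy hym h0
  set F : ℝ≥0 → ℝ := fun x => μ.real (Icc 0 x) with hF
  have hc : 0 < F (y 0) := ENNReal.toReal_pos (hμ.pos h0) (hμ.ne_top _)
  -- `K` compares `F` with `1 + F` beyond the first cut
  set K := 1 + (F (y 0))⁻¹
  have hK : ∀ k, 1 + F (y k) ≤ K * F (y k) := fun k => by
    have h1 : F (y 0) ≤ F (y k) := hμ.monotone_real (hym k.zero_le)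
    have h2 : (F (y 0))⁻¹ * F (y 0) ≤ (F (y 0))⁻¹ * F (y k) := by gcongr
    rw [inv_mul_cancel₀ hc.ne'] at h2
    simp only [K]
    linarith
  have hterm : ∀ k, (weight μ y k : ℝ≥0∞) * ((y (k + 1) - y k : ℝ≥0) : ℝ≥0∞) ≤
      ENNReal.ofReal (K ^ 2) * ∫⁻ w in Ioc (y k) (y (k + 1)) ×ˢ Ioc (y k) (y (k + 1)), 1
        ∂(rate μ).prod m := by
    intro k
    have hk := hym k.le_succ
    have hFk : 0 < F (y k) := hc.trans_le (hμ.monotone_real (hym k.zero_le))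
    have hFF : F (y k) ≤ F (y (k + 1)) := hμ.monotone_real hk
    have hlen : ((y (k + 1) - y k : ℝ≥0) : ℝ≥0∞) = ENNReal.ofReal (y (k + 1) - y k) := by
      rw [← NNReal.coe_sub hk, ENNReal.ofReal_coe_nnreal]
    have hlen0 : (0 : ℝ) ≤ y (k + 1) - y k := sub_nonneg.2 (NNReal.coe_le_coe.2 hk)
    have hΛ : ENNReal.ofReal (F (y k) * (y (k + 1) - y k)) ≤ rate μ (Ioc (y k) (y (k + 1))) := by
      rw [measure_congr Ioc_ae_eq_Icc, ENNReal.ofReal_mul hFk.le, ofReal_measureReal (hμ.ne_top _),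
        ← hlen]
      exact le_rate_Icc _ _
    have hm : m (Ioc (y k) (y (k + 1))) =
        ENNReal.ofReal ((1 + F (y k))⁻¹ - (1 + F (y (k + 1)))⁻¹) := by
      rw [StieltjesFunction.measure_Ioc]
      congr 1
      change -(1 + F (y (k + 1)))⁻¹ - -(1 + F (y k))⁻¹ = _
      ring
    have hpos : 0 < y (k + 1) := h0.trans_le (hym (Nat.zero_le _))
    rw [setLIntegral_one, Measure.prod_prod, hm, coe_weight_real hμ hym hpos, hlen,
      ← ENNReal.ofReal_mul (div_nonneg (sub_nonneg.2 hFF) measureReal_nonneg)]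
    refine le_trans ?_ (mul_le_mul_right (mul_le_mul_left hΛ _) _)
    rw [← ENNReal.ofReal_mul (mul_nonneg hFk.le hlen0), ← ENNReal.ofReal_mul (sq_nonneg K)]
    refine ENNReal.ofReal_le_ofReal ?_
    change (F (y (k + 1)) - F (y k)) / F (y (k + 1)) * _ ≤ _
    have hFk' : 0 < F (y (k + 1)) := hFk.trans_le hFF
    have h1 := hK k
    have h2 := hK (k + 1)
    have hKpos : 0 < K := by positivity
    have e1 : (F (y (k + 1)) - F (y k)) / F (y (k + 1)) ≤
        K * ((F (y (k + 1)) - F (y k)) / (1 + F (y (k + 1)))) := by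
      rw [← mul_div_assoc, div_le_div_iff₀ hFk' (by positivity)]
      nlinarith [mul_le_mul_of_nonneg_left h2 (sub_nonneg.2 hFF)]
    have e2 : (F (y (k + 1)) - F (y k)) / (1 + F (y (k + 1))) =
        (1 + F (y k)) * ((1 + F (y k))⁻¹ - (1 + F (y (k + 1)))⁻¹) := by
      field_simp
      ring
    have e3 : 0 ≤ (1 + F (y k))⁻¹ - (1 + F (y (k + 1)))⁻¹ :=
      sub_nonneg.2 (inv_anti₀ (by positivity) (by linarith))
    calc (F (y (k + 1)) - F (y k)) / F (y (k + 1)) * (y (k + 1) - y k)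
        ≤ K * ((1 + F (y k)) * ((1 + F (y k))⁻¹ - (1 + F (y (k + 1)))⁻¹)) *
          (y (k + 1) - y k) := by
          rw [← e2]; gcongr
      _ ≤ K * ((K * F (y k)) * ((1 + F (y k))⁻¹ - (1 + F (y (k + 1)))⁻¹)) *
          (y (k + 1) - y k) := by gcongr
      _ = _ := by ring
  refine ((ENNReal.tsum_le_tsum hterm).trans_lt ?_).ne
  rw [ENNReal.tsum_mul_left]
  exact ENNReal.mul_lt_top ENNReal.ofReal_lt_top hy.lt_top

/-- The squared proportions of mass carried by the sticks, weighted by the total mass, are summable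
if the mass measure has few pairs of close points: up to finitely many terms, the `k`-th one is at
most the integral of `1 / F` over the pairs of points of the `k`-th stick. -/
theorem ae_sum_sq (hμ : IsGoodMass μ) {ρ : Measure (ℕ → ℝ≥0)} [SFinite ρ]
    (hmono : ∀ᵐ y ∂ρ, Monotone y)
    (hvoid : ∀ s t, s ≤ t → ρ {y | ∀ i, y i ∉ Ico s t} ≤ voidProb (rate μ) s t)
    (hclose : ∫⁻ x, ∫⁻ x', {w : ℝ≥0 × ℝ≥0 | 2 ≤ μ (Icc 0 w.1) ∧ w.1 ≤ w.2}.indicator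
      (fun w => (μ (Icc 0 w.1))⁻¹ *
        ENNReal.ofReal (Real.exp (-((w.2 - w.1) * μ.real (Icc 0 w.1))))) (x, x') ∂μ ∂μ ≠ ∞) :
    ∀ᵐ y ∂ρ, 0 < y 0 → Tendsto y atTop atTop →
      ∑' k, μ (Icc 0 (y k)) * (weight μ y k : ℝ≥0∞) ^ 2 ≠ ∞ := by
  have := hμ.isLocallyFiniteMeasure
  have hF := measurable_measure_Icc μ
  set F : ℝ≥0 → ℝ≥0∞ := fun x => μ (Icc 0 x) with hFdef
  let A : Set (ℝ≥0 × ℝ≥0) := {w | 2 ≤ F w.1 ∧ w.1 ≤ w.2}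
  have hle : MeasurableSet {w : ℝ≥0 × ℝ≥0 | w.1 ≤ w.2} :=
    measurableSet_le measurable_fst measurable_snd
  have hA : MeasurableSet A :=
    (measurableSet_le measurable_const (hF.comp measurable_fst)).inter hle
  let h : ℝ≥0 × ℝ≥0 → ℝ≥0∞ := A.indicator
    (fun w => (F w.1)⁻¹ * ENNReal.ofReal (Real.exp (-((w.2 - w.1) * (F w.1).toReal))))
  have hF1 : Measurable fun w : ℝ≥0 × ℝ≥0 => F w.1 := hF.comp measurable_fst
  have hh : Measurable h := by
    refine Measurable.indicator (hF1.inv.mul ?_) hA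
    have := hF1.ennreal_toReal
    fun_prop
  let B : Set (ℝ≥0 × ℝ≥0) := {w | 2 ≤ F (w.1 ⊓ w.2)}
  have hB : MeasurableSet B := measurableSet_le measurable_const
    (hF.comp (measurable_fst.inf measurable_snd))
  let g : ℝ≥0 × ℝ≥0 → ℝ≥0∞ := B.indicator fun w => (F (w.1 ⊔ w.2))⁻¹
  have hg : Measurable g :=
    Measurable.indicator (hF.comp (measurable_fst.sup measurable_snd)).inv hB
  have key : ∀ s t, s ≤ t → g (s, t) * voidProb (rate μ) s t ≤ h (s, t) ∧ g (t, s) = g (s, t) := by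
    intro s t hst
    constructor
    · by_cases h2 : 2 ≤ F s
      · have hmB : (s, t) ∈ B := by simpa [B, inf_eq_left.2 hst] using h2
        have hmA : (s, t) ∈ A := ⟨h2, hst⟩
        simp only [g, h, indicator_of_mem hmB, indicator_of_mem hmA, sup_eq_right.2 hst]
        gcongr
        · exact monotone_measure_Icc μ hst
        · refine ENNReal.ofReal_le_ofReal (Real.exp_le_exp.2 (neg_le_neg ?_))
          have h3 := le_rate_Icc (μ := μ) s t
          rw [← measure_congr (μ := rate μ) Ico_ae_eq_Icc] at h3
          have h4 := ENNReal.toReal_mono (hμ.rate_Ico_ne_top s t) h3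
          rw [ENNReal.toReal_mul, ENNReal.coe_toReal, NNReal.coe_sub hst, mul_comm] at h4
          exact h4
      · have hmB : (s, t) ∉ B := by simpa [B, inf_eq_left.2 hst] using h2
        simp [g, indicator_of_notMem hmB]
    · simp only [g, B, indicator, mem_ofPred_eq, inf_comm, sup_comm]
  have hfin : ∫⁻ w, g w * voidProb (rate μ) (w.1 ⊓ w.2) (w.1 ⊔ w.2) ∂μ.prod μ ≠ ∞ := by
    have h1 : ∀ w, g w * voidProb (rate μ) (w.1 ⊓ w.2) (w.1 ⊔ w.2) ≤ h w + h w.swap := by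
      rintro ⟨s, t⟩
      rcases le_total s t with hst | hst
      · simp only [inf_eq_left.2 hst, sup_eq_right.2 hst]
        exact (key s t hst).1.trans le_self_add
      · simp only [inf_eq_right.2 hst, sup_eq_left.2 hst]
        rw [(key t s hst).2]
        exact (key t s hst).1.trans le_add_self
    refine ((lintegral_mono h1).trans_lt ?_).ne
    rw [lintegral_add_left hh, lintegral_prod_swap, lintegral_prod _ hh.aemeasurable]
    exact ENNReal.add_lt_top.2 ⟨hclose.lt_top, hclose.lt_top⟩
  filter_upwards [ae_tsum_gap_ne_top hmono hvoid (μ.prod μ) hg hfin, hmono] with y hy hym h0 hyt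
  obtain ⟨k₀, hk₀⟩ := eventually_atTop.1 ((hμ.tendsto.comp hyt).eventually
    (eventually_ge_nhds (show (2 : ℝ≥0∞) < ∞ by simp)))
  rw [← ENNReal.summable.sum_add_tsum_nat_add' (k := k₀)]
  refine ENNReal.add_ne_top.2 ⟨?_, ?_⟩
  · refine (ENNReal.sum_lt_top.2 fun k _ => ?_).ne
    exact ENNReal.mul_lt_top (hμ.ne_top _).lt_top (by finiteness)
  · have hterm : ∀ k, μ (Icc 0 (y (k + k₀))) * (weight μ y (k + k₀) : ℝ≥0∞) ^ 2 ≤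
        ∫⁻ w in Ioc (y (k + k₀)) (y (k + k₀ + 1)) ×ˢ Ioc (y (k + k₀)) (y (k + k₀ + 1)), g w
          ∂μ.prod μ := by
      intro k
      set n := k + k₀ with hn
      have h2 : 2 ≤ F (y n) := hk₀ n (Nat.le_add_left _ _)
      have hpos : 0 < y (n + 1) := h0.trans_le (hym (Nat.zero_le _))
      have hFtop : F (y (n + 1)) ≠ ∞ := hμ.ne_top _
      have hF0 : F (y (n + 1)) ≠ 0 := hμ.pos hpos
      have hle : F (y n) * (F (y (n + 1)))⁻¹ ≤ 1 := by
        rw [← div_eq_mul_inv]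
        exact ENNReal.div_le_of_le_mul (by
          rw [one_mul]
          exact monotone_measure_Icc μ (hym n.le_succ))
      calc F (y n) * (weight μ y n : ℝ≥0∞) ^ 2
          = F (y n) * (F (y (n + 1)))⁻¹ * ((F (y (n + 1)))⁻¹ *
            (μ (Ioc (y n) (y (n + 1))) * μ (Ioc (y n) (y (n + 1))))) := by
            rw [coe_weight hμ hpos, div_eq_mul_inv]
            ring
        _ ≤ (F (y (n + 1)))⁻¹ * (μ (Ioc (y n) (y (n + 1))) * μ (Ioc (y n) (y (n + 1)))) :=
            mul_le_of_le_one_left' hle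
        _ = ∫⁻ _ in Ioc (y n) (y (n + 1)) ×ˢ Ioc (y n) (y (n + 1)), (F (y (n + 1)))⁻¹
            ∂μ.prod μ := by rw [setLIntegral_const, Measure.prod_prod]
        _ ≤ _ := by
            refine setLIntegral_mono hg fun w hw => ?_
            have hmB : w ∈ B :=
              h2.trans (monotone_measure_Icc μ (le_inf hw.1.1.le hw.2.1.le))
            simp only [g, indicator_of_mem hmB]
            exact ENNReal.inv_le_inv.2 (monotone_measure_Icc μ (sup_le hw.1.2 hw.2.2))
    exact ((ENNReal.tsum_le_tsum hterm).trans
      (ENNReal.tsum_comp_le_tsum_of_injective (add_left_injective k₀) _)).trans_lt hy.lt_top |>.ne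

end Rate

/-! ### The mass measure -/

section MassMeasure

variable (θ : ℕ → ℝ≥0)

theorem lintegral_massMeasure (x : ℕ → ℝ≥0) {f : ℝ≥0 → ℝ≥0∞} (hf : Measurable f) :
    ∫⁻ u, f u ∂massMeasure θ x =
      (θ 0 : ℝ≥0∞) ^ 2 * ∫⁻ u, f u ∂lebesgue + ∑' i, (θ (i + 1) : ℝ≥0∞) * f (x i) := by
  rw [massMeasure, lintegral_add_measure, lintegral_sum_measure, lintegral_smul_measure]
  congr 1
  refine tsum_congr fun i => ?_
  rw [lintegral_smul_measure, lintegral_dirac' _ hf]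
  rfl

theorem massMeasure_apply (x : ℕ → ℝ≥0) {s : Set ℝ≥0} (hs : MeasurableSet s) :
    massMeasure θ x s =
      (θ 0 : ℝ≥0∞) ^ 2 * lebesgue s + ∑' i, (θ (i + 1) : ℝ≥0∞) * s.indicator 1 (x i) := by
  rw [← lintegral_indicator_one hs, lintegral_massMeasure θ x (measurable_one.indicator hs),
    lintegral_indicator_one hs]

instance (x : ℕ → ℝ≥0) : SFinite (massMeasure θ x) := by
  unfold massMeasure
  have h1 : SFinite (θ 0 ^ 2 • lebesgue) :=
    inferInstanceAs (SFinite (((θ 0 ^ 2 : ℝ≥0) : ℝ≥0∞) • lebesgue))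
  have h2 : ∀ i, SFinite (θ (i + 1) • Measure.dirac (x i)) := fun i =>
    inferInstanceAs (SFinite ((θ (i + 1) : ℝ≥0∞) • Measure.dirac (x i)))
  infer_instance

variable {θ}

theorem measurable_lintegral_massMeasure {α : Type*} [MeasurableSpace α] {f : α × ℝ≥0 → ℝ≥0∞}
    (hf : Measurable f) {x : α → ℕ → ℝ≥0} (hx : Measurable x) :
    Measurable fun a => ∫⁻ u, f (a, u) ∂massMeasure θ (x a) := by
  have h : (fun a => ∫⁻ u, f (a, u) ∂massMeasure θ (x a)) = fun a =>
      (θ 0 : ℝ≥0∞) ^ 2 * ∫⁻ u, f (a, u) ∂lebesgue +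
        ∑' i, (θ (i + 1) : ℝ≥0∞) * f (a, x a i) := by
    funext a
    exact lintegral_massMeasure θ (x a) (f := fun u => f (a, u)) (by fun_prop)
  rw [h]
  refine (hf.lintegral_prod_right'.const_mul _).add (Measurable.tsum fun i => ?_)
  exact (hf.comp (measurable_id.prodMk ((measurable_pi_apply i).comp hx))).const_mul _

theorem measurable_massMeasure : Measurable (massMeasure θ) := by
  refine Measure.measurable_of_measurable_coe _ fun s hs => ?_
  have h := measurable_lintegral_massMeasure (θ := θ) (f := fun w : (ℕ → ℝ≥0) × ℝ≥0 =>
    s.indicator 1 w.2) ((measurable_one.indicator hs).comp measurable_snd) measurable_id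
  simpa only [id, lintegral_indicator_one hs] using h

theorem measurable_massMeasure_Icc :
    Measurable fun w : (ℕ → ℝ≥0) × ℝ≥0 => massMeasure θ w.1 (Icc 0 w.2) := by
  have hS : MeasurableSet {w : ((ℕ → ℝ≥0) × ℝ≥0) × ℝ≥0 | w.2 ≤ w.1.2} :=
    measurableSet_le measurable_snd (by fun_prop)
  have h := measurable_lintegral_massMeasure (θ := θ)
    (f := fun w : ((ℕ → ℝ≥0) × ℝ≥0) × ℝ≥0 => {w | w.2 ≤ w.1.2}.indicator 1 w)
    (measurable_one.indicator hS) (x := fun w => w.1) measurable_fst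
  convert h using 2 with w
  rw [← lintegral_indicator_one measurableSet_Icc]
  refine lintegral_congr fun u => ?_
  simp [indicator]

theorem lebesgue_univ : lebesgue univ = ∞ := by
  refine ENNReal.eq_top_of_forall_nnreal_le fun r => ?_
  calc (r : ℝ≥0∞) = lebesgue (Icc 0 r) := by rw [lebesgue_Icc, tsub_zero]
    _ ≤ _ := measure_mono (subset_univ _)

theorem lintegral_exp_lebesgue_le {c : ℝ} (hc : 0 < c) (u : ℝ≥0) :
    ∫⁻ s, (Ici u).indicator (fun s : ℝ≥0 => ENNReal.ofReal (Real.exp (-((s - u) * c)))) s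
      ∂lebesgue ≤ (ENNReal.ofReal c)⁻¹ := by
  let f : ℝ → ℝ≥0∞ := fun s => (ENNReal.ofReal c)⁻¹ * exponentialPDF c (s - u)
  have hf : Measurable f := by
    have := (measurable_exponentialPDFReal c).ennreal_ofReal
    exact ((this.comp (measurable_id.sub_const (u : ℝ)))).const_mul _
  calc _ = ∫⁻ s : ℝ≥0, f s ∂lebesgue := by
        refine lintegral_congr fun s => ?_
        by_cases hs : u ≤ s
        · have hs' : (0 : ℝ) ≤ s - u := sub_nonneg.2 (NNReal.coe_le_coe.2 hs)
          rw [indicator_of_mem (by exact hs)]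
          simp only [f]
          rw [exponentialPDF_of_nonneg hs', ENNReal.ofReal_mul hc.le, ← mul_assoc,
            ENNReal.inv_mul_cancel (by simpa using hc) (by simp), one_mul, mul_comm c]
        · have hs' : (s : ℝ) - u < 0 := sub_neg.2 (NNReal.coe_lt_coe.2 (not_le.1 hs))
          rw [indicator_of_notMem (by exact hs)]
          simp only [f]
          rw [exponentialPDF_of_neg hs', mul_zero]
    _ = ∫⁻ s, f s ∂(lebesgue.map ((↑) : ℝ≥0 → ℝ)) := (lintegral_map hf (by fun_prop)).symm
    _ ≤ ∫⁻ s, f s := by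
        rw [lebesgue, measurableEmbedding_coe.map_comap]
        exact setLIntegral_le_lintegral _ _
    _ = (ENNReal.ofReal c)⁻¹ * ∫⁻ s, exponentialPDF c (s - u) := by
        refine lintegral_const_mul _ ?_
        exact (measurable_exponentialPDFReal c).ennreal_ofReal.comp
          (measurable_id.sub_const (u : ℝ))
    _ = _ := by
        rw [lintegral_sub_right_eq_self (fun s => exponentialPDF c s),
          lintegral_exponentialPDF_eq_one hc, mul_one]

end MassMeasure

section Exponential

variable {Ω : Type*} {mΩ : MeasurableSpace Ω} {P : Measure Ω} {X : Ω → ℝ≥0} {r : ℝ≥0}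

theorem map_apply_eq_expMeasure (hX : Measurable X)
    (h : HasLaw (fun ω => (X ω : ℝ)) (expMeasure r) P) {s : Set ℝ≥0} (hs : MeasurableSet s) :
    P.map X s = expMeasure r (((↑) : ℝ≥0 → ℝ) '' s) := by
  rw [← h.map_eq, Measure.map_apply hX hs, Measure.map_apply (by fun_prop)
    (measurableEmbedding_coe.measurableSet_image.2 hs)]
  congr 1
  ext ω
  simp

theorem expMeasure_apply {s : Set ℝ} (hs : MeasurableSet s) :
    expMeasure r s = ∫⁻ u in s, exponentialPDF r u := by
  rw [expMeasure, gammaMeasure, withDensity_apply _ hs]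
  rfl

theorem map_le_smul_lebesgue (hX : Measurable X)
    (h : HasLaw (fun ω => (X ω : ℝ)) (expMeasure r) P) : P.map X ≤ (r : ℝ≥0∞) • lebesgue := by
  refine Measure.le_iff.2 fun s hs => ?_
  have hs' := measurableEmbedding_coe.measurableSet_image.2 hs
  rw [map_apply_eq_expMeasure hX h hs, Measure.smul_apply, lebesgue,
    measurableEmbedding_coe.comap_apply, expMeasure_apply hs']
  calc ∫⁻ u in ((↑) : ℝ≥0 → ℝ) '' s, exponentialPDF r u
      ≤ ∫⁻ _ in ((↑) : ℝ≥0 → ℝ) '' s, (r : ℝ≥0∞) := by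
        refine setLIntegral_mono' hs' ?_
        rintro _ ⟨u, -, rfl⟩
        rw [exponentialPDF_of_nonneg (NNReal.coe_nonneg u), ← ENNReal.ofReal_coe_nnreal]
        refine ENNReal.ofReal_le_ofReal (mul_le_of_le_one_right r.2 (Real.exp_le_one_iff.2 ?_))
        have : (0 : ℝ) ≤ r * u := by positivity
        linarith
    _ = _ := by rw [setLIntegral_const, smul_eq_mul]

theorem le_map_Ioc (hX : Measurable X) (h : HasLaw (fun ω => (X ω : ℝ)) (expMeasure r) P)
    (hr : r ≤ 1) (s t : ℝ≥0) :
    (r : ℝ≥0∞) * (ENNReal.ofReal (Real.exp (-t)) * ((t - s : ℝ≥0) : ℝ≥0∞)) ≤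
      P.map X (Ioc s t) := by
  have hs' := measurableEmbedding_coe.measurableSet_image.2 (measurableSet_Ioc (a := s) (b := t))
  have hvol : volume (((↑) : ℝ≥0 → ℝ) '' Ioc s t) = ((t - s : ℝ≥0) : ℝ≥0∞) := by
    rw [← measurableEmbedding_coe.comap_apply]
    change lebesgue _ = _
    rw [measure_congr (μ := lebesgue) Ioc_ae_eq_Icc, lebesgue_Icc]
  rw [map_apply_eq_expMeasure hX h measurableSet_Ioc, expMeasure_apply hs', ← hvol, ← mul_assoc,
    ← setLIntegral_const]
  refine setLIntegral_mono' hs' ?_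
  rintro _ ⟨u, hu, rfl⟩
  rw [exponentialPDF_of_nonneg (NNReal.coe_nonneg u), ← ENNReal.ofReal_coe_nnreal,
    ← ENNReal.ofReal_mul (NNReal.coe_nonneg r)]
  refine ENNReal.ofReal_le_ofReal (mul_le_mul_of_nonneg_left (Real.exp_le_exp.2 ?_)
    (NNReal.coe_nonneg r))
  have h1 : (r : ℝ) * u ≤ 1 * t :=
    mul_le_mul (by exact_mod_cast hr) (NNReal.coe_le_coe.2 hu.2) (NNReal.coe_nonneg u) zero_le_one
  linarith

end Exponential

/-! ### Almost sure properties of the mass measure -/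

section Parameter

variable {θ : ℕ → ℝ≥0}

theorem tsum_sq_ne_top (hθ : IsICRTParameter θ) : ∑' i, (θ (i + 1) : ℝ≥0∞) ^ 2 ≠ ∞ := by
  have h : Summable fun i => θ (i + 1) ^ 2 :=
    NNReal.summable_nat_add _ hθ.sum_sq.summable 1
  simpa using ENNReal.tsum_coe_ne_top_iff_summable.2 h

theorem param_le_one (hθ : IsICRTParameter θ) (i : ℕ) : θ i ≤ 1 := by
  have h : θ i ^ 2 ≤ 1 := le_hasSum hθ.sum_sq i fun _ _ => zero_le
  exact (pow_le_one_iff_of_nonneg zero_le two_ne_zero).1 h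

theorem param_pos_of_not_summable (hθ : IsICRTParameter θ)
    (h : ¬ Summable fun i => θ (i + 1)) (i : ℕ) : 0 < θ (i + 1) := by
  rw [pos_iff_ne_zero]
  intro h0
  refine h (summable_of_hasFiniteSupport ((finite_lt_nat i).subset fun j hj => ?_))
  by_contra hij
  refine hj (le_antisymm ?_ bot_le)
  rw [← h0]
  exact hθ.antitone (not_lt.1 hij)

end Parameter

section GoodMass

variable {Ω : Type*} {mΩ : MeasurableSpace Ω} {P : Measure Ω} [IsProbabilityMeasure P]
  {θ : ℕ → ℝ≥0} {X : ℕ → Ω → ℝ≥0}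

theorem ae_massMeasure_Icc_ne_top (hθ : IsICRTParameter θ) (hX : ∀ i, Measurable (X i))
    (hlaw : ∀ i, 0 < θ (i + 1) → HasLaw (fun ω => (X i ω : ℝ)) (expMeasure (θ (i + 1))) P) :
    ∀ᵐ ω ∂P, ∀ l, massMeasure θ (fun i => X i ω) (Icc 0 l) ≠ ∞ := by
  have hnat : ∀ᵐ ω ∂P, ∀ n : ℕ, massMeasure θ (fun i => X i ω) (Icc 0 n) < ∞ := by
    refine ae_all_iff.2 fun n => ?_
    have hXm : Measurable fun ω => fun i => X i ω := measurable_pi_lambda _ hX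
    have hmeas : Measurable fun ω => massMeasure θ (fun i => X i ω) (Icc 0 n) :=
      measurable_massMeasure_Icc.comp (f := fun ω => ((fun i => X i ω), (n : ℝ≥0)))
        (hXm.prodMk measurable_const)
    refine ae_lt_top hmeas (ne_of_lt ?_)
    have hI : ∀ i, Measurable fun ω => (Icc (0 : ℝ≥0) n).indicator (1 : ℝ≥0 → ℝ≥0∞) (X i ω) :=
      fun i => (measurable_one.indicator measurableSet_Icc).comp (hX i)
    have hterm : ∀ i, ∫⁻ ω, (θ (i + 1) : ℝ≥0∞) * (Icc (0 : ℝ≥0) n).indicator 1 (X i ω) ∂P ≤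
        (θ (i + 1) : ℝ≥0∞) ^ 2 * n := by
      intro i
      rw [lintegral_const_mul _ (hI i),
        ← lintegral_map (measurable_one.indicator measurableSet_Icc) (hX i),
        lintegral_indicator_one measurableSet_Icc, sq, mul_assoc]
      rcases eq_or_ne (θ (i + 1)) 0 with h0 | h0
      · simp [h0]
      · gcongr
        refine (map_le_smul_lebesgue (hX i) (hlaw i (pos_iff_ne_zero.2 h0)) _).trans ?_
        rw [Measure.smul_apply, lebesgue_Icc, tsub_zero, smul_eq_mul, ENNReal.coe_natCast]
    have hsum : ∀ ω, massMeasure θ (fun i => X i ω) (Icc 0 n) = (θ 0 : ℝ≥0∞) ^ 2 *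
        lebesgue (Icc 0 n) + ∑' i, (θ (i + 1) : ℝ≥0∞) * (Icc (0 : ℝ≥0) n).indicator 1 (X i ω) :=
      fun ω => massMeasure_apply θ _ measurableSet_Icc
    simp only [hsum]
    rw [lintegral_add_left measurable_const, lintegral_const, measure_univ, mul_one,
      lintegral_tsum fun i => ((hI i).const_mul _).aemeasurable]
    refine ENNReal.add_lt_top.2 ⟨?_, (ENNReal.tsum_le_tsum hterm).trans_lt ?_⟩
    · rw [lebesgue_Icc]
      finiteness
    · rw [ENNReal.tsum_mul_right]
      exact ENNReal.mul_lt_top (tsum_sq_ne_top hθ).lt_top (by simp)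
  filter_upwards [hnat] with ω hω l
  obtain ⟨n, hn⟩ := exists_nat_ge l
  exact ((measure_mono (Icc_subset_Icc_right hn)).trans_lt (hω n)).ne

/-- Every interval is charged: by the Lebesgue part, or by infinitely many atoms, thanks to the
second Borel–Cantelli lemma. -/
theorem ae_massMeasure_Ioc_ne_zero (hθ : IsICRTParameter θ) (hX : ∀ i, Measurable (X i))
    (hind : iIndepFun X P)
    (hlaw : ∀ i, 0 < θ (i + 1) → HasLaw (fun ω => (X i ω : ℝ)) (expMeasure (θ (i + 1))) P) :
    ∀ᵐ ω ∂P, ∀ q q' : ℚ≥0, q < q' →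
      massMeasure θ (fun i => X i ω) (Ioc (q : ℝ≥0) q') ≠ 0 := by
  simp only [ae_all_iff]
  intro q q' hq
  have hlen : (q' : ℝ≥0) - q ≠ 0 := (tsub_pos_of_lt (by exact_mod_cast hq)).ne'
  set s : Set ℝ≥0 := Ioc (q : ℝ≥0) q'
  have hs : MeasurableSet s := measurableSet_Ioc
  rcases hθ.ne_zero_or with h0 | hsum
  · refine Eventually.of_forall fun ω => ?_
    rw [massMeasure_apply θ _ hs, measure_congr (μ := lebesgue) Ioc_ae_eq_Icc, lebesgue_Icc]
    intro h
    rw [add_eq_zero, mul_eq_zero] at h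
    rcases h.1 with h | h
    · exact h0 (by simpa using h)
    · exact hlen (by exact_mod_cast h)
  · have hpos := param_pos_of_not_summable hθ hsum
    have hindset : iIndepSet (fun i => X i ⁻¹' s) P :=
      (iIndepSet_iff_meas_biInter fun i => hX i hs).2 fun S =>
        hind.measure_inter_preimage_eq_mul S fun _ _ => hs
    have htop : ∑' i, P (X i ⁻¹' s) = ∞ := by
      set c : ℝ≥0∞ := ENNReal.ofReal (Real.exp (-((q' : ℝ≥0) : ℝ))) *
        (((q' : ℝ≥0) - q : ℝ≥0) : ℝ≥0∞)
      have hc : c ≠ 0 :=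
        mul_ne_zero (by simpa using Real.exp_pos _) (by exact_mod_cast hlen)
      have h1 : ∑' i, (θ (i + 1) : ℝ≥0∞) = ∞ := by
        by_contra h
        exact hsum (ENNReal.tsum_coe_ne_top_iff_summable.1 h)
      refine top_unique ?_
      calc ∞ = ∑' i, (θ (i + 1) : ℝ≥0∞) * c := by
            rw [ENNReal.tsum_mul_right, h1, ENNReal.top_mul hc]
        _ ≤ _ := ENNReal.tsum_le_tsum fun i => by
            rw [← Measure.map_apply (hX i) hs]
            exact le_map_Ioc (hX i) (hlaw i (hpos i)) (param_le_one hθ _) _ _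
    have hlim := measure_limsup_eq_one (fun i => hX i hs) hindset htop
    have hlimm : MeasurableSet (limsup (fun i => X i ⁻¹' s) atTop) :=
      MeasurableSet.measurableSet_limsup fun i => hX i hs
    have hae : ∀ᵐ ω ∂P, ω ∈ limsup (fun i => X i ⁻¹' s) atTop :=
      (mem_ae_iff_prob_eq_one hlimm).2 hlim
    filter_upwards [hae] with ω hω
    rw [mem_limsup_iff_frequently_mem] at hω
    obtain ⟨i, hi⟩ := hω.exists
    rw [massMeasure_apply θ _ hs]
    refine (lt_of_lt_of_le ?_ le_add_self).ne'
    refine lt_of_lt_of_le ?_ (ENNReal.le_tsum i)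
    rw [indicator_of_mem (by exact hi)]
    simpa using hpos i

theorem massMeasure_univ (hθ : IsICRTParameter θ) (x : ℕ → ℝ≥0) : massMeasure θ x univ = ∞ := by
  rw [massMeasure_apply θ _ MeasurableSet.univ, lebesgue_univ]
  rcases hθ.ne_zero_or with h0 | hsum
  · rw [ENNReal.mul_top (by simpa using h0), top_add]
  · simp only [indicator_univ, Pi.one_apply, mul_one]
    rw [show ∑' i, (θ (i + 1) : ℝ≥0∞) = ∞ by
      by_contra h
      exact hsum (ENNReal.tsum_coe_ne_top_iff_summable.1 h), add_top]

theorem ae_isGoodMass (hθ : IsICRTParameter θ) (hX : ∀ i, Measurable (X i)) (hind : iIndepFun X P)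
    (hlaw : ∀ i, 0 < θ (i + 1) → HasLaw (fun ω => (X i ω : ℝ)) (expMeasure (θ (i + 1))) P) :
    ∀ᵐ ω ∂P, IsGoodMass (massMeasure θ fun i => X i ω) := by
  filter_upwards [ae_massMeasure_Icc_ne_top hθ hX hlaw,
    ae_massMeasure_Ioc_ne_zero hθ hX hind hlaw] with ω h1 h2
  refine ⟨h1, h2, ?_⟩
  have h := tendsto_measure_Iic_atTop (massMeasure θ fun i => X i ω)
  rw [massMeasure_univ hθ] at h
  simpa only [← Icc_bot, NNReal.bot_eq_zero] using h

end GoodMass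

section Close

variable {θ : ℕ → ℝ≥0}

/-- The parameter `θ` deprived of the `(j + 1)`-st atom. -/
def restParam (θ : ℕ → ℝ≥0) (j : ℕ) : ℕ → ℝ≥0 := Function.update θ (j + 1) 0

theorem restParam_zero (j : ℕ) : restParam θ j 0 = θ 0 := by
  simp [restParam, Function.update_of_ne]

theorem restParam_succ (i j : ℕ) : restParam θ j (i + 1) = if i = j then 0 else θ (i + 1) := by
  by_cases h : i = j
  · simp [restParam, h]
  · simp [restParam, Function.update_of_ne, h]

theorem massMeasure_eq_add (j : ℕ) (x : ℕ → ℝ≥0) :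
    massMeasure θ x = massMeasure (restParam θ j) x + (θ (j + 1) : ℝ≥0∞) • Measure.dirac (x j) := by
  ext s hs
  rw [Measure.add_apply, Measure.smul_apply, massMeasure_apply θ x hs,
    massMeasure_apply _ x hs, ENNReal.tsum_eq_add_tsum_ite j, restParam_zero,
    Measure.dirac_apply' _ hs, smul_eq_mul, add_assoc, add_comm (∑' i, _ * _)]
  congr 2
  refine tsum_congr fun i => ?_
  rw [restParam_succ]
  split_ifs <;> simp

theorem massMeasure_restParam_update (j : ℕ) (x : ℕ → ℝ≥0) (u : ℝ≥0) :
    massMeasure (restParam θ j) (Function.update x j u) = massMeasure (restParam θ j) x := by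
  ext s hs
  rw [massMeasure_apply _ _ hs, massMeasure_apply _ _ hs]
  congr 1
  refine tsum_congr fun i => ?_
  rw [restParam_succ]
  by_cases h : i = j
  · simp [h]
  · rw [Function.update_of_ne h]

theorem massMeasure_restParam_le (j : ℕ) (x : ℕ → ℝ≥0) :
    massMeasure (restParam θ j) x ≤ massMeasure θ x := by
  rw [massMeasure_eq_add (θ := θ) j x]
  exact Measure.le_add_right le_rfl

/-- The contribution of the pair `(u, s)`, where `u ≤ s`, to the number of pairs of close points,
when the distribution function of the mass measure at `u` is `F`. -/
noncomputable def decay (F : ℝ≥0∞) (u s : ℝ≥0) : ℝ≥0∞ :=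
  (Ici u).indicator (fun s : ℝ≥0 => F⁻¹ * ENNReal.ofReal (Real.exp (-((s - u) * F.toReal)))) s

theorem measurable_decay : Measurable fun w : ℝ≥0∞ × ℝ≥0 × ℝ≥0 => decay w.1 w.2.1 w.2.2 := by
  have h1 : MeasurableSet {w : ℝ≥0∞ × ℝ≥0 × ℝ≥0 | w.2.1 ≤ w.2.2} :=
    measurableSet_le (by fun_prop) (by fun_prop)
  have h2 : Measurable fun w : ℝ≥0∞ × ℝ≥0 × ℝ≥0 =>
      w.1⁻¹ * ENNReal.ofReal (Real.exp (-((w.2.2 - w.2.1) * w.1.toReal))) := by fun_prop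
  exact h2.indicator h1

theorem decay_le_of_le {F G : ℝ≥0∞} (hG : G ≠ ∞) (h : F ≤ G) (u s : ℝ≥0) :
    decay G u s ≤ decay F u s := by
  by_cases hs : u ≤ s
  · simp only [decay, indicator_of_mem (mem_Ici.2 hs)]
    have h1 : F.toReal ≤ G.toReal := ENNReal.toReal_mono hG h
    have h2 : (0 : ℝ) ≤ s - u := sub_nonneg.2 (NNReal.coe_le_coe.2 hs)
    gcongr
  · simp [decay, hs]

theorem decay_self (F : ℝ≥0∞) (u : ℝ≥0) : decay F u u = F⁻¹ := by simp [decay]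

theorem lintegral_decay_le {F : ℝ≥0∞} (h0 : F ≠ 0) (h : F ≠ ∞) (u : ℝ≥0) :
    ∫⁻ s, decay F u s ∂lebesgue ≤ F⁻¹ ^ 2 := by
  have hm : Measurable fun s : ℝ≥0 => (Ici u).indicator
      (fun s : ℝ≥0 => ENNReal.ofReal (Real.exp (-((s - u) * F.toReal)))) s :=
    Measurable.indicator (by fun_prop) measurableSet_Ici
  have := lintegral_exp_lebesgue_le (ENNReal.toReal_pos h0 h) u
  rw [ENNReal.ofReal_toReal h] at this
  calc _ = ∫⁻ s, F⁻¹ * (Ici u).indicator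
        (fun s : ℝ≥0 => ENNReal.ofReal (Real.exp (-((s - u) * F.toReal)))) s ∂lebesgue := by
        refine lintegral_congr fun s => ?_
        by_cases hs : u ≤ s <;> simp [decay, hs]
    _ ≤ _ := by
        rw [lintegral_const_mul _ hm, sq]
        gcongr

/-- The number of pairs made of the `(j + 1)`-st atom, placed at `s`, and of a close point of the
rest of the mass. It does not involve the coordinate `x j`. -/
noncomputable def closeTo (θ : ℕ → ℝ≥0) (j : ℕ) (x : ℕ → ℝ≥0) (s : ℝ≥0) : ℝ≥0∞ :=
  ∫⁻ u, {u | 1 ≤ massMeasure (restParam θ j) x (Icc 0 u)}.indicator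
    (fun u => decay (massMeasure (restParam θ j) x (Icc 0 u)) u s) u
    ∂massMeasure (restParam θ j) x

theorem measurable_decay_massMeasure :
    Measurable fun w : ((ℕ → ℝ≥0) × ℝ≥0) × ℝ≥0 =>
      {w : ((ℕ → ℝ≥0) × ℝ≥0) × ℝ≥0 | 1 ≤ massMeasure θ w.1.1 (Icc 0 w.2)}.indicator
        (fun w => decay (massMeasure θ w.1.1 (Icc 0 w.2)) w.2 w.1.2) w := by
  have hF : Measurable fun w : ((ℕ → ℝ≥0) × ℝ≥0) × ℝ≥0 => massMeasure θ w.1.1 (Icc 0 w.2) :=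
    measurable_massMeasure_Icc.comp (f := fun w : ((ℕ → ℝ≥0) × ℝ≥0) × ℝ≥0 => (w.1.1, w.2))
      (by fun_prop)
  refine Measurable.indicator ?_ (measurableSet_le measurable_const hF)
  exact measurable_decay.comp (hF.prodMk (by fun_prop : Measurable
    fun w : ((ℕ → ℝ≥0) × ℝ≥0) × ℝ≥0 => (w.2, w.1.2)))

theorem measurable_closeTo (j : ℕ) :
    Measurable fun w : (ℕ → ℝ≥0) × ℝ≥0 => closeTo θ j w.1 w.2 :=
  measurable_lintegral_massMeasure (θ := restParam θ j)
    (measurable_decay_massMeasure (θ := restParam θ j)) (x := fun w => w.1) measurable_fst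

theorem closeTo_update (j : ℕ) (x : ℕ → ℝ≥0) (u s : ℝ≥0) :
    closeTo θ j (Function.update x j u) s = closeTo θ j x s := by
  simp only [closeTo, massMeasure_restParam_update]

theorem lintegral_closeTo_le (j : ℕ) (x : ℕ → ℝ≥0) (h : IsLocallyFiniteMeasure (massMeasure θ x)) :
    ∫⁻ s, closeTo θ j x s ∂lebesgue ≤ 4 := by
  set μ := massMeasure (restParam θ j) x
  have : IsLocallyFiniteMeasure μ := Measure.isLocallyFiniteMeasure_of_le
    (massMeasure_restParam_le j x)
  have hm := (measurable_decay_massMeasure (θ := restParam θ j)).comp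
    (f := fun w : ℝ≥0 × ℝ≥0 => ((x, w.1), w.2)) (by fun_prop)
  unfold closeTo
  rw [lintegral_lintegral_swap (f := fun s u => {u | 1 ≤ μ (Icc 0 u)}.indicator
    (fun u => decay (μ (Icc 0 u)) u s) u) hm.aemeasurable]
  refine (lintegral_mono fun u => ?_).trans (lintegral_inv_sq_le μ)
  by_cases hu : 1 ≤ μ (Icc 0 u)
  · have hu' : u ∈ {u | 1 ≤ μ (Icc 0 u)} := hu
    simp only [indicator_of_mem hu']
    exact lintegral_decay_le (one_pos.trans_le hu).ne' isCompact_Icc.measure_lt_top.ne u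
  · have hu' : u ∉ {u | 1 ≤ μ (Icc 0 u)} := hu
    simp only [indicator_of_notMem hu', lintegral_zero, le_refl]

/-- The pairs of close points are controlled by those whose second point is an atom, and a term for
the Lebesgue part. Removing one atom changes the distribution function by at most one, hence the
conditions `2 ≤ F` and `1 ≤ F` before and after the removal. -/
theorem lintegral_close_le (hθ : ∀ i, θ i ≤ 1) (x : ℕ → ℝ≥0) (hx : IsGoodMass (massMeasure θ x)) :
    ∫⁻ u, ∫⁻ s, {w : ℝ≥0 × ℝ≥0 | 2 ≤ massMeasure θ x (Icc 0 w.1) ∧ w.1 ≤ w.2}.indicator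
      (fun w => (massMeasure θ x (Icc 0 w.1))⁻¹ *
        ENNReal.ofReal (Real.exp (-((w.2 - w.1) * (massMeasure θ x).real (Icc 0 w.1))))) (u, s)
      ∂massMeasure θ x ∂massMeasure θ x ≤
    (θ 0 : ℝ≥0∞) ^ 2 * 4 +
      ∑' j, (θ (j + 1) : ℝ≥0∞) * ((θ (j + 1) : ℝ≥0∞) + closeTo θ j x (x j)) := by
  have := hx.isLocallyFiniteMeasure
  set μ := massMeasure θ x with hμ
  have hF := measurable_measure_Icc μ
  set F : ℝ≥0 → ℝ≥0∞ := fun u => μ (Icc 0 u) with hFdef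
  have hFtop : ∀ u, F u ≠ ∞ := hx.ne_top
  let B : Set ℝ≥0 := {u | 2 ≤ F u}
  have hB : MeasurableSet B := measurableSet_le measurable_const hF
  have hdec : ∀ s, Measurable fun u => decay (F u) u s := fun s =>
    measurable_decay.comp (hF.prodMk (measurable_id.prodMk measurable_const))
  have hdec' : ∀ u, Measurable fun s => decay (F u) u s := fun u =>
    measurable_decay.comp (measurable_const.prodMk (measurable_const.prodMk measurable_id))
  have hinner : ∀ u, ∫⁻ s, {w : ℝ≥0 × ℝ≥0 | 2 ≤ F w.1 ∧ w.1 ≤ w.2}.indicator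
      (fun w => (F w.1)⁻¹ * ENNReal.ofReal (Real.exp (-((w.2 - w.1) * μ.real (Icc 0 w.1)))))
        (u, s) ∂μ ≤ (θ 0 : ℝ≥0∞) ^ 2 * {u | 1 ≤ F u}.indicator (fun u => (F u)⁻¹ ^ 2) u +
      ∑' j, (θ (j + 1) : ℝ≥0∞) * B.indicator (fun u => decay (F u) u (x j)) u := by
    intro u
    by_cases hu : 2 ≤ F u
    · have h1 : ∀ s, {w : ℝ≥0 × ℝ≥0 | 2 ≤ F w.1 ∧ w.1 ≤ w.2}.indicator
          (fun w => (F w.1)⁻¹ * ENNReal.ofReal (Real.exp (-((w.2 - w.1) * μ.real (Icc 0 w.1)))))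
            (u, s) = decay (F u) u s := fun s => by
        by_cases hs : u ≤ s
        · have hmem : (u, s) ∈ {w : ℝ≥0 × ℝ≥0 | 2 ≤ F w.1 ∧ w.1 ≤ w.2} := ⟨hu, hs⟩
          rw [indicator_of_mem hmem, decay, indicator_of_mem (mem_Ici.2 hs)]
          rfl
        · have hmem : (u, s) ∉ {w : ℝ≥0 × ℝ≥0 | 2 ≤ F w.1 ∧ w.1 ≤ w.2} := fun h => hs h.2
          rw [indicator_of_notMem hmem, decay, indicator_of_notMem (by simpa using hs)]
      have huB : u ∈ B := hu
      have hu1 : u ∈ {u | 1 ≤ F u} := le_trans (by norm_num : (1 : ℝ≥0∞) ≤ 2) hu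
      simp only [h1, indicator_of_mem huB, indicator_of_mem hu1]
      rw [hμ, lintegral_massMeasure θ x (hdec' u)]
      gcongr
      exact lintegral_decay_le (one_pos.trans_le hu1).ne' (hFtop u) u
    · have h1 : ∀ s, (u, s) ∉ {w : ℝ≥0 × ℝ≥0 | 2 ≤ F w.1 ∧ w.1 ≤ w.2} := fun s h => hu h.1
      simp only [indicator_of_notMem (h1 _), lintegral_zero]
      exact zero_le
  refine (lintegral_mono hinner).trans ?_
  have hinv : Measurable fun u => {u | 1 ≤ F u}.indicator (fun u => (F u)⁻¹ ^ 2) u :=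
    Measurable.indicator (hF.inv.pow_const 2) (measurableSet_le measurable_const hF)
  rw [lintegral_add_left (hinv.const_mul _), lintegral_const_mul _ hinv,
    lintegral_tsum fun j => (((hdec (x j)).indicator hB).const_mul _).aemeasurable]
  refine add_le_add (mul_le_mul_right (lintegral_inv_sq_le μ) _)
    (ENNReal.tsum_le_tsum fun j => ?_)
  rw [lintegral_const_mul _ ((hdec (x j)).indicator hB)]
  gcongr
  have hdecomp := massMeasure_eq_add (θ := θ) j x
  rw [← hμ] at hdecomp
  set μ' := massMeasure (restParam θ j) x with hμ'
  rw [hdecomp, lintegral_add_measure, lintegral_smul_measure,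
    lintegral_dirac' _ ((hdec (x j)).indicator hB), add_comm]
  gcongr
  · rw [smul_eq_mul]
    refine mul_le_of_le_one_right' ?_
    by_cases h : x j ∈ B
    · rw [indicator_of_mem h, decay_self, ENNReal.inv_le_one]
      exact le_trans (by norm_num : (1 : ℝ≥0∞) ≤ 2) h
    · rw [indicator_of_notMem h]
      exact zero_le
  · refine lintegral_mono fun u => ?_
    by_cases h : u ∈ B
    · have hle : μ' (Icc 0 u) ≤ F u := massMeasure_restParam_le j x _
      have hge : F u ≤ μ' (Icc 0 u) + 1 := by
        rw [hFdef, hdecomp]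
        simp only [Measure.add_apply, Measure.smul_apply, smul_eq_mul]
        gcongr
        exact mul_le_one' (by exact_mod_cast hθ _) prob_le_one
      have h1 : u ∈ {u | 1 ≤ μ' (Icc 0 u)} := by
        have h2 : (1 : ℝ≥0∞) + 1 ≤ μ' (Icc 0 u) + 1 := by
          rw [one_add_one_eq_two]; exact le_trans h hge
        exact (ENNReal.add_le_add_iff_right (by simp)).1 h2
      rw [indicator_of_mem h, indicator_of_mem h1]
      exact decay_le_of_le (hFtop u) hle _ _
    · rw [indicator_of_notMem h]
      exact zero_le

end Close

section Independence

variable {Ω : Type*} {mΩ : MeasurableSpace Ω} {P : Measure Ω} {θ : ℕ → ℝ≥0} {X : ℕ → Ω → ℝ≥0}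

theorem indepFun_update (hX : ∀ i, Measurable (X i)) (hind : iIndepFun X P) (j : ℕ) :
    IndepFun (fun ω => Function.update (fun i => X i ω) j 0) (X j) P := by
  have h := indep_iSup_of_disjoint (fun i => (hX i).comap_le) hind.iIndep
    (S := {j}ᶜ) (T := {j}) disjoint_compl_left
  rw [IndepFun_iff_Indep]
  refine indep_of_indep_of_le_left (indep_of_indep_of_le_right h ?_) ?_
  · simp
  · rw [← measurable_iff_comap_le]
    refine @measurable_pi_lambda _ _ _ (_) _ _ fun i => ?_
    by_cases hi : i = j
    · subst hi
      simp only [Function.update_self]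
      exact measurable_const
    · simp only [Function.update_of_ne hi]
      refine Measurable.mono (comap_measurable (X i)) ?_ le_rfl
      exact le_iSup₂_of_le i hi le_rfl

/-- The mass measure has almost surely few pairs of close points. The atom at `X j` is independent
of the rest of the mass and its law has density at most `θ (j + 1)`, so the expected contribution of
the pairs containing it is of order `θ (j + 1) ^ 2`. -/
theorem ae_lintegral_close_ne_top [IsProbabilityMeasure P] (hθ : IsICRTParameter θ)
    (hX : ∀ i, Measurable (X i)) (hind : iIndepFun X P)
    (hlaw : ∀ i, 0 < θ (i + 1) → HasLaw (fun ω => (X i ω : ℝ)) (expMeasure (θ (i + 1))) P) :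
    ∀ᵐ ω ∂P, ∫⁻ u, ∫⁻ s, {w : ℝ≥0 × ℝ≥0 |
      2 ≤ massMeasure θ (fun i => X i ω) (Icc 0 w.1) ∧ w.1 ≤ w.2}.indicator
      (fun w => (massMeasure θ (fun i => X i ω) (Icc 0 w.1))⁻¹ * ENNReal.ofReal
        (Real.exp (-((w.2 - w.1) * (massMeasure θ fun i => X i ω).real (Icc 0 w.1))))) (u, s)
      ∂(massMeasure θ fun i => X i ω) ∂(massMeasure θ fun i => X i ω) ≠ ∞ := by
  have hgood := ae_isGoodMass hθ hX hind hlaw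
  have hXm : Measurable fun ω => fun i => X i ω := measurable_pi_lambda _ hX
  have hcm : ∀ j, Measurable fun ω => closeTo θ j (fun i => X i ω) (X j ω) := fun j =>
    (measurable_closeTo j).comp (f := fun ω => ((fun i => X i ω), X j ω)) (hXm.prodMk (hX j))
  have hclose : ∀ j, 0 < θ (j + 1) →
      ∫⁻ ω, closeTo θ j (fun i => X i ω) (X j ω) ∂P ≤ θ (j + 1) * 4 := by
    intro j hj
    set U : Ω → ℕ → ℝ≥0 := fun ω => Function.update (fun i => X i ω) j 0 with hU
    have hUm : Measurable U := measurable_pi_lambda _ fun i => by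
      by_cases hi : i = j
      · subst hi; simp only [hU, Function.update_self]; exact measurable_const
      · simp only [hU, Function.update_of_ne hi]; exact hX i
    have hmap := (indepFun_iff_map_prod_eq_prod_map_map hUm.aemeasurable (hX j).aemeasurable).1
      (indepFun_update hX hind j)
    calc ∫⁻ ω, closeTo θ j (fun i => X i ω) (X j ω) ∂P
        = ∫⁻ ω, closeTo θ j (U ω) (X j ω) ∂P := by simp only [hU, closeTo_update]
      _ = ∫⁻ w, closeTo θ j w.1 w.2 ∂(P.map fun ω => (U ω, X j ω)) :=
          (lintegral_map (measurable_closeTo j) (hUm.prodMk (hX j))).symm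
      _ = ∫⁻ x, ∫⁻ s, closeTo θ j x s ∂P.map (X j) ∂P.map U := by
          rw [hmap, lintegral_prod _ (measurable_closeTo j).aemeasurable]
      _ = ∫⁻ ω, ∫⁻ s, closeTo θ j (U ω) s ∂P.map (X j) ∂P :=
          lintegral_map (measurable_closeTo j).lintegral_prod_right' hUm
      _ ≤ ∫⁻ _, (θ (j + 1) : ℝ≥0∞) * 4 ∂P := by
          refine lintegral_mono_ae ?_
          filter_upwards [hgood] with ω hω
          simp only [hU, closeTo_update]
          refine (lintegral_mono' (map_le_smul_lebesgue (hX j) (hlaw j hj)) le_rfl).trans ?_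
          rw [lintegral_smul_measure, smul_eq_mul]
          gcongr
          exact lintegral_closeTo_le j _ hω.isLocallyFiniteMeasure
      _ = _ := by simp
  have hfin : ∫⁻ ω, ((θ 0 : ℝ≥0∞) ^ 2 * 4 + ∑' j, (θ (j + 1) : ℝ≥0∞) *
      ((θ (j + 1) : ℝ≥0∞) + closeTo θ j (fun i => X i ω) (X j ω))) ∂P ≠ ∞ := by
    rw [lintegral_add_left measurable_const, lintegral_const, measure_univ, mul_one,
      lintegral_tsum fun j => (((hcm j).const_add _).const_mul _).aemeasurable]
    refine ENNReal.add_ne_top.2 ⟨by finiteness, ?_⟩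
    have hterm : ∀ j, ∫⁻ ω, (θ (j + 1) : ℝ≥0∞) * ((θ (j + 1) : ℝ≥0∞) +
        closeTo θ j (fun i => X i ω) (X j ω)) ∂P ≤ (θ (j + 1) : ℝ≥0∞) ^ 2 * 5 := by
      intro j
      rcases eq_or_ne (θ (j + 1)) 0 with h0 | h0
      · simp [h0]
      · rw [lintegral_const_mul _ ((hcm j).const_add _), lintegral_add_left measurable_const,
          lintegral_const, measure_univ, mul_one]
        calc _ ≤ (θ (j + 1) : ℝ≥0∞) * ((θ (j + 1) : ℝ≥0∞) + θ (j + 1) * 4) := by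
              gcongr
              exact hclose j (pos_iff_ne_zero.2 h0)
          _ = (θ (j + 1) : ℝ≥0∞) ^ 2 * (1 + 4) := by ring
          _ = _ := by norm_num
    refine ((ENNReal.tsum_le_tsum hterm).trans_lt ?_).ne
    rw [ENNReal.tsum_mul_right]
    exact ENNReal.mul_lt_top (tsum_sq_ne_top hθ).lt_top (by simp)
  have hm : Measurable fun ω => (θ 0 : ℝ≥0∞) ^ 2 * 4 + ∑' j, (θ (j + 1) : ℝ≥0∞) *
      ((θ (j + 1) : ℝ≥0∞) + closeTo θ j (fun i => X i ω) (X j ω)) :=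
    (Measurable.tsum fun j => ((hcm j).const_add _).const_mul _).const_add _
  filter_upwards [hgood, ae_lt_top hm hfin] with ω hω hlt
  exact ((lintegral_close_le (param_le_one hθ) _ hω).trans_lt hlt).ne

end Independence

/-! ### Conditional laws -/

section CondDistrib

variable {Ω β E : Type*} {mΩ : MeasurableSpace Ω} [MeasurableSpace β] [MeasurableSpace E]
  [StandardBorelSpace E] [Nonempty E] {P : Measure Ω} [IsFiniteMeasure P]

/-- A measurable condition on a pair holds almost surely if and only if it holds almost surely under
the conditional law of the second variable. -/
theorem ae_iff_ae_condDistrib {M : Ω → β} {Y : Ω → E} (hM : Measurable M) (hY : Measurable Y)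
    {S : Set (β × E)} (hS : MeasurableSet S) :
    (∀ᵐ ω ∂P, (M ω, Y ω) ∈ S) ↔ ∀ᵐ ω ∂P, ∀ᵐ y ∂condDistrib Y M P (M ω), (M ω, y) ∈ S := by
  rw [← ae_map_iff (p := fun w => w ∈ S) (hM.prodMk hY).aemeasurable hS,
    ← compProd_map_condDistrib hY.aemeasurable,
    Measure.ae_compProd_iff (p := fun w => w ∈ S) hS,
    ae_map_iff (p := fun m => ∀ᵐ y ∂condDistrib Y M P m, (m, y) ∈ S) hM.aemeasurable]
  exact measurableSet_eq_fun (Kernel.measurable_kernel_prodMk_left hS.compl) measurable_const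

end CondDistrib

section Cumul

/-- A jointly measurable version of `(μ, y) ↦ μ ([0, y] ∩ s)`, on the space of all measures: the
infimum over rational truncation levels agrees with it when `μ` is finite on bounded intervals. -/
noncomputable def cumul (s : Set ℝ≥0) (w : Measure ℝ≥0 × ℝ≥0) : ℝ≥0∞ :=
  ⨅ q : ℚ≥0, if w.2 < (q : ℝ≥0) then w.1 (Icc 0 (q : ℝ≥0) ∩ s) else ∞

theorem measurable_cumul {s : Set ℝ≥0} (hs : MeasurableSet s) : Measurable (cumul s) := by
  refine Measurable.iInf fun q => Measurable.ite (measurableSet_lt measurable_snd measurable_const)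
    ((Measure.measurable_coe (measurableSet_Icc.inter hs)).comp measurable_fst) measurable_const

theorem cumul_eq {μ : Measure ℝ≥0} (hμ : ∀ l, μ (Icc 0 l) ≠ ∞) {s : Set ℝ≥0}
    (hs : MeasurableSet s) (y : ℝ≥0) : cumul s (μ, y) = μ (Icc 0 y ∩ s) := by
  refine le_antisymm ?_ (le_iInf fun q => ?_)
  · have h := tendsto_measure_biInter_gt (μ := μ) (s := fun r : ℝ≥0 => Icc 0 r ∩ s) (a := y)
      (fun r _ => (measurableSet_Icc.inter hs).nullMeasurableSet)
      (fun i j _ hij => inter_subset_inter_left _ (Icc_subset_Icc_right hij))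
      ⟨y + 1, by simp, ((measure_mono inter_subset_left).trans_lt (hμ _).lt_top).ne⟩
    have hI : ⋂ r > y, Icc 0 r ∩ s = Icc 0 y ∩ s := by
      ext u
      simp only [mem_iInter, mem_inter_iff, mem_Icc, zero_le, true_and]
      refine ⟨fun h => ⟨le_of_forall_gt_imp_ge_of_dense fun r hr => (h r hr).1,
        (h (y + 1) (by simp)).2⟩, fun h r hr => ⟨h.1.trans hr.le, h.2⟩⟩
    rw [hI] at h
    refine le_of_forall_gt_imp_ge_of_dense fun c hc => ?_
    obtain ⟨r, hr, hyr⟩ := ((h.eventually_lt_const hc).and self_mem_nhdsWithin).exists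
    obtain ⟨q, hyq, hqr⟩ := exists_nnrat_btwn hyr
    refine (iInf_le _ q).trans ?_
    rw [if_pos hyq]
    exact (measure_mono (inter_subset_inter_left _ (Icc_subset_Icc_right hqr.le))).trans hr.le
  · split_ifs with h
    · exact measure_mono (inter_subset_inter_left _ (Icc_subset_Icc_right h.le))
    · exact le_top

theorem IsGoodMass.cumul_univ {μ : Measure ℝ≥0} (hμ : IsGoodMass μ) (y : ℝ≥0) :
    cumul univ (μ, y) = μ (Icc 0 y) := by
  rw [cumul_eq hμ.ne_top MeasurableSet.univ, inter_univ]

end Cumul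

section Poisson

theorem measurableSet_encard_eq {B : Set ℝ≥0} (hB : MeasurableSet B) (n : ℕ) :
    MeasurableSet {y : ℕ → ℝ≥0 | {i | y i ∈ B}.encard = n} := by
  have h : {y : ℕ → ℝ≥0 | {i | y i ∈ B}.encard = n} =
      ⋃ s : Finset ℕ, ⋃ _ : s.card = n, {y | ∀ i, y i ∈ B ↔ i ∈ s} := by
    ext y
    simp only [mem_ofPred_eq, mem_iUnion, exists_prop]
    constructor
    · intro h
      have hf := finite_of_encard_eq_coe h
      refine ⟨hf.toFinset, ?_, by simp⟩
      rw [hf.encard_eq_coe_toFinset_card] at h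
      exact_mod_cast h
    · rintro ⟨s, hs, h⟩
      rw [show {i | y i ∈ B} = (s : Set ℕ) by ext i; simp [h i], encard_coe_eq_coe_finsetCard, hs]
  rw [h]
  refine MeasurableSet.iUnion fun s => MeasurableSet.iUnion fun _ => ?_
  rw [ofPred_forall]
  refine MeasurableSet.iInter fun i => ?_
  have hi : Measurable fun y : ℕ → ℝ≥0 => y i := measurable_pi_apply i
  by_cases his : i ∈ s
  · simp only [his, iff_true]
    exact hi hB
  · simp only [his, iff_false]
    exact hi hB.compl

/-- If the number of terms of a random sequence in `B` has a Poisson law, it is finite. -/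
theorem ae_finite_of_poisson {ρ : Measure (ℕ → ℝ≥0)} [IsProbabilityMeasure ρ] {B : Set ℝ≥0}
    (hB : MeasurableSet B) {r : ℝ≥0}
    (h : ∀ n : ℕ, ρ.real {y | {i | y i ∈ B}.encard = n} = (poissonMeasure r).real {n}) :
    ∀ᵐ y ∂ρ, {i | y i ∈ B}.Finite := by
  have hU : ρ (⋃ n : ℕ, {y | {i | y i ∈ B}.encard = n}) = 1 := by
    rw [measure_iUnion (fun m n hmn => disjoint_left.2 fun y hm hn => hmn ?_)
      (measurableSet_encard_eq hB)]
    · calc ∑' n : ℕ, ρ {y | {i | y i ∈ B}.encard = n} = ∑' n : ℕ, poissonMeasure r {n} :=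
            tsum_congr fun n => (measureReal_eq_measureReal_iff).1 (h n)
        _ = poissonMeasure r (⋃ n, {n}) := by
            rw [measure_iUnion (fun m n hmn => by simpa using hmn) fun n => .singleton n]
        _ = 1 := by rw [iUnion_of_singleton, measure_univ]
    · have := Eq.trans (Eq.symm hm) hn
      exact_mod_cast this
  filter_upwards [(mem_ae_iff_prob_eq_one (MeasurableSet.iUnion (measurableSet_encard_eq hB))).2 hU]
    with y hy
  obtain ⟨n, hn⟩ := mem_iUnion.1 hy
  exact finite_of_encard_eq_coe hn

theorem rate_Ico_eq_Ioo (μ : Measure ℝ≥0) (s t : ℝ≥0) : rate μ (Ico s t) = rate μ (Ioo s t) :=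
  measure_congr Ioo_ae_eq_Ico.symm

/-- The avoidance probabilities of all the intervals are controlled by those of the intervals with
rational endpoints. -/
theorem void_le_voidProb {μ : Measure ℝ≥0} (hμ : IsGoodMass μ) {ρ : Measure (ℕ → ℝ≥0)}
    [IsProbabilityMeasure ρ] (h : ∀ q q' : ℚ≥0, ρ.real {y | ∀ i, y i ∉ Ico (q : ℝ≥0) q'} =
      Real.exp (-(rate μ (Ico (q : ℝ≥0) q')).toReal)) (s t : ℝ≥0) :
    ρ {y | ∀ i, y i ∉ Ico s t} ≤ voidProb (rate μ) s t := by
  have := hμ.isLocallyFiniteMeasure_rate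
  set v := ρ.real {y | ∀ i, y i ∉ Ico s t} with hv
  rcases (measureReal_nonneg : 0 ≤ v).eq_or_lt with h0 | h0
  · have : ρ {y | ∀ i, y i ∉ Ico s t} = 0 := by
      rw [← measureReal_eq_zero_iff, ← hv, h0]
    rw [this]
    exact zero_le
  · have hc : 0 ≤ -Real.log v := neg_nonneg.2 (Real.log_nonpos h0.le measureReal_le_one)
    have hle : rate μ (Ioo s t) ≤ ENNReal.ofReal (-Real.log v) := by
      refine measure_le_of_forall_Icc_le measurableSet_Ioo fun x hx z hz hxz => ?_
      obtain ⟨q, hsq, hqx⟩ := exists_nnrat_btwn hx.1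
      obtain ⟨q', hzq', hqt⟩ := exists_nnrat_btwn hz.2
      refine (measure_mono (show Icc x z ⊆ Ico (q : ℝ≥0) q' from
        fun u hu => ⟨hqx.le.trans hu.1, hu.2.trans_lt hzq'⟩)).trans ?_
      rw [ENNReal.le_ofReal_iff_toReal_le (hμ.rate_Ico_ne_top _ _) hc, le_neg,
        Real.log_le_iff_le_exp h0, ← h]
      exact measureReal_mono fun y hy i hi => hy i ⟨hsq.le.trans hi.1, hi.2.trans hqt⟩
    rw [voidProb, ← ofReal_measureReal, rate_Ico_eq_Ioo]
    refine ENNReal.ofReal_le_ofReal ?_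
    rw [← hv, ← Real.log_le_iff_le_exp h0, le_neg]
    exact ENNReal.toReal_le_of_le_ofReal hc hle

end Poisson

section Cuts

theorem measurable_sum_length : Measurable fun w : Measure ℝ≥0 × (ℕ → ℝ≥0) =>
    ∑' k, ((((cumul univ (w.1, w.2 (k + 1)) - cumul univ (w.1, w.2 k)) /
      cumul univ (w.1, w.2 (k + 1))).toNNReal : ℝ≥0) : ℝ≥0∞) *
        ((w.2 (k + 1) - w.2 k : ℝ≥0) : ℝ≥0∞) := by
  have hF : ∀ k, Measurable fun w : Measure ℝ≥0 × (ℕ → ℝ≥0) => cumul univ (w.1, w.2 k) := fun k =>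
    (measurable_cumul MeasurableSet.univ).comp
      (f := fun w : Measure ℝ≥0 × (ℕ → ℝ≥0) => (w.1, w.2 k)) (by fun_prop)
  refine Measurable.tsum fun k => ?_
  exact (((hF (k + 1)).sub (hF k)).div (hF (k + 1))).ennreal_toNNReal.coe_nnreal_ennreal.mul
    (by fun_prop)

theorem measurable_sum_sq : Measurable fun w : Measure ℝ≥0 × (ℕ → ℝ≥0) =>
    ∑' k, cumul univ (w.1, w.2 k) * ((((cumul univ (w.1, w.2 (k + 1)) - cumul univ (w.1, w.2 k)) /
      cumul univ (w.1, w.2 (k + 1))).toNNReal : ℝ≥0) : ℝ≥0∞) ^ 2 := by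
  have hF : ∀ k, Measurable fun w : Measure ℝ≥0 × (ℕ → ℝ≥0) => cumul univ (w.1, w.2 k) := fun k =>
    (measurable_cumul MeasurableSet.univ).comp
      (f := fun w : Measure ℝ≥0 × (ℕ → ℝ≥0) => (w.1, w.2 k)) (by fun_prop)
  refine Measurable.tsum fun k => ?_
  exact (hF k).mul ((((hF (k + 1)).sub (hF k)).div
    (hF (k + 1))).ennreal_toNNReal.coe_nnreal_ennreal.pow_const 2)

theorem weight_eq_cumul {μ : Measure ℝ≥0} (hμ : IsGoodMass μ) {y : ℕ → ℝ≥0} (hy : Monotone y)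
    (k : ℕ) : weight μ y k = ((cumul univ (μ, y (k + 1)) - cumul univ (μ, y k)) /
      cumul univ (μ, y (k + 1))).toNNReal := by
  rw [hμ.cumul_univ, hμ.cumul_univ, weight, measure_Icc_succ hy,
    ENNReal.add_sub_cancel_left (hμ.ne_top _)]

variable {Ω : Type*} {mΩ : MeasurableSpace Ω} {P : Measure Ω} [IsProbabilityMeasure P]
  {M : Ω → Measure ℝ≥0} {Y : ℕ → Ω → ℝ≥0}

/-- The numbers of cuts in a given set have Poisson laws under the conditional law of the cuts. -/
theorem condDistrib_encard (hM : Measurable M) (hY : ∀ i, Measurable (Y i))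
    (h : IsCondPoissonProcess P (MeasurableSpace.comap M inferInstance) (fun ω => rate (M ω)) Y)
    {B : Set ℝ≥0} (hB : MeasurableSet B) (hb : Bornology.IsBounded B) (n : ℕ) :
    ∀ᵐ ω ∂P, (condDistrib (fun ω i => Y i ω) M P (M ω)).real {y | {i | y i ∈ B}.encard = n} =
      (poissonMeasure (rate (M ω) B).toNNReal).real {n} := by
  have h1 := h 1 (fun _ => B) (fun _ => n) (fun _ => hB) (fun _ => hb)
    (fun i j hij => absurd (Subsingleton.elim i j) hij)
  have h2 := condDistrib_ae_eq_condExp (μ := P) hM (measurable_pi_lambda (fun ω i => Y i ω) hY)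
    (measurableSet_encard_eq hB n)
  filter_upwards [h1, h2] with ω h1 h2
  rw [h2]
  simpa using h1

/-- The conditional probability that the cuts avoid a given set. -/
theorem condDistrib_void (hM : Measurable M) (hY : ∀ i, Measurable (Y i))
    (h : IsCondPoissonProcess P (MeasurableSpace.comap M inferInstance) (fun ω => rate (M ω)) Y)
    {B : Set ℝ≥0} (hB : MeasurableSet B) (hb : Bornology.IsBounded B) :
    ∀ᵐ ω ∂P, (condDistrib (fun ω i => Y i ω) M P (M ω)).real {y | ∀ i, y i ∉ B} =
      Real.exp (-(rate (M ω) B).toReal) := by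
  filter_upwards [condDistrib_encard hM hY h hB hb 0] with ω h0
  rw [poissonMeasure_real_singleton] at h0
  have hset : {y : ℕ → ℝ≥0 | ∀ i, y i ∉ B} = {y | {i | y i ∈ B}.encard = (0 : ℕ)} := by
    ext y
    simp [eq_empty_iff_forall_notMem]
  rw [hset, h0]
  simp [ENNReal.toReal]

/-- The cuts have almost surely the properties needed for the convergence of the masses. -/
theorem ae_isGoodCut (hM : Measurable M) (hY : ∀ i, Measurable (Y i))
    (h : IsCondPoissonProcess P (MeasurableSpace.comap M inferInstance) (fun ω => rate (M ω)) Y)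
    (hmono : ∀ᵐ ω ∂P, StrictMono fun i => Y i ω) (hgood : ∀ᵐ ω ∂P, IsGoodMass (M ω))
    (hclose : ∀ᵐ ω ∂P, ∫⁻ x, ∫⁻ x', {w : ℝ≥0 × ℝ≥0 | 2 ≤ M ω (Icc 0 w.1) ∧ w.1 ≤ w.2}.indicator
      (fun w => (M ω (Icc 0 w.1))⁻¹ * ENNReal.ofReal
        (Real.exp (-((w.2 - w.1) * (M ω).real (Icc 0 w.1))))) (x, x') ∂M ω ∂M ω ≠ ∞) :
    ∀ᵐ ω ∂P, IsGoodCut (M ω) fun i => Y i ω := by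
  have hYm : Measurable fun ω i => Y i ω := measurable_pi_lambda _ hY
  have hev : ∀ i, Measurable fun w : Measure ℝ≥0 × (ℕ → ℝ≥0) => w.2 i := fun i => by fun_prop
  -- the properties of the cuts under their conditional law
  have hvoid : ∀ᵐ ω ∂P, ∀ q q' : ℚ≥0,
      (condDistrib (fun ω i => Y i ω) M P (M ω)).real {y | ∀ i, y i ∉ Ico (q : ℝ≥0) q'} =
        Real.exp (-(rate (M ω) (Ico (q : ℝ≥0) q')).toReal) :=
    ae_all_iff.2 fun q => ae_all_iff.2 fun q' =>
      condDistrib_void hM hY h measurableSet_Ico (Metric.isBounded_Ico _ _)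
  have hmono' : ∀ᵐ ω ∂P, ∀ᵐ y ∂condDistrib (fun ω i => Y i ω) M P (M ω), Monotone y := by
    have hS : MeasurableSet {w : Measure ℝ≥0 × (ℕ → ℝ≥0) | ∀ i j, i ≤ j → w.2 i ≤ w.2 j} := by
      simp only [ofPred_forall]
      exact .iInter fun i => .iInter fun j => .iInter fun _ => measurableSet_le (hev i) (hev j)
    refine (ae_iff_ae_condDistrib hM hYm hS).1 ?_
    filter_upwards [hmono] with ω hω i j hij using hω.monotone hij
  -- there are finitely many cuts in each bounded interval, and none at the root
  have hfin : ∀ᵐ ω ∂P, ∀ n : ℕ, {i | Y i ω ∈ Icc (0 : ℝ≥0) n}.Finite := by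
    refine ae_all_iff.2 fun n => ?_
    have hS : MeasurableSet {w : Measure ℝ≥0 × (ℕ → ℝ≥0) |
        ∃ k : ℕ, {i | w.2 i ∈ Icc (0 : ℝ≥0) n}.encard = k} := by
      simp only [ofPred_exists]
      exact .iUnion fun k => measurable_snd (measurableSet_encard_eq measurableSet_Icc k)
    have := (ae_iff_ae_condDistrib hM hYm (P := P) hS).2 ?_
    · filter_upwards [this] with ω ⟨k, hk⟩ using finite_of_encard_eq_coe hk
    · filter_upwards [ae_all_iff.2 fun k => condDistrib_encard hM hY h
        (measurableSet_Icc (a := (0 : ℝ≥0)) (b := n)) (Metric.isBounded_Icc _ _) k] with ω hω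
      filter_upwards [ae_finite_of_poisson measurableSet_Icc hω] with y hy
      exact ⟨_, hy.encard_eq_coe⟩
  have hpos : ∀ᵐ ω ∂P, 0 < Y 0 ω := by
    have hS : MeasurableSet {w : Measure ℝ≥0 × (ℕ → ℝ≥0) | 0 < w.2 0} :=
      measurableSet_lt measurable_const (hev 0)
    refine (ae_iff_ae_condDistrib hM hYm hS).2 ?_
    filter_upwards [condDistrib_void hM hY h (measurableSet_singleton 0)
      Bornology.isBounded_singleton] with ω hω
    rw [measure_singleton, ENNReal.toReal_zero, neg_zero, Real.exp_zero] at hω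
    have hSm : MeasurableSet {y : ℕ → ℝ≥0 | ∀ i, y i ∉ ({0} : Set ℝ≥0)} := by
      simp only [ofPred_forall]
      exact .iInter fun i => (measurable_pi_apply i) (measurableSet_singleton 0).compl
    have h1 : condDistrib (fun ω i => Y i ω) M P (M ω) {y | ∀ i, y i ∉ ({0} : Set ℝ≥0)} = 1 := by
      rwa [measureReal_def, ENNReal.toReal_eq_one_iff] at hω
    filter_upwards [(mem_ae_iff_prob_eq_one hSm).2 h1] with y hy
    exact pos_iff_ne_zero.2 (hy 0)
  have hlength : ∀ᵐ ω ∂P, 0 < Y 0 ω → ∑' k, ((((cumul univ (M ω, Y (k + 1) ω) -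
      cumul univ (M ω, Y k ω)) / cumul univ (M ω, Y (k + 1) ω)).toNNReal : ℝ≥0) : ℝ≥0∞) *
        ((Y (k + 1) ω - Y k ω : ℝ≥0) : ℝ≥0∞) ≠ ∞ := by
    have h0 : MeasurableSet {w : Measure ℝ≥0 × (ℕ → ℝ≥0) | 0 < w.2 0} :=
      measurableSet_lt measurable_const (hev 0)
    refine (ae_iff_ae_condDistrib hM hYm
      (h0.imp (measurable_sum_length (measurableSet_singleton ∞).compl))).2 ?_
    filter_upwards [hgood, hvoid, hmono'] with ω hg hv hm
    filter_upwards [hm, ae_sum_length hg hm fun s t _ => void_le_voidProb hg hv s t]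
      with y hy hsum h0
    simpa only [weight_eq_cumul hg hy, mem_compl_iff, mem_singleton_iff] using hsum h0
  have hsq : ∀ᵐ ω ∂P, 0 < Y 0 ω → (∀ n : ℕ, ∃ i, (n : ℝ≥0) ≤ Y i ω) →
      ∑' k, cumul univ (M ω, Y k ω) * ((((cumul univ (M ω, Y (k + 1) ω) -
        cumul univ (M ω, Y k ω)) / cumul univ (M ω, Y (k + 1) ω)).toNNReal : ℝ≥0) : ℝ≥0∞) ^ 2
          ≠ ∞ := by
    have h0 : MeasurableSet {w : Measure ℝ≥0 × (ℕ → ℝ≥0) | 0 < w.2 0} :=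
      measurableSet_lt measurable_const (hev 0)
    have h1 : MeasurableSet {w : Measure ℝ≥0 × (ℕ → ℝ≥0) | ∀ n : ℕ, ∃ i, (n : ℝ≥0) ≤ w.2 i} := by
      simp only [ofPred_forall, ofPred_exists]
      exact .iInter fun n => .iUnion fun i => measurableSet_le measurable_const (hev i)
    refine (ae_iff_ae_condDistrib hM hYm
      (h0.imp (h1.imp (measurable_sum_sq (measurableSet_singleton ∞).compl)))).2 ?_
    filter_upwards [hgood, hvoid, hmono', hclose] with ω hg hv hm hc
    filter_upwards [hm, ae_sum_sq hg hm (fun s t _ => void_le_voidProb hg hv s t) hc]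
      with y hy hsum h0 h1
    have hlim : Tendsto y atTop atTop := tendsto_atTop_atTop_of_monotone hy fun b => by
      obtain ⟨n, hn⟩ := exists_nat_ge b
      exact (h1 n).imp fun i hi => hn.trans hi
    simpa only [weight_eq_cumul hg hy, hg.cumul_univ, mem_compl_iff, mem_singleton_iff]
      using hsum h0 hlim
  filter_upwards [hmono, hgood, hfin, hpos, hlength, hsq] with ω hm hg hf h0 hl hs
  have hunb : ∀ n : ℕ, ∃ i, (n : ℝ≥0) ≤ Y i ω := by
    intro n
    by_contra! hlt
    exact infinite_univ ((hf n).subset fun i _ => ⟨zero_le, (hlt i).le⟩)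
  refine ⟨hm, tendsto_atTop_atTop_of_monotone hm.monotone fun b => ?_, h0, ?_, ?_⟩
  · obtain ⟨n, hn⟩ := exists_nat_ge b
    exact (hunb n).imp fun i hi => hn.trans hi
  · simpa only [weight_eq_cumul hg hm.monotone] using hl h0
  · simpa only [weight_eq_cumul hg hm.monotone, hg.cumul_univ] using hs h0 hunb

end Cuts

/-! ### The glue points under their conditional law -/

section InfinitePi

theorem generateFrom_range_Iic :
    MeasurableSpace.generateFrom (range fun q : ℚ≥0 => Iic (q : ℝ≥0)) =
      (inferInstance : MeasurableSpace ℝ≥0) := by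
  refine le_antisymm (MeasurableSpace.generateFrom_le ?_) ?_
  · rintro _ ⟨q, rfl⟩
    exact measurableSet_Iic
  · rw [BorelSpace.measurable_eq (α := ℝ≥0), borel_eq_generateFrom_Iic]
    refine MeasurableSpace.generateFrom_le ?_
    rintro _ ⟨b, rfl⟩
    have h : Iic b = ⋂ q : ℚ≥0, ⋂ _ : b < (q : ℝ≥0), Iic (q : ℝ≥0) := by
      ext x
      simp only [mem_Iic, mem_iInter]
      refine ⟨fun hx q hq => hx.trans hq.le,
        fun hx => le_of_forall_gt_imp_ge_of_dense fun c hc => ?_⟩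
      obtain ⟨q, h1, h2⟩ := exists_nnrat_btwn hc
      exact (hx q h1).trans h2.le
    rw [h]
    exact .iInter fun q => .iInter fun _ => MeasurableSpace.measurableSet_generateFrom ⟨q, rfl⟩

theorem isPiSystem_range_Iic : IsPiSystem (range fun q : ℚ≥0 => Iic (q : ℝ≥0)) := by
  have h := isPiSystem_image_Iic (range fun q : ℚ≥0 => (q : ℝ≥0))
  rwa [← range_comp] at h

/-- A probability measure on sequences is a given product measure as soon as it agrees with it on
the boxes with rational bounds. -/
theorem eq_infinitePi_of_Iic {ρ : Measure (ℕ → ℝ≥0)} [IsProbabilityMeasure ρ]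
    {ν : ℕ → Measure ℝ≥0} [∀ k, IsProbabilityMeasure (ν k)]
    (h : ∀ k (q : Fin k → ℚ≥0), ρ.real {z | ∀ j : Fin k, z j ∈ Iic (q j : ℝ≥0)} =
      ∏ j : Fin k, (ν j).real (Iic (q j : ℝ≥0))) :
    ρ = Measure.infinitePi ν := by
  have hpi : ∀ k, Measure.pi (fun j : Fin k => ν j) =
      ρ.map fun (z : ℕ → ℝ≥0) (j : Fin k) => z j := by
    intro k
    have hm : Measurable fun (z : ℕ → ℝ≥0) (j : Fin k) => z j := by fun_prop
    refine Measure.pi_eq_generateFrom (fun _ => generateFrom_range_Iic)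
      (fun _ => isPiSystem_range_Iic) (fun j => ⟨fun n => Iic (n : ℝ≥0), fun n => ⟨n, by simp⟩,
        fun n => measure_lt_top _ _, ?_⟩) fun s hs => ?_
    · refine eq_univ_of_forall fun x => ?_
      obtain ⟨n, hn⟩ := exists_nat_ge x
      exact mem_iUnion.2 ⟨n, hn⟩
    · choose q hq using hs
      obtain rfl : (fun j => Iic (q j : ℝ≥0)) = s := funext hq
      rw [Measure.map_apply hm (MeasurableSet.univ_pi fun j => measurableSet_Iic),
        ← ofReal_measureReal]
      have hset : (fun (z : ℕ → ℝ≥0) (j : Fin k) => z j) ⁻¹' (univ.pi fun j => Iic (q j : ℝ≥0)) =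
          {z | ∀ j : Fin k, z j ∈ Iic (q j : ℝ≥0)} := by
        ext z
        simp [Pi.le_def]
      rw [hset, h, ENNReal.ofReal_prod_of_nonneg fun _ _ => measureReal_nonneg]
      exact Finset.prod_congr rfl fun j _ => ofReal_measureReal
  refine Measure.eq_infinitePi _ fun s t ht => ?_
  classical
  obtain ⟨k, hk⟩ : ∃ k, ∀ i ∈ s, i < k := ⟨s.sup id + 1, fun i hi => Nat.lt_succ_of_le
    (Finset.le_sup (f := id) hi)⟩
  have hm : Measurable fun (z : ℕ → ℝ≥0) (j : Fin k) => z j := by fun_prop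
  have ht' : ∀ j : Fin k, MeasurableSet (if (j : ℕ) ∈ s then t j else univ) := fun j => by
    split_ifs
    exacts [ht _, MeasurableSet.univ]
  have hset : Set.pi s t = (fun (z : ℕ → ℝ≥0) (j : Fin k) => z j) ⁻¹'
      (univ.pi fun j => if (j : ℕ) ∈ s then t j else univ) := by
    ext z
    simp only [Set.mem_pi, mem_preimage, mem_univ, true_imp_iff, Finset.mem_coe]
    refine ⟨fun hz j => ?_, fun hz i hi => ?_⟩
    · split_ifs with hj
      exacts [hz _ hj, mem_univ _]
    · simpa only [if_pos hi] using hz ⟨i, hk i hi⟩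
  rw [hset, ← Measure.map_apply hm (MeasurableSet.univ_pi ht'), ← hpi, Measure.pi_pi,
    Fin.prod_univ_eq_prod_range (fun j => ν j (if j ∈ s then t j else univ)) k,
    ← Finset.prod_subset (s₁ := s) (fun i hi => Finset.mem_range.2 (hk i hi))]
  · exact Finset.prod_congr rfl fun i hi => by rw [if_pos hi]
  · intro i _ hi
    rw [if_neg hi, measure_univ]

end InfinitePi

section CondKernel

/-- The pairs `(μ, y)` for which the conditional law `μ[|Icc 0 y]` makes sense. -/
def condDomain : Set (Measure ℝ≥0 × ℝ≥0) :=
  {w | (∀ n : ℕ, w.1 (Icc 0 (n : ℝ≥0)) ≠ ∞) ∧ cumul univ w ≠ 0}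

theorem measurableSet_condDomain : MeasurableSet condDomain := by
  have h1 : MeasurableSet {w : Measure ℝ≥0 × ℝ≥0 | ∀ n : ℕ, w.1 (Icc 0 (n : ℝ≥0)) ≠ ∞} := by
    simp only [ofPred_forall]
    exact .iInter fun n => ((Measure.measurable_coe measurableSet_Icc).comp measurable_fst)
      (measurableSet_singleton ∞).compl
  exact h1.inter (measurable_cumul MeasurableSet.univ (measurableSet_singleton 0).compl)

theorem ne_top_of_mem_condDomain {w : Measure ℝ≥0 × ℝ≥0} (hw : w ∈ condDomain) (l : ℝ≥0) :
    w.1 (Icc 0 l) ≠ ∞ := by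
  obtain ⟨n, hn⟩ := exists_nat_ge l
  exact ((measure_mono (Icc_subset_Icc_right hn)).trans_lt (hw.1 n).lt_top).ne

open Classical in
/-- The kernel `(μ, y) ↦ μ[|Icc 0 y]`, set to a Dirac mass where this is not a probability
measure. -/
noncomputable def condIcc : Kernel (Measure ℝ≥0 × ℝ≥0) ℝ≥0 where
  toFun w := if w ∈ condDomain then w.1[|Icc 0 w.2] else Measure.dirac 0
  measurable' := by
    refine Measure.measurable_of_measurable_coe _ fun s hs => ?_
    have h : (fun w : Measure ℝ≥0 × ℝ≥0 =>
        (if w ∈ condDomain then w.1[|Icc 0 w.2] else Measure.dirac 0) s) = fun w =>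
          if w ∈ condDomain then (cumul univ w)⁻¹ * cumul s w else Measure.dirac 0 s := by
      funext w
      split_ifs with hw
      · rw [cond_apply measurableSet_Icc, ← cumul_eq (ne_top_of_mem_condDomain hw) hs,
          ← inter_univ (Icc 0 w.2), ← cumul_eq (ne_top_of_mem_condDomain hw) MeasurableSet.univ]
      · rfl
    rw [h]
    exact Measurable.ite measurableSet_condDomain
      ((measurable_cumul MeasurableSet.univ).inv.mul (measurable_cumul hs)) measurable_const

theorem condIcc_apply {w : Measure ℝ≥0 × ℝ≥0} (hw : w ∈ condDomain) :
    condIcc w = w.1[|Icc 0 w.2] := if_pos hw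

instance : IsMarkovKernel condIcc where
  isProbabilityMeasure w := by
    by_cases hw : w ∈ condDomain
    · rw [condIcc_apply hw]
      refine cond_isProbabilityMeasure_of_finite ?_ (ne_top_of_mem_condDomain hw _)
      rw [← inter_univ (Icc 0 w.2), ← cumul_eq (ne_top_of_mem_condDomain hw) MeasurableSet.univ]
      exact hw.2
    · rw [show condIcc w = Measure.dirac 0 from if_neg hw]
      infer_instance

theorem IsGoodMass.condIcc_apply {μ : Measure ℝ≥0} (hμ : IsGoodMass μ) {y : ℝ≥0} (hy : 0 < y) :
    condIcc (μ, y) = μ[|Icc 0 y] :=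
  ICRT.condIcc_apply ⟨fun _ => hμ.ne_top _, by rw [hμ.cumul_univ]; exact hμ.pos hy⟩

end CondKernel

section Measurability

variable {β : Type*} [MeasurableSpace β]

theorem measurableSet_eventually {Q : ℕ → β → Prop} (h : ∀ k, MeasurableSet {b | Q k b}) :
    MeasurableSet {b | ∀ᶠ k in atTop, Q k b} := by
  simp only [eventually_atTop, ofPred_exists, ofPred_forall]
  exact .iUnion fun _ => .iInter fun k => .iInter fun _ => h k

theorem measurableSet_frequently {Q : ℕ → β → Prop} (h : ∀ k, MeasurableSet {b | Q k b}) :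
    MeasurableSet {b | ∃ᶠ k in atTop, Q k b} := by
  simp only [Filter.Frequently]
  exact (measurableSet_eventually fun k => (h k).compl).compl

/-- Being good is a measurable condition on laws depending measurably on a parameter, cuts and glue
points. -/
theorem measurableSet_isGoodGluing {p : ℕ → Kernel β ℝ≥0} [∀ k, IsMarkovKernel (p k)]
    {Y z : β → ℕ → ℝ≥0} (hY : Measurable Y) (hz : Measurable z) :
    MeasurableSet {b | IsGoodGluing (fun k => p k b) (Y b) (z b)} := by
  have hp : ∀ k {A : Set (β × ℝ≥0)}, MeasurableSet A → Measurable fun b => p k b {x | (b, x) ∈ A} :=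
    fun k A hA => Kernel.measurable_kernel_prodMk_left hA
  have hYz : ∀ {E : Type} [MeasurableSpace E], Measurable fun w : β × E => ((Y w.1, z w.1), w.2) :=
    fun {E} _ => by fun_prop
  have hproj : ∀ m k, Measurable fun w : β × ℝ≥0 => proj (Y w.1) (z w.1) m k w.2 := fun m k =>
    (measurable_proj m k).comp hYz
  have hheight : ∀ m k, Measurable fun w : β × ℝ≥0 => height (Y w.1) (z w.1) m k w.2 := fun m k =>
    (measurable_height m k).comp hYz
  have hraw : ∀ k, Measurable fun w : β × (ℝ≥0 × ℝ≥0) => rawDist (Y w.1) (z w.1) k w.2.1 w.2.2 :=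
    fun k => (measurable_rawDist k).comp hYz
  have hYi : ∀ i, Measurable fun w : β × ℝ≥0 => Y w.1 i := fun i => by fun_prop
  have h1 : MeasurableSet {b | ∀ k, z b k ≤ Y b k} := by
    simp only [ofPred_forall]
    exact .iInter fun k => measurableSet_le (by fun_prop) (by fun_prop)
  have h2 : MeasurableSet {b | ∀ m n i l, ∃ L, Tendsto
      (fun k => (p k b).real {x | proj (Y b) (z b) m k x ∈ cell (Y b) n i l}) atTop (𝓝 L)} := by
    simp only [ofPred_forall]
    refine .iInter fun m => .iInter fun n => .iInter fun i => .iInter fun l => ?_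
    refine measurableSet_exists_tendsto fun k => (hp k (A := {w | proj (Y w.1) (z w.1) m k w.2 ∈
      cell (Y w.1) n i l}) ?_).ennreal_toReal
    have hA : MeasurableSet {w : β × ℝ≥0 | ∀ j < i, Y w.1 j < proj (Y w.1) (z w.1) m k w.2} := by
      simp only [ofPred_forall]
      exact .iInter fun j => .iInter fun _ => measurableSet_lt (hYi j) (hproj m k)
    have hB : MeasurableSet {w : β × ℝ≥0 | proj (Y w.1) (z w.1) m k w.2 ≤ Y w.1 i} :=
      measurableSet_le (hproj m k) (hYi i)
    have hC : MeasurableSet {w : β × ℝ≥0 | ⌊n * proj (Y w.1) (z w.1) m k w.2⌋₊ = l} :=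
      (Nat.measurable_floor.comp ((hproj m k).const_mul _)) (measurableSet_singleton l)
    exact hA.inter (hB.inter hC)
  have h3 : MeasurableSet {b | ∀ j : ℕ, ∃ m, ∀ᶠ k in atTop,
      ∫⁻ x, height (Y b) (z b) m k x ∂p k b ≤ (j : ℝ≥0∞)⁻¹} := by
    simp only [ofPred_forall, ofPred_exists]
    exact .iInter fun j => .iUnion fun m => measurableSet_eventually fun k => measurableSet_le
      ((hheight m k).coe_nnreal_ennreal.lintegral_kernel_prod_right' (κ := p k)) measurable_const
  have h4 : MeasurableSet {b | ∀ (q q' : ℚ≥0) (j : ℕ), q < q' → ∃ m i : ℕ, ∀ᶠ k in atTop,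
      (i : ℝ≥0∞)⁻¹ ≤ p k b {x | proj (Y b) (z b) m k x ∈ Ioc (q : ℝ≥0) q' ∧
        height (Y b) (z b) m k x ≤ 1 / ((j : ℝ≥0) + 1)}} := by
    simp only [ofPred_forall, ofPred_exists]
    refine .iInter fun q => .iInter fun q' => .iInter fun j => .iInter fun _ => .iUnion fun m =>
      .iUnion fun i => measurableSet_eventually fun k => measurableSet_le measurable_const
        (hp k (A := {w | proj (Y w.1) (z w.1) m k w.2 ∈ Ioc (q : ℝ≥0) q' ∧
          height (Y w.1) (z w.1) m k w.2 ≤ 1 / ((j : ℝ≥0) + 1)}) ?_)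
    have hA : MeasurableSet {w : β × ℝ≥0 | height (Y w.1) (z w.1) m k w.2 ≤ 1 / ((j : ℝ≥0) + 1)} :=
      measurableSet_le (hheight m k) measurable_const
    exact (hproj m k measurableSet_Ioc).inter hA
  have h5 : MeasurableSet {b | ∀ n j : ℕ, ∃ i : ℕ, ∃ᶠ k in atTop,
      p k b {x | height (Y b) (z b) n k x < 1 / ((i : ℝ≥0) + 1)} ≤ (j : ℝ≥0∞)⁻¹} := by
    simp only [ofPred_forall, ofPred_exists]
    exact .iInter fun n => .iInter fun j => .iUnion fun i => measurableSet_frequently fun k =>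
      measurableSet_le (hp k (A := {w | height (Y w.1) (z w.1) n k w.2 < 1 / ((i : ℝ≥0) + 1)})
        (measurableSet_lt (hheight n k) measurable_const)) measurable_const
  have h6 : MeasurableSet {b | ∀ j : ℕ, ∃ i : ℕ, ∃ᶠ k in atTop, ((p k b).prod (p k b))
      {w | rawDist (Y b) (z b) k w.1 w.2 < (1 / ((i : ℝ≥0) + 1) : ℝ≥0)} ≤ (j : ℝ≥0∞)⁻¹} := by
    simp only [ofPred_forall, ofPred_exists, ← Kernel.prod_apply]
    exact .iInter fun j => .iUnion fun i => measurableSet_frequently fun k =>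
      measurableSet_le (Kernel.measurable_kernel_prodMk_left (κ := p k ×ₖ p k)
        (t := {w | rawDist (Y w.1) (z w.1) k w.2.1 w.2.2 < (1 / ((i : ℝ≥0) + 1) : ℝ≥0)})
        (measurableSet_lt (hraw k) measurable_const)) measurable_const
  convert h1.inter (h2.inter (h3.inter (h4.inter (h5.inter h6)))) using 1
  ext b
  exact ⟨fun h => ⟨h.1, h.2, h.3, h.4, h.5, h.6⟩, fun h => ⟨h.1, h.2.1, h.2.2.1, h.2.2.2.1,
    h.2.2.2.2.1, h.2.2.2.2.2⟩⟩

end Measurability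

section Glue

variable {Ω : Type*} {mΩ : MeasurableSpace Ω} {P : Measure Ω} [IsProbabilityMeasure P]
  {M : Ω → Measure ℝ≥0} {Y Z : ℕ → Ω → ℝ≥0}

/-- The conditional law of the glue points is a product measure. -/
theorem condDistrib_glue (hM : Measurable M) (hY : ∀ i, Measurable (Y i))
    (hZ : ∀ i, Measurable (Z i))
    (h : IsCondIndepWithLaws P (MeasurableSpace.comap (fun ω => (M ω, fun i => Y i ω))
      inferInstance) (fun i ω => (M ω)[|Icc 0 (Y i ω)]) Z)
    (hgood : ∀ᵐ ω ∂P, IsGoodMass (M ω)) (hcut : ∀ᵐ ω ∂P, IsGoodCut (M ω) fun i => Y i ω) :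
    ∀ᵐ ω ∂P, condDistrib (fun ω i => Z i ω) (fun ω => (M ω, fun i => Y i ω)) P
      (M ω, fun i => Y i ω) = Measure.infinitePi fun k => (M ω)[|Icc 0 (Y k ω)] := by
  have hbox : ∀ᵐ ω ∂P, ∀ k (q : Fin k → ℚ≥0),
      (condDistrib (fun ω i => Z i ω) (fun ω => (M ω, fun i => Y i ω)) P
        (M ω, fun i => Y i ω)).real {z | ∀ j : Fin k, z j ∈ Iic (q j : ℝ≥0)} =
          ∏ j : Fin k, ((M ω)[|Icc 0 (Y j ω)]).real (Iic (q j : ℝ≥0)) := by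
    refine ae_all_iff.2 fun k => ae_all_iff.2 fun q => ?_
    have hS : MeasurableSet {z : ℕ → ℝ≥0 | ∀ j : Fin k, z j ∈ Iic (q j : ℝ≥0)} := by
      simp only [ofPred_forall]
      exact .iInter fun j => measurable_pi_apply (X := fun _ : ℕ => ℝ≥0) (j : ℕ) measurableSet_Iic
    filter_upwards [h k (fun j => Iic (q j : ℝ≥0)) fun j => measurableSet_Iic,
      condDistrib_ae_eq_condExp (μ := P) (hM.prodMk (measurable_pi_lambda (fun ω i => Y i ω) hY))
        (measurable_pi_lambda (fun ω i => Z i ω) hZ) hS] with ω h1 h2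
    rw [h2]
    exact h1
  filter_upwards [hbox, hgood, hcut] with ω hω hg hc
  have := hg.isProbabilityMeasure hc
  exact eq_infinitePi_of_Iic hω

/-- The glue points are almost surely good. -/
theorem ae_isGoodGluing_of_isCondIndep (hM : Measurable M) (hY : ∀ i, Measurable (Y i))
    (hZ : ∀ i, Measurable (Z i))
    (h : IsCondIndepWithLaws P (MeasurableSpace.comap (fun ω => (M ω, fun i => Y i ω))
      inferInstance) (fun i ω => (M ω)[|Icc 0 (Y i ω)]) Z)
    (hgood : ∀ᵐ ω ∂P, IsGoodMass (M ω)) (hcut : ∀ᵐ ω ∂P, IsGoodCut (M ω) fun i => Y i ω) :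
    ∀ᵐ ω ∂P, IsGoodGluing (fun k => (M ω)[|Icc 0 (Y k ω)]) (fun i => Y i ω) fun i => Z i ω := by
  let p : ℕ → Kernel ((Measure ℝ≥0 × (ℕ → ℝ≥0)) × (ℕ → ℝ≥0)) ℝ≥0 := fun k =>
    condIcc.comap (fun w => (w.1.1, w.1.2 k)) (by fun_prop)
  have hS : MeasurableSet {w : (Measure ℝ≥0 × (ℕ → ℝ≥0)) × (ℕ → ℝ≥0) |
      IsGoodGluing (fun k => p k w) w.1.2 w.2} :=
    measurableSet_isGoodGluing (by fun_prop) (by fun_prop)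
  have hp : ∀ᵐ ω ∂P, ∀ z, (fun k => p k ((M ω, fun i => Y i ω), z)) =
      fun k => (M ω)[|Icc 0 (Y k ω)] := by
    filter_upwards [hgood, hcut] with ω hg hc z
    exact funext fun k => hg.condIcc_apply (hc.cut_pos k)
  have hae := (ae_iff_ae_condDistrib (P := P)
    (hM.prodMk (measurable_pi_lambda (fun ω i => Y i ω) hY))
    (measurable_pi_lambda (fun ω i => Z i ω) hZ) hS).2 ?_
  · filter_upwards [hae, hp] with ω h1 h2
    rw [← h2 fun i => Z i ω]
    exact h1
  · filter_upwards [hp, hgood, hcut, condDistrib_glue hM hY hZ h hgood hcut] with ω h1 hg hc h2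
    rw [h2]
    filter_upwards [ae_isGoodGluing hg hc] with z hz
    rw [← h1 z] at hz
    exact hz

end Glue

end ICRT

theorem theorem1 {Ω : Type*} [MeasurableSpace Ω] (P : Measure Ω) [IsProbabilityMeasure P]
    (θ : ℕ → ℝ≥0) (hθ : IsICRTParameter θ) (X Y Z : ℕ → Ω → ℝ≥0)
    (h : IsICRTConstruction P θ X Y Z) :
    ∀ᵐ ω ∂P, ∃ S : StickBreaking, S.cut = (fun i => Y i ω) ∧ S.glue = (fun i => Z i ω) ∧
      ∃ p : ProbabilityMeasure S.Tree,
        (∃ q : ℝ≥0 → ProbabilityMeasure S.Tree,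
          (∀ l, 0 < l → (q l : Measure S.Tree) =
            ((massMeasure θ fun i => X i ω)[|Icc 0 l]).map S.toTree) ∧
          Tendsto q atTop (𝓝 p)) ∧
        (p : Measure S.Tree).support = univ ∧
        (∀ x, (p : Measure S.Tree) {x} = 0) ∧
        ∀ᵐ x ∂(p : Measure S.Tree), x ∈ S.leaves := by
  have hM : Measurable fun ω => massMeasure θ fun i => X i ω :=
    ICRT.measurable_massMeasure.comp (measurable_pi_lambda (fun ω i => X i ω) h.measurable_X)
  have hgood := ICRT.ae_isGoodMass hθ h.measurable_X h.indep_X h.law_X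
  have hcut := ICRT.ae_isGoodCut hM h.measurable_Y h.poisson_Y h.strictMono_Y hgood
    (ICRT.ae_lintegral_close_ne_top hθ h.measurable_X h.indep_X h.law_X)
  filter_upwards [hgood, hcut, ICRT.ae_isGoodGluing_of_isCondIndep hM h.measurable_Y
    h.measurable_Z h.law_Z hgood hcut] with ω hg hc hz
  exact ICRT.exists_limit hg hc hz
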